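/- **Setting.** Let $h,\kappa\in\mathbb C$ be nonzero, let $\alpha_1,\alpha_2,\dots,\eta\in\mathbb C$, and let $K\supseteq\mathbb C$ be a field of functions of two times, i.e. a field with two $\mathbb C$-linear derivations $\partial_1,\partial_2$ and elements $t_1,t_2$ with $\partial_it_j=\delta_{ij}$ (for example $\mathbb C(t_1,t_2)$, or the meromorphic functions on a domain of $\mathbb C^2$). Let $q_1,p_1,q_2,p_2$ be quantum canonical variables, $[q_i,p_j]=\delta_{ij}h$, $[q_i,q_j]=[p_i,p_j]=0$, commuting with $K$, where $[A,B]=AB-BA$. For noncommutative polynomials $H_1,H_2$ in $q_1,p_1,q_2,p_2$ with coefficients in $K$, the quantum Hamiltonian system with Hamiltonians $H_1,H_2$ is $$dv=\kappa[H_1,v]\,dt_1+\kappa[H_2,v]\,dt_2,\qquad v=q_1,p_1,q_2,p_2,$$ so that $\frac{df}{dt_i}=\kappa[H_i,f]+\frac{\partial f}{\partial t_i}$ for every $f$ depending on the canonical variables and on $t_1,t_2$. (The constant $\kappa$ only normalizes the Hamiltonians; $\kappa=-1/h$ is the Heisenberg normalization $\frac{dv}{dt_i}=\frac1h[v,H_i]$.)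 A transformation $r$ expresses $q_1,p_1,q_2,p_2$ through new canonical variables $x_1,y_1,x_2,y_2$ ($[x_i,y_j]=\delta_{ij}h$, $[x_i,x_j]=[y_i,y_j]=0$), their inverses and $t_1,t_2$. It transforms the system into a Hamiltonian system with polynomial Hamiltonians if there are noncommutative polynomials $G_1,G_2$ in $x_1,y_1,x_2,y_2$ over $K$ such that the evolution $\frac{df}{dt_i}=\kappa[G_i,f]+\frac{\partial f}{\partial t_i}$ of the new variables induces the given system for $q_1,p_1,q_2,p_2$, i.e. $\kappa[G_i,r(v)]+\frac{\partial r(v)}{\partial t_i}=\kappa[r(H_i),r(v)]$ for $v=q_1,p_1,q_2,p_2$ and $i=1,2$. **Theorem.** Consider any of the seven cases below, with the transformations $r_i$, the constant $S$ and the polynomials $\mathcal H_1,\mathcal H_2$ given there. Assume $S\ne0$, and moreover $\alpha_1\neq\alpha_2$ in case G(1,1,1,1,1), $\alpha_3\ne\alpha_4$ and $\eta\neq0$ in case G(1,1,1,2), and $\eta\ne0$ in case G(2,3). Then $\mathcal H_1,\mathcal H_2$ have total degree at most $5$, and for noncommutative polynomials $H_1,H_2$ of total degree at most $5$ in $q_1,p_1,q_2,p_2$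 the following are equivalent: (i) each $r_i$ of the case transforms the system with Hamiltonians $H_1,H_2$ again into a Hamiltonian system with polynomial Hamiltonians; (ii) $H_1=-\frac1{\kappa h}\mathcal H_1+c_1$ and $H_2=-\frac1{\kappa h}\mathcal H_2+c_2$ for some $c_1,c_2\in K$. In particular exactly one system satisfies (i), and for $\kappa=-1/h$ its Hamiltonians are $\mathcal H_1,\mathcal H_2$. The transformations are listed as $r:(q_1;\,p_1;\,q_2;\,p_2)=(\dots)$. **(1) G(1,1,1,1,1).** For $j=1,2$: $r_j:\left(\frac1{x_1};\,-x_1^2y_1-x_1x_2y_2-\alpha_jx_1;\,\frac{x_2}{x_1};\,x_1y_2\right)$; $r_3:\left(-x_1y_1^2+\alpha_3y_1;\,\frac1{y_1};\,x_2;\,y_2\right)$; $r_4:\left(x_1;\,y_1;\,-x_2y_2^2+\alpha_4y_2;\,\frac1{y_2}\right)$; $r_5:\left(-x_1y_1^2-x_2+\alpha_5y_1+1;\,\frac1{y_1};\,x_2;\,\frac1{y_1}+y_2\right)$; $r_6:\left(-x_1y_1^2-\frac{t_1}{t_2}x_2+\alpha_6y_1+t_1;\,\frac1{y_1};\,x_2;\,\frac{t_1}{t_2}\frac1{y_1}+y_2\right)$.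 $S=h-\alpha_1-\alpha_2-\alpha_3-\alpha_4-\alpha_5-\alpha_6$, $$\begin{aligned}St_1(t_1-1)(t_1-t_2)\mathcal H_1={}&(t_2-t_1)\left(q_1^3p_1^2+2q_1^2q_2p_1p_2+q_1q_2^2p_2^2\right)+(t_1+1)(t_1-t_2)q_1^2p_1^2-2t_1(t_2-1)q_1q_2p_1p_2\\&+t_1(t_1-1)q_1q_2p_1^2+t_2(t_1-1)q_1q_2p_2^2-(h-\alpha_1-\alpha_2)(t_2-t_1)q_1(q_1p_1+q_2p_2)-t_1(t_1-t_2)q_1p_1^2\\&+\left(h(t_2-t_1)+(\alpha_1+\alpha_2)(t_1-t_2)+\alpha_3t_1(t_2-t_1)+\alpha_4t_2(t_1-1)-\alpha_5(t_1^2-t_1+t_2-t_1t_2)\right)q_1p_1\\&-\alpha_4t_2(t_1-1)q_1p_2-\alpha_3t_1(t_1-1)q_2p_1+\alpha_3t_1(t_2-1)q_2p_2+\alpha_1\alpha_2(t_2-t_1)q_1+\alpha_3t_1(t_1-t_2)p_1,\end{aligned}$$ $$\begin{aligned}St_2(t_2-1)(t_2-t_1)\mathcal H_2={}&(t_1-t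_2)q_2^3p_2^2-2(t_2-t_1)q_1q_2^2p_1p_2+(t_1-t_2)q_1^2q_2p_1^2+(t_2+1)(t_2-t_1)q_2^2p_2^2-2t_2(t_1-1)q_1q_2p_1p_2\\&+t_1(t_2-1)q_1q_2p_1^2+t_2(t_2-1)q_1q_2p_2^2+(h-\alpha_1-\alpha_2)(t_2-t_1)(q_1q_2p_1+q_2^2p_2)-t_2(t_2-t_1)q_2p_2^2\\&+\alpha_4t_2\left((t_1-1)q_1p_1-(t_2-1)q_1p_2\right)-\alpha_3t_1(t_2-1)q_2p_1\\&+\left(h(t_1-t_2)+(\alpha_1+\alpha_2)(t_2-t_1)+\alpha_3t_1(t_2-1)+\alpha_4t_2(t_1-t_2)-\alpha_5(t_1+t_2^2-t_2-t_1t_2)\right)q_2p_2\\&-\alpha_1\alpha_2(t_2-t_1)q_2+\alpha_4t_2(t_2-t_1)p_2.\end{aligned}$$ **(2) G(1,1,1,2).** $r_1,r_2:\left(\frac1{x_1};\,-x_1^2y_1-x_1x_2y_2-\alpha_jx_1;\,\frac{x_2}{x_1};\,x_1y_2\right)$ with $j=3$ for $r_1$ and $j=4$ for $r_2$; $r_3:\left(x_1;\,\eta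 x_1^{-2}(x_2-1)-\alpha_1x_1^{-1}+y_1;\,x_2;\,-\eta x_1^{-1}+y_2\right)$; $r_4:\left(x_1;\,y_1;\,-x_2y_2^2+\alpha_2y_2;\,\frac1{y_2}\right)$; $r_5:\left(-x_1y_1^2-\frac{t_1}{t_2}x_2+\alpha_5y_1+t_1;\,\frac1{y_1};\,x_2;\,\frac{t_1}{t_2}\frac1{y_1}+y_2\right)$. $S=h-\alpha_1+\alpha_2+\alpha_3+\alpha_4+\alpha_5$, $$\begin{aligned}St_1^2\mathcal H_1={}&q_1^3p_1^2+2q_1^2q_2p_1p_2+q_1q_2^2p_2^2-t_1q_1^2p_1^2-t_2q_1q_2p_2^2+(\alpha_3+\alpha_4-h)(q_1^2p_1+q_1q_2p_2)\\&+(\eta+(2h-\alpha_1)t_1)q_1p_1+\alpha_2t_2q_1p_2+\eta t_1q_2p_1+\eta(1-t_2)q_2p_2+\alpha_3\alpha_4q_1-\eta t_1p_1,\end{aligned}$$ $$\begin{aligned}St_2t_1(t_2-1)\mathcal H_2={}&t_1(q_1^2q_2p_1^2+q_2^3p_2^2+2q_1q_2^2p_1p_2)+t_2(t_2-1)q_1q_2p_2^2-t_1(2t_2q_1q_2p_1p_2+(t_2+1)q_2^2p_2^2)\\&+(\alpha_3+\alpha_4-h)t_1(q_1q_2p_1+q_2^2p_2)+t_1t_2q_2p_2^2+\alpha_2t_1t_2q_1p_1+\alpha_2t_2(1-t_2)q_1p_2+\eta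 t_1(1-t_2)q_2p_1\\&+\left(t_1(-\alpha_1(t_2-1)+\alpha_2t_2-\alpha_3-\alpha_4+(2t_2-1)h)+\eta t_2(t_2-1)\right)q_2p_2+\alpha_3\alpha_4t_1q_2-\alpha_2t_1t_2p_2.\end{aligned}$$ **(3) G(1,1,3).** $r_1:\left(-x_1y_1^2-x_2y_1y_2+\alpha_1y_1;\,\frac1{y_1};\,x_2y_1;\,\frac{y_2}{y_1}\right)$; $r_2:\left(\frac1{x_1};\,-x_1^2y_1-\alpha_2x_1;\,x_2;\,y_2\right)$; $r_3:\left(x_1;\,y_1;\,\frac1{x_2};\,-x_2^2y_2-\alpha_3x_2\right)$; $r_4:\left(-x_1y_1^2-x_2y_1y_2+\frac2{y_1}(y_2+1)+\alpha_4y_1-2t_1;\,\frac1{y_1};\,x_2y_1+\frac2{y_1}(y_2+1)-2t_2;\,\frac{y_2}{y_1}\right)$. $S=h-\alpha_1-\alpha_2-\alpha_3-\alpha_4$, $$\begin{aligned}S(t_1-t_2)\mathcal H_1={}&q_1^2p_1p_2+q_2^2p_1p_2-2q_1q_2p_1p_2+(t_1-t_2)(q_1^2p_1-2q_1p_1^2-2q_2p_1p_2)+(2t_1^2-2t_1t_2-\alpha_3)q_1p_1\\&+\alpha_2q_1p_2+\alpha_3q_2p_1-\alpha_2q_2p_2+\alpha_2(t_1-t_2)q_1+2\alpha_1(t_1-t_2)p_1,\end{aligned}$$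 $$\begin{aligned}S(t_2-t_1)\mathcal H_2={}&q_1^2p_1p_2+q_2^2p_1p_2-2q_1q_2p_1p_2-(t_1-t_2)(q_2^2p_2-2q_2p_2^2-2q_1p_1p_2)-\alpha_3q_1p_1+\alpha_2q_1p_2+\alpha_3q_2p_1\\&-(2t_1t_2-2t_2^2+\alpha_2)q_2p_2-\alpha_3(t_1-t_2)q_2-2\alpha_1(t_1-t_2)p_2.\end{aligned}$$ **(4) G(1,2,2).** $r_1:\left(\frac1{x_1};\,-x_1^2y_1-\alpha_1x_1;\,x_2;\,y_2\right)$; $r_2:\left(\frac1{x_1};\,-x_1^2y_1-\alpha_2x_1-y_2+1;\,\frac1{x_1}+x_2;\,y_2\right)$; $r_3:\left(x_1;\,y_1;\,\frac1{x_2};\,-x_2^2y_2-\alpha_3x_2\right)$; $r_4:\left(x_1;\,-\frac{t_2}{t_1}x_1^{-2}y_2-2x_2x_1^{-1}y_2-t_1x_1^{-2}+2\alpha_4x_1^{-1}+y_1;\,x_1^2x_2+\frac{t_2}{t_1}x_1;\,x_1^{-2}y_2\right)$. $S=2h+\alpha_1+\alpha_2+\alpha_3+2\alpha_4$, $$\begin{aligned}St_1(t_1-t_2)\mathcal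 H_1={}&(t_1-t_2)q_1^2p_1^2+2t_1q_1q_2p_1p_2-t_2q_1^2p_1p_2-t_1q_2^2p_1p_2+(t_2-t_1)q_1^2p_1\\&+((\alpha_1+\alpha_2+\alpha_3)t_1-(\alpha_1+\alpha_2)t_2)q_1p_1-\alpha_1t_2q_1p_2-\alpha_3t_1q_2p_1+\alpha_1t_1q_2p_2-\alpha_1(t_1-t_2)q_1+t_1(t_1-t_2)p_1,\end{aligned}$$ $$\begin{aligned}St_2(t_1-t_2)\mathcal H_2={}&(t_1-t_2)q_2^2p_2^2-2t_2q_1q_2p_1p_2+t_2q_1^2p_1p_2+t_1q_2^2p_1p_2+(t_2-t_1)q_2^2p_2-\alpha_3t_2q_1p_1+\alpha_1t_2q_1p_2+\alpha_3t_1q_2p_1\\&+((\alpha_2+\alpha_3)t_1-(\alpha_1+\alpha_2+\alpha_3)t_2)q_2p_2-\alpha_3(t_1-t_2)q_2+t_2(t_1-t_2)p_2.\end{aligned}$$ **(5) G(1,4).** $r_1:\left(\frac1{x_1};\,-x_1^2y_1-\alpha_1x_1;\,x_2;\,y_2\right)$; $r_2:\left(x_1;\,y_1;\,\frac1{x_2};\,-x_2^2y_2-\alpha_2x_2\right)$;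 $r_3:\left(\frac1{x_1};\,-x_1^2y_1+2x_1x_2y_2-x_1^{-2}y_2+2x_1^{-2}-\alpha_3x_1+\frac{t_1-t_2}2y_2+t_1;\,x_1^2x_2+\frac{t_1-t_2}2x_1+\frac1{x_1};\,x_1^{-2}y_2\right)$. $S=2h+\alpha_1+\alpha_2+\alpha_3$, $$\begin{aligned}S(t_1-t_2)\mathcal H_1={}&-q_1^2p_1p_2-q_2^2p_1p_2+2q_1q_2p_1p_2+(t_2-t_1)q_1^2p_1+\alpha_2q_1p_1-\alpha_1q_1p_2-\alpha_2q_2p_1+\alpha_1q_2p_2\\&+\tfrac12(t_1-t_2)p_1(p_1+p_2)-\alpha_1(t_1-t_2)q_1-\tfrac12t_1(t_1-t_2)p_1,\end{aligned}$$ $$\begin{aligned}S(t_1-t_2)\mathcal H_2={}&q_1^2p_1p_2+q_2^2p_1p_2-2q_1q_2p_1p_2+(t_2-t_1)q_2^2p_2-\alpha_2q_1p_1+\alpha_1q_1p_2+\alpha_2q_2p_1-\alpha_1q_2p_2\\&+\tfrac12(t_1-t_2)(p_1p_2+p_2^2)-\alpha_2(t_1-t_2)q_2-\tfrac12t_2(t_1-t_2)p_2.\end{aligned}$$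 **(6) G(2,3).** Put $\beta=1+\alpha_1-\alpha_2+2\alpha_3$. $r_1:\left(\frac1{x_1};\,-x_1^2y_1-x_1x_2y_2-\alpha_1x_1;\,\frac{x_2}{x_1};\,x_1y_2\right)$; $r_2:\left(\frac{x_1}{x_2};\,x_2y_1;\,\frac1{x_2};\,-x_2^2y_2-x_1x_2y_1-\alpha_1x_2\right)$; $r_3:\left(x_1;\,-\eta t_1\frac1{x_2}+y_1;\,x_2;\,\eta t_1\frac{x_1}{x_2^2}-\eta t_1t_2\frac1{x_2^2}+\alpha_2\frac1{x_2}+y_2\right)$; $r_4:\left(\frac1{x_1};\,-x_1^2y_1-x_1x_2y_2-(\alpha_1+\alpha_2)x_1-\eta t_1\frac{x_1}{x_2};\,\frac{x_2}{x_1};\,-\eta t_1t_2\frac{x_1^2}{x_2^2}+\eta t_1\frac{x_1}{x_2^2}+x_1y_2+\alpha_2\frac{x_1}{x_2}\right)$; $r_5:\left(\frac1{x_1};\,-x_1^2y_1-x_1x_2y_2-\beta x_1+\frac1{2x_1};\,\frac{x_2}{x_1};\,x_1y_2-\frac12\right)$; $r_6:\left(\frac{x_1}{x_2};\,\frac{x_1}{2x_2}+x_2y_1;\,\frac1{x_2};\,-x_2^2y_2-x_1x_2y_1-\beta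 x_2-\frac12\right)$. $S=1+3h+2\alpha_1+2\alpha_3$, $$\begin{aligned}St_1\mathcal H_1={}&q_2^2p_2^2-q_2p_1^2+\tfrac12q_1q_2p_1+\tfrac12q_2^2p_2-\eta t_1q_1p_2+(1+h+2\alpha_1-\alpha_2+2\alpha_3)q_2p_2+\tfrac12\alpha_1q_2-\eta t_1(p_1-t_2p_2),\end{aligned}$$ $$\begin{aligned}S\mathcal H_2={}&-\tfrac12q_1^2p_1-\tfrac12q_1q_2p_2+2q_2p_1p_2+q_1p_1^2+\tfrac12t_2q_1p_1+\tfrac12q_2p_1-t_2p_1^2\\&-\tfrac12\alpha_1q_1+(1+h+2\alpha_1-\alpha_2+2\alpha_3)p_1+\eta t_1p_2.\end{aligned}$$ **(7) G(5).** $r_1:\left(\frac1{x_1};\,-x_1^2y_1-x_1x_2y_2-\alpha_1x_1;\,\frac{x_2}{x_1};\,x_1y_2\right)$; $r_2:\left(\frac{x_1}{x_2};\,x_2y_1;\,\frac1{x_2};\,-x_1x_2y_1-x_2^2y_2-\alpha_1x_2\right)$; $r_3:\left(\frac1{x_1};\,-2\frac{x_2^2}{x_1^2}-x_1^2y_1-x_1x_2y_2-(\alpha_1-2\alpha_2)x_1+\frac2{x_1}-2t_2;\,\frac{x_2}{x_1};\,2\frac{x_2^3}{x_1^3}-4\frac{x_2}{x_1^2}+x_1y_2-2t_1\right)$;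 $r_4:\left(\frac{x_1}{x_2};\,2\frac{x_1}{x_2}-\frac2{x_2^2}+x_2y_1-2t_2;\,\frac1{x_2};\,-4\frac{x_1}{x_2^2}-x_1x_2y_1+\frac2{x_2^3}-x_2^2y_2-(\alpha_1-2\alpha_2)x_2-2t_1\right)$. $S=3h+2\alpha_1-2\alpha_2$, $$S\mathcal H_1=2q_1q_2p_1+q_2p_1^2+2q_2^2p_2-2q_1p_2+2t_2q_2p_1+2p_1p_2+2\alpha_1q_2+2t_1p_1+2t_2p_2,$$ $$\begin{aligned}S\mathcal H_2={}&q_2^2p_1^2+2q_1^2p_1+2q_1q_2p_2-q_1p_1^2+2q_2p_1p_2+2t_1q_2p_1+2t_2q_2p_2-t_2p_1^2+p_2^2+2\alpha_1q_1-2t_2^2p_1+2t_1p_2.\end{aligned}$$ A fraction $\frac ab$ (numerator and denominator always commute) stands for $ab^{-1}$. -/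

import Mathlib

open scoped TensorProduct

namespace QuantumGarnier

/-- The four canonical variables. On the original side they are written `q₁, p₁, q₂, p₂`; on the
side of a transformed chart the same four names stand for `x₁, y₁, x₂, y₂`. -/
inductive Var
  | q₁ | p₁ | q₂ | p₂

/-- The canonical symplectic pairing: `[u, v] = pairing u v * h` for canonical variables `u, v`. -/
def pairing : Var → Var → ℂ
  | .q₁, .p₁ => 1
  | .p₁, .q₁ => -1
  | .q₂, .p₂ => 1
  | .p₂, .q₂ => -1
  | _, _ => 0

/-- The canonical commutation relations `[qᵢ, pⱼ] = δᵢⱼ h`, `[qᵢ, qⱼ] = [pᵢ, pⱼ] = 0`. -/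
inductive WeylRel (h : ℂ) : FreeAlgebra ℂ Var → FreeAlgebra ℂ Var → Prop
  | comm (u v : Var) :
      WeylRel h
        (FreeAlgebra.ι ℂ u * FreeAlgebra.ι ℂ v - FreeAlgebra.ι ℂ v * FreeAlgebra.ι ℂ u)
        (algebraMap ℂ _ (pairing u v * h))

/-- The algebra of noncommutative polynomials in the canonical variables, with coefficients
in `ℂ` (a Weyl algebra). -/
abbrev Weyl (h : ℂ) : Type := RingQuot (WeylRel h)

/-- The canonical commutation relations together with a two-sided inverse of every canonical
variable: `Sum.inl v` is the variable `v` and `Sum.inr v` is its inverse. -/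
inductive LocRel (h : ℂ) : FreeAlgebra ℂ (Var ⊕ Var) → FreeAlgebra ℂ (Var ⊕ Var) → Prop
  | comm (u v : Var) :
      LocRel h
        (FreeAlgebra.ι ℂ (Sum.inl u) * FreeAlgebra.ι ℂ (Sum.inl v)
          - FreeAlgebra.ι ℂ (Sum.inl v) * FreeAlgebra.ι ℂ (Sum.inl u))
        (algebraMap ℂ _ (pairing u v * h))
  | mul_inv (u : Var) :
      LocRel h (FreeAlgebra.ι ℂ (Sum.inl u) * FreeAlgebra.ι ℂ (Sum.inr u)) 1
  | inv_mul (u : Var) :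
      LocRel h (FreeAlgebra.ι ℂ (Sum.inr u) * FreeAlgebra.ι ℂ (Sum.inl u)) 1

/-- The Weyl algebra with the canonical variables inverted. -/
abbrev Loc (h : ℂ) : Type := RingQuot (LocRel h)

section Coefficients

variable (K : Type*) [Field K] [Algebra ℂ K] (h : ℂ)

/-- Noncommutative polynomials in the canonical variables whose coefficients are functions of the
times, i.e. elements of `K`. -/
abbrev WeylK : Type _ := K ⊗[ℂ] Weyl h

/-- Noncommutative polynomials in the canonical variables and their inverses whose coefficients are
functions of the times. -/
abbrev LocK : Type _ := K ⊗[ℂ] Loc h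

/-- A canonical variable, as an element of `WeylK`. -/
def weylVar (v : Var) : WeylK K h :=
  1 ⊗ₜ[ℂ] RingQuot.mkAlgHom ℂ (WeylRel h) (FreeAlgebra.ι ℂ v)

/-- A canonical variable, as an element of `LocK`. -/
def locVar (v : Var) : LocK K h :=
  1 ⊗ₜ[ℂ] RingQuot.mkAlgHom ℂ (LocRel h) (FreeAlgebra.ι ℂ (Sum.inl v))

/-- The inverse of a canonical variable, as an element of `LocK`. -/
def locInv (v : Var) : LocK K h :=
  1 ⊗ₜ[ℂ] RingQuot.mkAlgHom ℂ (LocRel h) (FreeAlgebra.ι ℂ (Sum.inr v))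

variable {K h}

/-- The partial derivative with respect to a time variable, acting on the coefficients only (the
canonical variables being held fixed). -/
def partialTime (D : Derivation ℂ K K) : LocK K h →ₗ[ℂ] LocK K h :=
  LinearMap.rTensor (Loc h) (D : K →ₗ[ℂ] K)

/-- The commutator. -/
def comm {A : Type*} [Ring A] (a b : A) : A := a * b - b * a

/-- The expression `F`, a noncommutative polynomial in four letters, as an element of the algebra
of the canonical variables `q₁, p₁, q₂, p₂`. -/
noncomputable def toWeyl (h : ℂ) : FreeAlgebra K Var →ₐ[K] WeylK K h :=
  FreeAlgebra.lift K (weylVar K h)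

/-- Total degree at most `n`: a linear combination of words of length at most `n`. -/
def TotalDegreeLE (n : ℕ) (F : FreeAlgebra K Var) : Prop :=
  F ∈ Submodule.span K
    {w | ∃ l : List Var, l.length ≤ n ∧ w = (l.map (FreeAlgebra.ι K)).prod}

/-- A (time dependent) change of variables is given by the expressions `r v` of the old canonical
variables `v` through the new ones and their inverses. The flow of the old variables is
`dv/dt = κ [H, v]`, where `d/dt` is the evolution along the time with derivation `D`. It is
transformed into a Hamiltonian flow with a polynomial Hamiltonian when there is a noncommutative
polynomial `G` in the new variables such that the evolution `df/dt = κ [G, f] + ∂f/∂t` of the new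
variables induces `dv/dt = κ [H, v]` for the old variables. -/
def FlowTransformsToPolynomial (κ : ℂ) (D : Derivation ℂ K K) (r : Var → LocK K h)
    (H : FreeAlgebra K Var) : Prop :=
  ∃ G : FreeAlgebra K Var, ∀ v : Var,
    κ • comm (FreeAlgebra.lift K (locVar K h) G) (r v) + partialTime D (r v)
      = κ • comm (FreeAlgebra.lift K r H) (r v)

end Coefficients

/-- The seven systems. -/
inductive Kind
  | g11111 | g1112 | g113 | g122 | g14 | g23 | g5

/-- Four canonical variables `x₁, y₁, x₂, y₂` and their inverses `ix₁, iy₁, ix₂, iy₂`. -/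
structure Chart (A : Type*) where
  (x₁ y₁ x₂ y₂ ix₁ iy₁ ix₂ iy₂ : A)

/-- The new canonical variables and their inverses. -/
noncomputable def newChart (K : Type*) [Field K] [Algebra ℂ K] (h : ℂ) : Chart (LocK K h) :=
  ⟨locVar K h .q₁, locVar K h .p₁, locVar K h .q₂, locVar K h .p₂,
    locInv K h .q₁, locInv K h .p₁, locInv K h .q₂, locInv K h .p₂⟩

/-- The assignment of values to `q₁, p₁, q₂, p₂`, in this order. -/
def subst {A : Type*} (a b c d : A) : Var → A
  | .q₁ => a
  | .p₁ => b
  | .q₂ => c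
  | .p₂ => d

section Transformations

variable {K : Type*} [Field K] {A : Type*} [Ring A] [Algebra K A]

/-- Each list below consists of the quantum canonical transformations `r₁, r₂, …` of one system,
each written as the values of `q₁, p₁, q₂, p₂` (in this order) in terms of the new canonical
variables. The arguments are the parameters `a i` (for `αᵢ`), `η`, and the times. -/
def trans11111 (a : ℕ → K) (t₁ t₂ : K) : Chart A → List (Var → A)
  | ⟨x₁, y₁, x₂, y₂, ix₁, iy₁, _, iy₂⟩ =>
    [ subst ix₁ (-(x₁ ^ 2 * y₁) - x₁ * x₂ * y₂ - a 1 • x₁) (x₂ * ix₁) (x₁ * y₂),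
      subst ix₁ (-(x₁ ^ 2 * y₁) - x₁ * x₂ * y₂ - a 2 • x₁) (x₂ * ix₁) (x₁ * y₂),
      subst (-(x₁ * y₁ ^ 2) + a 3 • y₁) iy₁ x₂ y₂,
      subst x₁ y₁ (-(x₂ * y₂ ^ 2) + a 4 • y₂) iy₂,
      subst (-(x₁ * y₁ ^ 2) - x₂ + a 5 • y₁ + 1) iy₁ x₂ (iy₁ + y₂),
      subst (-(x₁ * y₁ ^ 2) - (t₁ / t₂) • x₂ + a 6 • y₁ + t₁ • 1) iy₁ x₂
        ((t₁ / t₂) • iy₁ + y₂) ]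

def trans1112 (a : ℕ → K) (η t₁ t₂ : K) : Chart A → List (Var → A)
  | ⟨x₁, y₁, x₂, y₂, ix₁, iy₁, _, iy₂⟩ =>
    [ subst ix₁ (-(x₁ ^ 2 * y₁) - x₁ * x₂ * y₂ - a 3 • x₁) (x₂ * ix₁) (x₁ * y₂),
      subst ix₁ (-(x₁ ^ 2 * y₁) - x₁ * x₂ * y₂ - a 4 • x₁) (x₂ * ix₁) (x₁ * y₂),
      subst x₁ (η • (ix₁ ^ 2 * (x₂ - 1)) - a 1 • ix₁ + y₁) x₂ (-(η • ix₁) + y₂),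
      subst x₁ y₁ (-(x₂ * y₂ ^ 2) + a 2 • y₂) iy₂,
      subst (-(x₁ * y₁ ^ 2) - (t₁ / t₂) • x₂ + a 5 • y₁ + t₁ • 1) iy₁ x₂
        ((t₁ / t₂) • iy₁ + y₂) ]

def trans113 (a : ℕ → K) (t₁ t₂ : K) : Chart A → List (Var → A)
  | ⟨x₁, y₁, x₂, y₂, ix₁, iy₁, ix₂, _⟩ =>
    [ subst (-(x₁ * y₁ ^ 2) - x₂ * y₁ * y₂ + a 1 • y₁) iy₁ (x₂ * y₁) (y₂ * iy₁),
      subst ix₁ (-(x₁ ^ 2 * y₁) - a 2 • x₁) x₂ y₂,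
      subst x₁ y₁ ix₂ (-(x₂ ^ 2 * y₂) - a 3 • x₂),
      subst (-(x₁ * y₁ ^ 2) - x₂ * y₁ * y₂ + 2 * iy₁ * (y₂ + 1) + a 4 • y₁ - (2 * t₁) • 1) iy₁
        (x₂ * y₁ + 2 * iy₁ * (y₂ + 1) - (2 * t₂) • 1) (y₂ * iy₁) ]

def trans122 (a : ℕ → K) (t₁ t₂ : K) : Chart A → List (Var → A)
  | ⟨x₁, y₁, x₂, y₂, ix₁, _, ix₂, _⟩ =>
    [ subst ix₁ (-(x₁ ^ 2 * y₁) - a 1 • x₁) x₂ y₂,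
      subst ix₁ (-(x₁ ^ 2 * y₁) - a 2 • x₁ - y₂ + 1) (ix₁ + x₂) y₂,
      subst x₁ y₁ ix₂ (-(x₂ ^ 2 * y₂) - a 3 • x₂),
      subst x₁
        (-((t₂ / t₁) • (ix₁ ^ 2 * y₂)) - 2 * x₂ * ix₁ * y₂ - t₁ • ix₁ ^ 2 + (2 * a 4) • ix₁ + y₁)
        (x₁ ^ 2 * x₂ + (t₂ / t₁) • x₁) (ix₁ ^ 2 * y₂) ]

def trans14 (a : ℕ → K) (t₁ t₂ : K) : Chart A → List (Var → A)
  | ⟨x₁, y₁, x₂, y₂, ix₁, _, ix₂, _⟩ =>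
    [ subst ix₁ (-(x₁ ^ 2 * y₁) - a 1 • x₁) x₂ y₂,
      subst x₁ y₁ ix₂ (-(x₂ ^ 2 * y₂) - a 2 • x₂),
      subst ix₁
        (-(x₁ ^ 2 * y₁) + 2 * x₁ * x₂ * y₂ - ix₁ ^ 2 * y₂ + 2 * ix₁ ^ 2 - a 3 • x₁
          + ((t₁ - t₂) / 2) • y₂ + t₁ • 1)
        (x₁ ^ 2 * x₂ + ((t₁ - t₂) / 2) • x₁ + ix₁) (ix₁ ^ 2 * y₂) ]

def trans23 (a : ℕ → K) (η t₁ t₂ : K) : Chart A → List (Var → A)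
  | ⟨x₁, y₁, x₂, y₂, ix₁, _, ix₂, _⟩ =>
    [ subst ix₁ (-(x₁ ^ 2 * y₁) - x₁ * x₂ * y₂ - a 1 • x₁) (x₂ * ix₁) (x₁ * y₂),
      subst (x₁ * ix₂) (x₂ * y₁) ix₂ (-(x₂ ^ 2 * y₂) - x₁ * x₂ * y₁ - a 1 • x₂),
      subst x₁ (-((η * t₁) • ix₂) + y₁) x₂
        ((η * t₁) • (x₁ * ix₂ ^ 2) - (η * t₁ * t₂) • ix₂ ^ 2 + a 2 • ix₂ + y₂),
      subst ix₁
        (-(x₁ ^ 2 * y₁) - x₁ * x₂ * y₂ - (a 1 + a 2) • x₁ - (η * t₁) • (x₁ * ix₂)) (x₂ * ix₁)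
        (-((η * t₁ * t₂) • (x₁ * ix₂) ^ 2) + (η * t₁) • (x₁ * ix₂ ^ 2) + x₁ * y₂
          + a 2 • (x₁ * ix₂)),
      subst ix₁
        (-(x₁ ^ 2 * y₁) - x₁ * x₂ * y₂ - (1 + a 1 - a 2 + 2 * a 3) • x₁ + (1 / 2 : K) • ix₁)
        (x₂ * ix₁) (x₁ * y₂ - (1 / 2 : K) • 1),
      subst (x₁ * ix₂) ((1 / 2 : K) • (x₁ * ix₂) + x₂ * y₁) ix₂
        (-(x₂ ^ 2 * y₂) - x₁ * x₂ * y₁ - (1 + a 1 - a 2 + 2 * a 3) • x₂ - (1 / 2 : K) • 1) ]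

def trans5 (a : ℕ → K) (t₁ t₂ : K) : Chart A → List (Var → A)
  | ⟨x₁, y₁, x₂, y₂, ix₁, _, ix₂, _⟩ =>
    [ subst ix₁ (-(x₁ ^ 2 * y₁) - x₁ * x₂ * y₂ - a 1 • x₁) (x₂ * ix₁) (x₁ * y₂),
      subst (x₁ * ix₂) (x₂ * y₁) ix₂ (-(x₁ * x₂ * y₁) - x₂ ^ 2 * y₂ - a 1 • x₂),
      subst ix₁
        (-(2 * (x₂ * ix₁) ^ 2) - x₁ ^ 2 * y₁ - x₁ * x₂ * y₂ - (a 1 - 2 * a 2) • x₁ + 2 * ix₁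
          - (2 * t₂) • 1)
        (x₂ * ix₁) (2 * (x₂ * ix₁) ^ 3 - 4 * ix₁ ^ 2 * x₂ + x₁ * y₂ - (2 * t₁) • 1),
      subst (x₁ * ix₂) (2 * x₁ * ix₂ - 2 * ix₂ ^ 2 + x₂ * y₁ - (2 * t₂) • 1) ix₂
        (-(4 * x₁ * ix₂ ^ 2) - x₁ * x₂ * y₁ + 2 * ix₂ ^ 3 - x₂ ^ 2 * y₂ - (a 1 - 2 * a 2) • x₂
          - (2 * t₁) • 1) ]

/-- The quantum canonical transformations of each system. -/
def transformations (k : Kind) (a : ℕ → K) (η t₁ t₂ : K) (c : Chart A) : List (Var → A) :=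
  match k with
  | .g11111 => trans11111 a t₁ t₂ c
  | .g1112 => trans1112 a η t₁ t₂ c
  | .g113 => trans113 a t₁ t₂ c
  | .g122 => trans122 a t₁ t₂ c
  | .g14 => trans14 a t₁ t₂ c
  | .g23 => trans23 a η t₁ t₂ c
  | .g5 => trans5 a t₁ t₂ c

end Transformations

section Hamiltonians

/-- The constant `s` in the common denominators of the two Hamiltonians. -/
def denom {R : Type*} [CommRing R] (k : Kind) (h : R) (a : ℕ → R) : R :=
  match k with
  | .g11111 => h - a 1 - a 2 - a 3 - a 4 - a 5 - a 6
  | .g1112 => h - a 1 + a 2 + a 3 + a 4 + a 5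
  | .g113 => h - a 1 - a 2 - a 3 - a 4
  | .g122 => 2 * h + a 1 + a 2 + a 3 + 2 * a 4
  | .g14 => 2 * h + a 1 + a 2 + a 3
  | .g23 => 1 + 3 * h + 2 * a 1 + 2 * a 3
  | .g5 => 3 * h + 2 * a 1 - 2 * a 2

/-- The nondegeneracy of the parameters: the denominator of the Hamiltonians does not vanish, the
transformations `r₁`, `r₂` of the first two systems are distinct, and `η` is nonzero in the two
systems in which it occurs. -/
def Nondegenerate (k : Kind) (h : ℂ) (α : ℕ → ℂ) (η : ℂ) : Prop :=
  denom k h α ≠ 0 ∧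
    match k with
    | .g11111 => α 1 ≠ α 2
    | .g1112 => α 3 ≠ α 4 ∧ η ≠ 0
    | .g23 => η ≠ 0
    | _ => True

variable {K : Type*} [Field K] {A : Type*} [Ring A] [Algebra K A]

/-- Each definition below gives the pair `H₁, H₂` of Hamiltonians of one system. -/
def ham11111 (h : K) (a : ℕ → K) (t₁ t₂ : K) (q₁ p₁ q₂ p₂ : A) : A × A :=
  (((denom .g11111 h a) * t₁ * (t₁ - 1) * (t₁ - t₂))⁻¹ •
    ((t₂ - t₁) • (q₁ ^ 3 * p₁ ^ 2) + (2 * (t₂ - t₁)) • (q₁ ^ 2 * q₂ * p₁ * p₂)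
      + (t₂ - t₁) • (q₁ * q₂ ^ 2 * p₂ ^ 2) + ((t₁ + 1) * (t₁ - t₂)) • (q₁ ^ 2 * p₁ ^ 2)
      - (2 * t₁ * (t₂ - 1)) • (q₁ * q₂ * p₁ * p₂) + (t₁ * (t₁ - 1)) • (q₁ * q₂ * p₁ ^ 2)
      + (t₂ * (t₁ - 1)) • (q₁ * q₂ * p₂ ^ 2)
      - ((h - a 1 - a 2) * (t₂ - t₁)) • (q₁ * (q₁ * p₁ + q₂ * p₂))
      - (t₁ * (t₁ - t₂)) • (q₁ * p₁ ^ 2)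
      + (h * (t₂ - t₁) + (a 1 + a 2) * (t₁ - t₂) + a 3 * t₁ * (t₂ - t₁) + a 4 * t₂ * (t₁ - 1)
          - a 5 * (t₁ ^ 2 - t₁ + t₂ - t₁ * t₂)) • (q₁ * p₁)
      - (a 4 * t₂ * (t₁ - 1)) • (q₁ * p₂) - (a 3 * t₁ * (t₁ - 1)) • (q₂ * p₁)
      + (a 3 * t₁ * (t₂ - 1)) • (q₂ * p₂) + (a 1 * a 2 * (t₂ - t₁)) • q₁
      + (a 3 * t₁ * (t₁ - t₂)) • p₁),
   ((denom .g11111 h a) * t₂ * (t₂ - 1) * (t₂ - t₁))⁻¹ •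
    ((t₁ - t₂) • (q₂ ^ 3 * p₂ ^ 2) - (2 * (t₂ - t₁)) • (q₁ * q₂ ^ 2 * p₁ * p₂)
      + (t₁ - t₂) • (q₁ ^ 2 * q₂ * p₁ ^ 2) + ((t₂ + 1) * (t₂ - t₁)) • (q₂ ^ 2 * p₂ ^ 2)
      - (2 * t₂ * (t₁ - 1)) • (q₁ * q₂ * p₁ * p₂) + (t₁ * (t₂ - 1)) • (q₁ * q₂ * p₁ ^ 2)
      + (t₂ * (t₂ - 1)) • (q₁ * q₂ * p₂ ^ 2)
      + ((h - a 1 - a 2) * (t₂ - t₁)) • (q₁ * q₂ * p₁ + q₂ ^ 2 * p₂)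
      - (t₂ * (t₂ - t₁)) • (q₂ * p₂ ^ 2)
      + (a 4 * t₂) • ((t₁ - 1) • (q₁ * p₁) - (t₂ - 1) • (q₁ * p₂))
      - (a 3 * t₁ * (t₂ - 1)) • (q₂ * p₁)
      + (h * (t₁ - t₂) + (a 1 + a 2) * (t₂ - t₁) + a 3 * t₁ * (t₂ - 1) + a 4 * t₂ * (t₁ - t₂)
          - a 5 * (t₁ + t₂ ^ 2 - t₂ - t₁ * t₂)) • (q₂ * p₂)
      - (a 1 * a 2 * (t₂ - t₁)) • q₂ + (a 4 * t₂ * (t₂ - t₁)) • p₂))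

def ham1112 (h : K) (a : ℕ → K) (η t₁ t₂ : K) (q₁ p₁ q₂ p₂ : A) : A × A :=
  (((denom .g1112 h a) * t₁ ^ 2)⁻¹ •
    (q₁ ^ 3 * p₁ ^ 2 + 2 * q₁ ^ 2 * q₂ * p₁ * p₂ + q₁ * q₂ ^ 2 * p₂ ^ 2
      - t₁ • (q₁ ^ 2 * p₁ ^ 2) - t₂ • (q₁ * q₂ * p₂ ^ 2)
      + (a 3 + a 4 - h) • (q₁ ^ 2 * p₁ + q₁ * q₂ * p₂)
      + (η + (2 * h - a 1) * t₁) • (q₁ * p₁) + (a 2 * t₂) • (q₁ * p₂) + (η * t₁) • (q₂ * p₁)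
      + (η * (1 - t₂)) • (q₂ * p₂) + (a 3 * a 4) • q₁ - (η * t₁) • p₁),
   ((denom .g1112 h a) * t₂ * t₁ * (t₂ - 1))⁻¹ •
    (t₁ • (q₁ ^ 2 * q₂ * p₁ ^ 2 + q₂ ^ 3 * p₂ ^ 2 + 2 * q₁ * q₂ ^ 2 * p₁ * p₂)
      + (t₂ * (t₂ - 1)) • (q₁ * q₂ * p₂ ^ 2)
      - t₁ • ((2 * t₂) • (q₁ * q₂ * p₁ * p₂) + (t₂ + 1) • (q₂ ^ 2 * p₂ ^ 2))
      + ((a 3 + a 4 - h) * t₁) • (q₁ * q₂ * p₁ + q₂ ^ 2 * p₂) + (t₁ * t₂) • (q₂ * p₂ ^ 2)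
      + (a 2 * t₁ * t₂) • (q₁ * p₁) + (a 2 * t₂ * (1 - t₂)) • (q₁ * p₂)
      + (η * t₁ * (1 - t₂)) • (q₂ * p₁)
      + (t₁ * (-(a 1 * (t₂ - 1)) + a 2 * t₂ - a 3 - a 4 + (2 * t₂ - 1) * h)
          + η * t₂ * (t₂ - 1)) • (q₂ * p₂)
      + (a 3 * a 4 * t₁) • q₂ - (a 2 * t₁ * t₂) • p₂))

def ham113 (h : K) (a : ℕ → K) (t₁ t₂ : K) (q₁ p₁ q₂ p₂ : A) : A × A :=
  (((denom .g113 h a) * (t₁ - t₂))⁻¹ •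
    (q₁ ^ 2 * p₁ * p₂ + q₂ ^ 2 * p₁ * p₂ - 2 * q₁ * q₂ * p₁ * p₂
      + (t₁ - t₂) • (q₁ ^ 2 * p₁ - 2 * q₁ * p₁ ^ 2 - 2 * q₂ * p₁ * p₂)
      + (2 * t₁ ^ 2 - 2 * t₁ * t₂ - a 3) • (q₁ * p₁) + a 2 • (q₁ * p₂) + a 3 • (q₂ * p₁)
      - a 2 • (q₂ * p₂) + (a 2 * (t₁ - t₂)) • q₁ + (2 * a 1 * (t₁ - t₂)) • p₁),
   ((denom .g113 h a) * (t₂ - t₁))⁻¹ •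
    (q₁ ^ 2 * p₁ * p₂ + q₂ ^ 2 * p₁ * p₂ - 2 * q₁ * q₂ * p₁ * p₂
      - (t₁ - t₂) • (q₂ ^ 2 * p₂ - 2 * q₂ * p₂ ^ 2 - 2 * q₁ * p₁ * p₂)
      - a 3 • (q₁ * p₁) + a 2 • (q₁ * p₂) + a 3 • (q₂ * p₁)
      - (2 * t₁ * t₂ - 2 * t₂ ^ 2 + a 2) • (q₂ * p₂) - (a 3 * (t₁ - t₂)) • q₂
      - (2 * a 1 * (t₁ - t₂)) • p₂))

def ham122 (h : K) (a : ℕ → K) (t₁ t₂ : K) (q₁ p₁ q₂ p₂ : A) : A × A :=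
  (((denom .g122 h a) * t₁ * (t₁ - t₂))⁻¹ •
    ((t₁ - t₂) • (q₁ ^ 2 * p₁ ^ 2) + (2 * t₁) • (q₁ * q₂ * p₁ * p₂) - t₂ • (q₁ ^ 2 * p₁ * p₂)
      - t₁ • (q₂ ^ 2 * p₁ * p₂) + (t₂ - t₁) • (q₁ ^ 2 * p₁)
      + ((a 1 + a 2 + a 3) * t₁ - (a 1 + a 2) * t₂) • (q₁ * p₁) - (a 1 * t₂) • (q₁ * p₂)
      - (a 3 * t₁) • (q₂ * p₁) + (a 1 * t₁) • (q₂ * p₂) - (a 1 * (t₁ - t₂)) • q₁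
      + (t₁ * (t₁ - t₂)) • p₁),
   ((denom .g122 h a) * t₂ * (t₁ - t₂))⁻¹ •
    ((t₁ - t₂) • (q₂ ^ 2 * p₂ ^ 2) - (2 * t₂) • (q₁ * q₂ * p₁ * p₂) + t₂ • (q₁ ^ 2 * p₁ * p₂)
      + t₁ • (q₂ ^ 2 * p₁ * p₂) + (t₂ - t₁) • (q₂ ^ 2 * p₂) - (a 3 * t₂) • (q₁ * p₁)
      + (a 1 * t₂) • (q₁ * p₂) + (a 3 * t₁) • (q₂ * p₁)
      + ((a 2 + a 3) * t₁ - (a 1 + a 2 + a 3) * t₂) • (q₂ * p₂) - (a 3 * (t₁ - t₂)) • q₂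
      + (t₂ * (t₁ - t₂)) • p₂))

def ham14 (h : K) (a : ℕ → K) (t₁ t₂ : K) (q₁ p₁ q₂ p₂ : A) : A × A :=
  (((denom .g14 h a) * (t₁ - t₂))⁻¹ •
    (-(q₁ ^ 2 * p₁ * p₂) - q₂ ^ 2 * p₁ * p₂ + 2 * q₁ * q₂ * p₁ * p₂ + (t₂ - t₁) • (q₁ ^ 2 * p₁)
      + a 2 • (q₁ * p₁) - a 1 • (q₁ * p₂) - a 2 • (q₂ * p₁) + a 1 • (q₂ * p₂)
      + ((t₁ - t₂) / 2) • (p₁ * (p₁ + p₂)) - (a 1 * (t₁ - t₂)) • q₁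
      - (t₁ * (t₁ - t₂) / 2) • p₁),
   ((denom .g14 h a) * (t₁ - t₂))⁻¹ •
    (q₁ ^ 2 * p₁ * p₂ + q₂ ^ 2 * p₁ * p₂ - 2 * q₁ * q₂ * p₁ * p₂ + (t₂ - t₁) • (q₂ ^ 2 * p₂)
      - a 2 • (q₁ * p₁) + a 1 • (q₁ * p₂) + a 2 • (q₂ * p₁) - a 1 • (q₂ * p₂)
      + ((t₁ - t₂) / 2) • (p₁ * p₂ + p₂ ^ 2) - (a 2 * (t₁ - t₂)) • q₂
      - (t₂ * (t₁ - t₂) / 2) • p₂))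

def ham23 (h : K) (a : ℕ → K) (η t₁ t₂ : K) (q₁ p₁ q₂ p₂ : A) : A × A :=
  (((denom .g23 h a) * t₁)⁻¹ •
    (q₂ ^ 2 * p₂ ^ 2 - q₂ * p₁ ^ 2 + (1 / 2 : K) • (q₁ * q₂ * p₁) + (1 / 2 : K) • (q₂ ^ 2 * p₂)
      - (η * t₁) • (q₁ * p₂) + (1 + h + 2 * a 1 - a 2 + 2 * a 3) • (q₂ * p₂)
      + (a 1 / 2) • q₂ - (η * t₁) • (p₁ - t₂ • p₂)),
   (denom .g23 h a)⁻¹ •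
    (-((1 / 2 : K) • (q₁ ^ 2 * p₁)) - (1 / 2 : K) • (q₁ * q₂ * p₂) + 2 * q₂ * p₁ * p₂
      + q₁ * p₁ ^ 2 + (t₂ / 2) • (q₁ * p₁) + (1 / 2 : K) • (q₂ * p₁) - t₂ • p₁ ^ 2
      - (a 1 / 2) • q₁ + (1 + h + 2 * a 1 - a 2 + 2 * a 3) • p₁ + (η * t₁) • p₂))

def ham5 (h : K) (a : ℕ → K) (t₁ t₂ : K) (q₁ p₁ q₂ p₂ : A) : A × A :=
  ((denom .g5 h a)⁻¹ •
    (2 * q₁ * q₂ * p₁ + q₂ * p₁ ^ 2 + 2 * q₂ ^ 2 * p₂ - 2 * q₁ * p₂ + (2 * t₂) • (q₂ * p₁)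
      + 2 * p₁ * p₂ + (2 * a 1) • q₂ + (2 * t₁) • p₁ + (2 * t₂) • p₂),
   (denom .g5 h a)⁻¹ •
    (q₂ ^ 2 * p₁ ^ 2 + 2 * q₁ ^ 2 * p₁ + 2 * q₁ * q₂ * p₂ - q₁ * p₁ ^ 2 + 2 * q₂ * p₁ * p₂
      + (2 * t₁) • (q₂ * p₁) + (2 * t₂) • (q₂ * p₂) - t₂ • p₁ ^ 2 + p₂ ^ 2 + (2 * a 1) • q₁
      - (2 * t₂ ^ 2) • p₁ + (2 * t₁) • p₂))

/-- The pair of Hamiltonians of each system, in the given variables. -/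
def hamiltonians (k : Kind) (h : K) (a : ℕ → K) (η t₁ t₂ : K) (q₁ p₁ q₂ p₂ : A) : A × A :=
  match k with
  | .g11111 => ham11111 h a t₁ t₂ q₁ p₁ q₂ p₂
  | .g1112 => ham1112 h a η t₁ t₂ q₁ p₁ q₂ p₂
  | .g113 => ham113 h a t₁ t₂ q₁ p₁ q₂ p₂
  | .g122 => ham122 h a t₁ t₂ q₁ p₁ q₂ p₂
  | .g14 => ham14 h a t₁ t₂ q₁ p₁ q₂ p₂
  | .g23 => ham23 h a η t₁ t₂ q₁ p₁ q₂ p₂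
  | .g5 => ham5 h a t₁ t₂ q₁ p₁ q₂ p₂

/-- The Hamiltonians of each system as noncommutative polynomials. -/
def garnierHamiltonians (k : Kind) (h : ℂ) (α : ℕ → ℂ) (η : ℂ) [Algebra ℂ K] (t₁ t₂ : K) :
    FreeAlgebra K Var × FreeAlgebra K Var :=
  hamiltonians k (algebraMap ℂ K h) (fun i => algebraMap ℂ K (α i)) (algebraMap ℂ K η) t₁ t₂
    (FreeAlgebra.ι K .q₁) (FreeAlgebra.ι K .p₁) (FreeAlgebra.ι K .q₂) (FreeAlgebra.ι K .p₂)

end Hamiltonians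

/-- The Hamiltonian system with Hamiltonians `H₁` (for the time with derivation `D₁`) and `H₂` (for
the time with derivation `D₂`) is transformed by each of the transformations of the system `k`
again into a Hamiltonian system with polynomial Hamiltonians. -/
def HolomorphyCondition {K : Type*} [Field K] [Algebra ℂ K] (k : Kind) (h κ : ℂ) (α : ℕ → ℂ)
    (η : ℂ) (D₁ D₂ : Derivation ℂ K K) (t₁ t₂ : K) (H₁ H₂ : FreeAlgebra K Var) : Prop :=
  ∀ r ∈ transformations k (fun i => algebraMap ℂ K (α i)) (algebraMap ℂ K η) t₁ t₂
      (newChart K h),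
    FlowTransformsToPolynomial κ D₁ r H₁ ∧ FlowTransformsToPolynomial κ D₂ r H₂

end QuantumGarnier

/-! ### Normally ordered monomials and their commutation rules. -/

namespace QuantumGarnier

/-! The theorem becomes a homogeneous linear problem, which is then solved by a certified
computation.

Each transformation `r` is canonical and invertible, and its explicit dependence on a time is inner:
there is an element `R` with `[r v, R] = h ∂(r v)`. Hence `r` sends the flow of `H` to the flow of
`r(H) + (κh)⁻¹R`. A Hamiltonian is determined by its flow up to an element commuting with every `r
v`. Invertibility of `r` makes such an element commute with all canonical variables, and then it is
a scalar of `K`. So the condition on `H` reads: `r(H) + (κh)⁻¹R` is a polynomial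
(`flowTransforms_iff`). For the stated Hamiltonian `E` the difference `r(E) - R` is a polynomial, by
direct computation. Modulo polynomials `R` may therefore be replaced by `r(E)`, and the condition
becomes: every `r` sends `F = H + (κh)⁻¹E` to a polynomial (`Data.flowTransforms_map_iff`). It
remains to see that an `F` of degree at most five with this property is constant
(`Data.forall_lift_mem_polynomials_iff`).

In the Weyl algebra `F` is a combination of the 126 normally ordered words of length at most five,
with the same coefficients under every canonical substitution (`exists_coefficients`). The image of
`F` under `r` is a combination of monomials `X₁ᵃ X₂ᵇ Y₁ᶜ Y₂ᵈ`, where `a, b` are integers and `X₁,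
X₂` are those variables which `r` inverts. If the image is a polynomial, all coefficients with `a <
0` or `b < 0` vanish (`Linear.source_of_mem_polynomials`). This gives linear equations for the 125
nonconstant coefficients, and elimination with pivots that are nonzero under the hypotheses leaves
only the zero solution (`Linear.solves_sound`).

Comparison of coefficients requires independence of the monomials (`Frame.comb_injective`). They are
joint eigenvectors of four Euler operators whose eigenvalues separate the exponents, since `h ≠ 0`
and the characteristic is zero. They are nonzero because they are units in a nontrivial ring, and
nontriviality follows from an explicit representation (`nontrivial_locK`). The same operators show
that central combinations are scalars (`Frame.comb_central`).

The computations use lists of integers, with the exponents of a monomial packed into one natural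
number. Only soundness of the algorithms is proved: every failing check returns a useless but
correct answer. Success for the seven systems is then established by evaluation in the kernel. -/

/-- Two units `X₁, X₂` and two elements `Y₁, Y₂` satisfying `[Xᵢ, Yⱼ] = δᵢⱼ h`,
`[Xᵢ, Xⱼ] = [Yᵢ, Yⱼ] = 0`. -/
structure Frame {K : Type*} (A : Type*) [Field K] [Ring A] [Algebra K A] (h : K) where
  X₁ : Aˣ
  X₂ : Aˣ
  Y₁ : A
  Y₂ : A
  xx : Commute X₁ X₂
  yx₁ : Y₁ * X₁ = X₁ * Y₁ - algebraMap K A h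
  yx₂ : Y₂ * X₂ = X₂ * Y₂ - algebraMap K A h
  y₁x₂ : Commute Y₁ X₂
  y₂x₁ : Commute Y₂ X₁
  yy : Commute Y₁ Y₂

section Frame

variable {K A : Type*} [Field K] [Ring A] [Algebra K A] {h : K}

lemma mul_units_inv_of_heisenberg {x : Aˣ} {y : A} (e : y * x = x * y - algebraMap K A h) :
    y * ↑x⁻¹ = ↑x⁻¹ * y + h • (↑(x ^ (-2 : ℤ)) : A) := by
  have h1 : (x : A) * (y * ↑x⁻¹) * x = x * (↑x⁻¹ * y + h • (↑(x ^ (-2 : ℤ)) : A)) * x := by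
    have h2 : (x : A) * (↑(x ^ (-2 : ℤ)) : A) * x = 1 := by
      rw [← Units.val_mul, ← Units.val_mul, ← zpow_one_add, ← zpow_add_one]; simp
    have h3 : (x : A) * (h • (↑(x ^ (-2 : ℤ)) : A)) * x = algebraMap K A h := by
      rw [mul_smul_comm, smul_mul_assoc, h2, Algebra.algebraMap_eq_smul_one]
    rw [mul_add, add_mul, h3, ← mul_assoc (x : A) ↑x⁻¹ y, Units.mul_inv, one_mul, e,
      ← mul_assoc, mul_assoc _ (↑x⁻¹ : A), Units.inv_mul, mul_one, sub_add_cancel]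
  exact (Units.mul_right_inj x).1 ((Units.mul_left_inj x).1 h1)

/-- The commutator with `y` acts on powers of `x` as `-h d/dx`. The formula propagates from the
exponent zero in both directions, through the cases of `x` and of its inverse. -/
lemma mul_units_zpow_of_heisenberg {x : Aˣ} {y : A} (e : y * x = x * y - algebraMap K A h)
    (a : ℤ) :
    y * ↑(x ^ a) = ↑(x ^ a) * y - ((a : K) * h) • (↑(x ^ (a - 1)) : A) := by
  induction a using Int.induction_on with
  | zero => simp
  | succ n ih =>
    rw [zpow_add_one, Units.val_mul, ← mul_assoc, ih, sub_mul, mul_assoc, e, smul_mul_assoc,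
      ← Units.val_mul, ← zpow_add_one, mul_sub, ← mul_assoc, sub_sub,
      Algebra.algebraMap_eq_smul_one,
      mul_smul_comm, mul_one]
    simp only [sub_add_cancel, add_sub_cancel_right, sub_right_inj]
    rw [← add_smul]; push_cast; ring_nf
  | pred n ih =>
    rw [zpow_sub_one, Units.val_mul, ← mul_assoc, ih, sub_mul, mul_assoc,
      mul_units_inv_of_heisenberg e, smul_mul_assoc, ← Units.val_mul, mul_add, mul_smul_comm,
      ← Units.val_mul, ← mul_assoc, ← Units.val_mul, ← zpow_sub_one, ← zpow_sub_one, ← zpow_add,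
      add_sub_assoc]
    rw [show (-(n : ℤ) + -2) = -(n : ℤ) - 1 - 1 by ring, ← sub_smul]
    rw [show h - ((-(n : ℤ) : ℤ) : K) * h = -(((-(n : ℤ) - 1 : ℤ) : K) * h) by push_cast; ring,
      neg_smul, ← sub_eq_add_neg]

/-- The commutator with `x` is `h d/dy`; followed by multiplication with `y` it is the Euler
operator in `y`. No inverse of `y` is involved. -/
lemma pow_mul_units_of_heisenberg {x : Aˣ} {y : A} (e : y * x = x * y - algebraMap K A h)
    (c : ℕ) :
    (x : A) * y ^ c * y - y ^ c * x * y = ((c : K) * h) • y ^ c := by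
  induction c with
  | zero => simp
  | succ n ih =>
    have e' : (x : A) * y = y * x + algebraMap K A h := by rw [e]; abel
    have : (x : A) * y ^ (n + 1) * y - y ^ (n + 1) * x * y
        = y * (x * y ^ n * y - y ^ n * x * y) + algebraMap K A h * y ^ n * y := by
      rw [pow_succ' y n, ← mul_assoc (x : A) y, e']; noncomm_ring
    rw [this, ih, mul_smul_comm, ← pow_succ', mul_assoc, ← pow_succ, ← Algebra.smul_def, ← add_smul]
    push_cast; ring_nf

namespace Frame

variable (F : Frame A h)

/-- The exponents of a normally ordered monomial `X₁ᵃ X₂ᵇ Y₁ᶜ Y₂ᵈ`. -/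
abbrev Exps := ℤ × ℤ × ℕ × ℕ

/-- The normally ordered monomial with the given exponents. -/
def mono (i : Exps) : A :=
  ↑(F.X₁ ^ i.1) * ↑(F.X₂ ^ i.2.1) * F.Y₁ ^ i.2.2.1 * F.Y₂ ^ i.2.2.2

/-- The linear combination of normally ordered monomials with the given coefficients. -/
noncomputable def comb : (Exps →₀ K) →ₗ[K] A := Finsupp.linearCombination K F.mono

@[simp] lemma comb_single (i : Exps) (k : K) : F.comb (Finsupp.single i k) = k • F.mono i := by
  simp [comb]

lemma x₁_zpow_comm (a b : ℤ) :
    (↑(F.X₁ ^ a) : A) * ↑(F.X₂ ^ b) = ↑(F.X₂ ^ b) * ↑(F.X₁ ^ a) := by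
  rw [← Units.val_mul, (F.xx.zpow_zpow a b).eq, Units.val_mul]

lemma y₁_zpow_comm (b : ℤ) : F.Y₁ * (↑(F.X₂ ^ b) : A) = ↑(F.X₂ ^ b) * F.Y₁ :=
  (F.y₁x₂.units_zpow_right b).eq

lemma y₂_zpow_comm (b : ℤ) : F.Y₂ * (↑(F.X₁ ^ b) : A) = ↑(F.X₁ ^ b) * F.Y₂ :=
  (F.y₂x₁.units_zpow_right b).eq

lemma Y₁_mul_mono (a b : ℤ) (c d : ℕ) :
    F.Y₁ * F.mono (a, b, c, d)
      = F.mono (a, b, c + 1, d) - ((a : K) * h) • F.mono (a - 1, b, c, d) := by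
  simp only [mono]
  rw [← mul_assoc, ← mul_assoc, ← mul_assoc, mul_units_zpow_of_heisenberg F.yx₁]
  simp only [sub_mul, smul_mul_assoc]
  rw [mul_assoc _ F.Y₁, y₁_zpow_comm, ← mul_assoc, mul_assoc _ F.Y₁, ← pow_succ']

lemma Y₂_mul_mono (a b : ℤ) (c d : ℕ) :
    F.Y₂ * F.mono (a, b, c, d)
      = F.mono (a, b, c, d + 1) - ((b : K) * h) • F.mono (a, b - 1, c, d) := by
  simp only [mono]
  rw [← mul_assoc, ← mul_assoc, ← mul_assoc, y₂_zpow_comm, mul_assoc _ F.Y₂,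
    mul_units_zpow_of_heisenberg F.yx₂]
  simp only [mul_sub, sub_mul, smul_mul_assoc, mul_smul_comm]
  rw [← mul_assoc, mul_assoc _ F.Y₂, (F.yy.symm.pow_right c).eq, ← mul_assoc, mul_assoc _ F.Y₂,
    ← pow_succ']

lemma X_mul_mono (a b a' b' : ℤ) (c d : ℕ) :
    (↑(F.X₁ ^ a) * ↑(F.X₂ ^ b) : A) * F.mono (a', b', c, d) = F.mono (a + a', b + b', c, d) := by
  simp only [mono]
  rw [zpow_add, zpow_add, Units.val_mul, Units.val_mul]
  simp only [← mul_assoc]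
  rw [mul_assoc (↑(F.X₁ ^ a) : A) ↑(F.X₂ ^ b), ← x₁_zpow_comm, ← mul_assoc]

lemma X₁_mul_mono (i : Exps) : F.X₁ * F.mono i = F.mono (1 + i.1, i.2) := by
  simpa using F.X_mul_mono 1 0 i.1 i.2.1 i.2.2.1 i.2.2.2

lemma X₂_mul_mono (i : Exps) : F.X₂ * F.mono i = F.mono (i.1, 1 + i.2.1, i.2.2) := by
  simpa using F.X_mul_mono 0 1 i.1 i.2.1 i.2.2.1 i.2.2.2

lemma mono_mul_Y₁ (a b : ℤ) (c d : ℕ) :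
    F.mono (a, b, c, d) * F.Y₁ = F.mono (a, b, c + 1, d) := by
  simp only [mono]
  rw [mul_assoc, (F.yy.symm.pow_left d).eq, pow_succ]
  simp only [mul_assoc]

lemma mono_mul_Y₂ (a b : ℤ) (c d : ℕ) :
    F.mono (a, b, c, d) * F.Y₂ = F.mono (a, b, c, d + 1) := by
  simp only [mono, pow_succ, mul_assoc]

/-- Since `ad Y₁ = -h ∂/∂X₁`, the operator `X₁ · ad Y₁` is a multiple of the Euler operator in `X₁`.
This and its three companions have the normally ordered monomials as joint eigenvectors. -/
lemma euler_X₁ (i : Exps) :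
    F.X₁ * (F.Y₁ * F.mono i - F.mono i * F.Y₁) = (-((i.1 : K) * h)) • F.mono i := by
  obtain ⟨a, b, c, d⟩ := i
  rw [mono_mul_Y₁, Y₁_mul_mono, sub_sub_cancel_left, mul_neg, mul_smul_comm, neg_smul]
  congr 2
  have := F.X_mul_mono 1 0 (a - 1) b c d
  simpa using this

lemma euler_X₂ (i : Exps) :
    F.X₂ * (F.Y₂ * F.mono i - F.mono i * F.Y₂) = (-((i.2.1 : K) * h)) • F.mono i := by
  obtain ⟨a, b, c, d⟩ := i
  rw [mono_mul_Y₂, Y₂_mul_mono, sub_sub_cancel_left, mul_neg, mul_smul_comm, neg_smul]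
  congr 2
  have := F.X_mul_mono 0 1 a (b - 1) c d
  simpa using this

/-- Here `ad X₁ = h ∂/∂Y₁`. The factor `Y₁` is restored on the right, where it only has to pass
powers of `Y₂`, so that no correction terms arise. -/
lemma euler_Y₁ (i : Exps) :
    (F.X₁ * F.mono i - F.mono i * F.X₁) * F.Y₁ = ((i.2.2.1 : K) * h) • F.mono i := by
  obtain ⟨a, b, c, d⟩ := i
  have key := pow_mul_units_of_heisenberg F.yx₁ c
  have c1 : (↑F.X₁ : A) * ↑(F.X₁ ^ a) = ↑(F.X₁ ^ a) * ↑F.X₁ := by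
    rw [← Units.val_mul, ← Units.val_mul, ← zpow_one_add, ← zpow_add_one, add_comm]
  have c2 : (↑F.X₁ : A) * ↑(F.X₂ ^ b) = ↑(F.X₂ ^ b) * ↑F.X₁ := by
    simpa using F.x₁_zpow_comm 1 b
  have c3 : F.Y₂ ^ d * (F.X₁ : A) = F.X₁ * F.Y₂ ^ d := (F.y₂x₁.pow_left d).eq
  have c4 : F.Y₂ ^ d * F.Y₁ = F.Y₁ * F.Y₂ ^ d := (F.yy.symm.pow_left d).eq
  have : (F.X₁ * F.mono (a, b, c, d) - F.mono (a, b, c, d) * F.X₁) * F.Y₁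
      = ↑(F.X₁ ^ a) * ↑(F.X₂ ^ b) * (F.X₁ * F.Y₁ ^ c * F.Y₁ - F.Y₁ ^ c * F.X₁ * F.Y₁)
        * F.Y₂ ^ d := by
    simp only [mono, sub_mul, mul_sub]
    congr 1
    · simp only [← mul_assoc]; rw [c1, mul_assoc _ (F.X₁ : A), c2]
      simp only [mul_assoc]; rw [c4]
    · simp only [mul_assoc]; rw [← mul_assoc (F.Y₂ ^ d), c3, mul_assoc, c4]
  rw [this, key]
  simp only [mono, mul_smul_comm, smul_mul_assoc]

lemma euler_Y₂ (i : Exps) :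
    (F.X₂ * F.mono i - F.mono i * F.X₂) * F.Y₂ = ((i.2.2.2 : K) * h) • F.mono i := by
  obtain ⟨a, b, c, d⟩ := i
  have key := pow_mul_units_of_heisenberg F.yx₂ d
  have c1 : (↑F.X₂ : A) * ↑(F.X₁ ^ a) = ↑(F.X₁ ^ a) * ↑F.X₂ := by
    simpa using (F.x₁_zpow_comm a 1).symm
  have c2 : (↑F.X₂ : A) * ↑(F.X₂ ^ b) = ↑(F.X₂ ^ b) * ↑F.X₂ := by
    rw [← Units.val_mul, ← Units.val_mul, ← zpow_one_add, ← zpow_add_one, add_comm]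
  have c3 : (F.X₂ : A) * F.Y₁ ^ c = F.Y₁ ^ c * F.X₂ := (F.y₁x₂.pow_left c).eq.symm
  have : (F.X₂ * F.mono (a, b, c, d) - F.mono (a, b, c, d) * F.X₂) * F.Y₂
      = ↑(F.X₁ ^ a) * ↑(F.X₂ ^ b) * F.Y₁ ^ c
        * (F.X₂ * F.Y₂ ^ d * F.Y₂ - F.Y₂ ^ d * F.X₂ * F.Y₂) := by
    simp only [mono, sub_mul, mul_sub]
    congr 1
    · simp only [← mul_assoc]; rw [c1, mul_assoc _ (F.X₂ : A), c2, ← mul_assoc,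
        mul_assoc _ (F.X₂ : A), c3, ← mul_assoc]
    · simp only [mul_assoc]
  rw [this, key]
  simp only [mono, mul_smul_comm]

end Frame

end Frame

/-! ### Linear independence of the monomials and the center, by Euler operators. -/

namespace Frame
section Independence

variable {K A : Type*} [Field K] [Ring A] [Algebra K A] {h : K} (F : Frame A h)

/-- Multiplication of each coefficient by a function of the exponents. -/
noncomputable def scale (f : Exps → K) : (Exps →₀ K) →ₗ[K] (Exps →₀ K) :=
  Finsupp.linearCombination K fun i => Finsupp.single i (f i)

lemma scale_single (f : Exps → K) (i : Exps) (k : K) :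
    scale f (Finsupp.single i k) = Finsupp.single i (k * f i) := by
  simp [scale]

lemma scale_apply (f : Exps → K) (u : Exps →₀ K) (i : Exps) : scale f u i = f i * u i := by
  induction u using Finsupp.induction_linear with
  | zero => simp
  | add u v hu hv => simp [hu, hv, mul_add]
  | single j k =>
    rw [scale_single]
    by_cases e : j = i
    · subst e; simp [mul_comm]
    · simp [Finsupp.single_eq_of_ne' e]

/-- The right side depends on `F.comb u` only. Hence multiplying the coefficients by the eigenvalues
preserves linear relations between the monomials. -/
lemma comb_scale_X₁ (u : Exps →₀ K) :
    F.comb (scale (fun i => -((i.1 : K) * h)) u)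
      = F.X₁ * (F.Y₁ * F.comb u - F.comb u * F.Y₁) := by
  induction u using Finsupp.induction_linear with
  | zero => simp
  | add u v hu hv => rw [map_add, map_add, hu, hv, map_add]; noncomm_ring
  | single j k =>
    rw [scale_single, comb_single, comb_single, mul_smul_comm, smul_mul_assoc, ← smul_sub,
      mul_smul_comm, euler_X₁, smul_smul]

lemma comb_scale_X₂ (u : Exps →₀ K) :
    F.comb (scale (fun i => -((i.2.1 : K) * h)) u)
      = F.X₂ * (F.Y₂ * F.comb u - F.comb u * F.Y₂) := by
  induction u using Finsupp.induction_linear with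
  | zero => simp
  | add u v hu hv => rw [map_add, map_add, hu, hv, map_add]; noncomm_ring
  | single j k =>
    rw [scale_single, comb_single, comb_single, mul_smul_comm, smul_mul_assoc, ← smul_sub,
      mul_smul_comm, euler_X₂, smul_smul]

lemma comb_scale_Y₁ (u : Exps →₀ K) :
    F.comb (scale (fun i => (i.2.2.1 : K) * h) u)
      = (F.X₁ * F.comb u - F.comb u * F.X₁) * F.Y₁ := by
  induction u using Finsupp.induction_linear with
  | zero => simp
  | add u v hu hv => rw [map_add, map_add, hu, hv, map_add]; noncomm_ring
  | single j k =>
    rw [scale_single, comb_single, comb_single, mul_smul_comm, smul_mul_assoc, ← smul_sub,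
      smul_mul_assoc, euler_Y₁, smul_smul]

lemma comb_scale_Y₂ (u : Exps →₀ K) :
    F.comb (scale (fun i => (i.2.2.2 : K) * h) u)
      = (F.X₂ * F.comb u - F.comb u * F.X₂) * F.Y₂ := by
  induction u using Finsupp.induction_linear with
  | zero => simp
  | add u v hu hv => rw [map_add, map_add, hu, hv, map_add]; noncomm_ring
  | single j k =>
    rw [scale_single, comb_single, comb_single, mul_smul_comm, smul_mul_assoc, ← smul_sub,
      smul_mul_assoc, euler_Y₂, smul_smul]

variable [CharZero K] (hh : h ≠ 0)
include hh

omit [Ring A] [Algebra K A] in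
lemma eq_of_eulers {i j : Exps} (e₁ : -((i.1 : K) * h) = -((j.1 : K) * h))
    (e₂ : -((i.2.1 : K) * h) = -((j.2.1 : K) * h)) (e₃ : (i.2.2.1 : K) * h = (j.2.2.1 : K) * h)
    (e₄ : (i.2.2.2 : K) * h = (j.2.2.2 : K) * h) : i = j := by
  obtain ⟨a, b, c, d⟩ := i
  obtain ⟨a', b', c', d'⟩ := j
  simp only [neg_inj, mul_eq_mul_right_iff, hh, or_false, Int.cast_inj, Nat.cast_inj] at *
  simp [*]

/-- As for eigenvectors with distinct eigenvalues: if two exponents in a relation are separated by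
an Euler operator, a shorter nontrivial relation exists. So a shortest relation involves a single
monomial, which would have to vanish. -/
lemma comb_injective [Nontrivial A] (u₁ : IsUnit F.Y₁) (u₂ : IsUnit F.Y₂) :
    Function.Injective F.comb := by
  rw [injective_iff_map_eq_zero]
  have key : ∀ n : ℕ, ∀ u : Exps →₀ K, u.support.card ≤ n → F.comb u = 0 → u = 0 := by
    intro n
    induction n with
    | zero => intro u hu _; simpa using hu
    | succ n ih =>
      intro u hu hz
      by_contra hne
      obtain ⟨i, hi⟩ := Finsupp.support_nonempty_iff.2 hne
      have hall : ∀ f : Exps → K, F.comb (scale f u) = 0 → ∀ j ∈ u.support, f i = f j := by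
        intro f hf j hj
        by_contra hfij
        -- This relation no longer contains `j`, but still contains `i`, with the coefficient `(f i
        -- - f j) * u i`.
        have hz' : F.comb (scale f u - f j • u) = 0 := by simp [hf, hz]
        have hc : (scale f u - f j • u).support ⊆ u.support.erase j := by
          intro l hl
          rw [Finsupp.mem_support_iff] at hl
          rw [Finset.mem_erase, Finsupp.mem_support_iff]
          simp only [Finsupp.coe_sub, Finsupp.coe_smul, Pi.sub_apply, Pi.smul_apply, scale_apply,
            smul_eq_mul, ← sub_mul] at hl
          refine ⟨?_, right_ne_zero_of_mul hl⟩
          rintro rfl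
          simp at hl
        have hcard : (scale f u - f j • u).support.card ≤ n := by
          have h1 := Finset.card_le_card hc
          rw [Finset.card_erase_of_mem hj] at h1
          omega
        have h0 := DFunLike.congr_fun (ih _ hcard hz') i
        simp only [Finsupp.coe_sub, Finsupp.coe_smul, Pi.sub_apply, Pi.smul_apply, scale_apply,
            smul_eq_mul, ← sub_mul, Finsupp.coe_zero, Pi.zero_apply, mul_eq_zero] at h0
        rcases h0 with h0 | h0
        · exact hfij (sub_eq_zero.1 h0)
        · exact (Finsupp.mem_support_iff.1 hi) h0
      have hsingle : u.support = {i} := by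
        refine Finset.eq_singleton_iff_unique_mem.2 ⟨hi,
          fun j hj => (eq_of_eulers hh ?_ ?_ ?_ ?_).symm⟩
        · exact hall _ (by rw [comb_scale_X₁, hz]; simp) j hj
        · exact hall _ (by rw [comb_scale_X₂, hz]; simp) j hj
        · exact hall _ (by rw [comb_scale_Y₁, hz]; simp) j hj
        · exact hall _ (by rw [comb_scale_Y₂, hz]; simp) j hj
      obtain ⟨k, hk, rfl⟩ := Finsupp.support_eq_singleton'.1 hsingle
      rw [comb_single] at hz
      -- This is where invertibility of all four canonical variables is used: a monomial is a unit
      -- and cannot be zero.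
      have hunit : IsUnit (F.mono i) :=
        (((Units.isUnit _).mul (Units.isUnit _)).mul (u₁.pow _)).mul (u₂.pow _)
      have h1 : F.mono i = 0 := by
        have := congrArg (fun z => k⁻¹ • z) hz
        simpa [smul_smul, inv_mul_cancel₀ hk] using this
      exact hunit.ne_zero h1
  exact fun u hu => key _ u le_rfl hu

/-- An element which commutes with the four generators is annihilated by all Euler operators. By
independence every exponent that occurs has the eigenvalues of the exponent zero, hence is zero. -/
lemma comb_central [Nontrivial A] (u₁ : IsUnit F.Y₁) (u₂ : IsUnit F.Y₂) (z : Exps →₀ K)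
    (c₁ : Commute (F.comb z) F.X₁) (c₂ : Commute (F.comb z) F.X₂) (c₃ : Commute (F.comb z) F.Y₁)
    (c₄ : Commute (F.comb z) F.Y₂) : ∃ k : K, F.comb z = algebraMap K A k := by
  have inj := F.comb_injective hh u₁ u₂
  have e₁ := F.comb_scale_X₁ z
  have e₂ := F.comb_scale_X₂ z
  have e₃ := F.comb_scale_Y₁ z
  have e₄ := F.comb_scale_Y₂ z
  rw [c₃.eq, sub_self, mul_zero] at e₁
  rw [c₄.eq, sub_self, mul_zero] at e₂
  rw [c₁.eq, sub_self, zero_mul] at e₃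
  rw [c₂.eq, sub_self, zero_mul] at e₄
  have f₁ := inj (e₁.trans (map_zero _).symm)
  have f₂ := inj (e₂.trans (map_zero _).symm)
  have f₃ := inj (e₃.trans (map_zero _).symm)
  have f₄ := inj (e₄.trans (map_zero _).symm)
  have hz : z = Finsupp.single 0 (z 0) := by
    ext i
    by_cases hi : z i = 0
    · by_cases h0 : (0 : Exps) = i
      · subst h0; simp
      · rw [Finsupp.single_eq_of_ne' h0, hi]
    · have : i = 0 := by
        have g₁ := DFunLike.congr_fun f₁ i
        have g₂ := DFunLike.congr_fun f₂ i
        have g₃ := DFunLike.congr_fun f₃ i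
        have g₄ := DFunLike.congr_fun f₄ i
        simp only [scale_apply, Finsupp.coe_zero, Pi.zero_apply, mul_eq_zero, hi, or_false] at *
        exact eq_of_eulers (j := (0 : Exps)) hh (by simpa using g₁) (by simpa using g₂)
          (by simpa using g₃) (by simpa using g₄)
      subst this; simp
  refine ⟨z 0, ?_⟩
  conv_lhs => rw [hz]
  rw [comb_single, Algebra.algebraMap_eq_smul_one]
  simp [mono]

end Independence
end Frame

/-! ### A representation showing that the localized Weyl algebra is not zero. -/

section Nontrivial

/-- A weighted shift of functions on the lattice. -/
def weightedShift (s : ℤ × ℤ) (w : ℤ × ℤ → ℂ) : Module.End ℂ (ℤ × ℤ → ℂ) where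
  toFun f m := w m * f (m + s)
  map_add' f g := by ext m; simp [mul_add]
  map_smul' c f := by ext m; simp; ring

lemma weightedShift_mul (s s' : ℤ × ℤ) (w w' : ℤ × ℤ → ℂ) :
    weightedShift s w * weightedShift s' w'
      = weightedShift (s + s') fun m => w m * w' (m + s) := by
  ext f m
  simp [weightedShift, Module.End.mul_apply, add_assoc, mul_assoc]

/-- The canonical variables and their inverses as operators on the functions
`x₁ ^ (m₁ + 1/2) x₂ ^ (m₂ + 1/2)`. -/
noncomputable def latticeOp (h : ℂ) : Var ⊕ Var → Module.End ℂ (ℤ × ℤ → ℂ)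
  | .inl .q₁ => weightedShift (-1, 0) 1
  | .inr .q₁ => weightedShift (1, 0) 1
  | .inl .q₂ => weightedShift (0, -1) 1
  | .inr .q₂ => weightedShift (0, 1) 1
  | .inl .p₁ => weightedShift (1, 0) fun m => -h * (m.1 + 3 / 2)
  | .inr .p₁ => weightedShift (-1, 0) fun m => (-h * (m.1 + 1 / 2))⁻¹
  | .inl .p₂ => weightedShift (0, 1) fun m => -h * (m.2 + 3 / 2)
  | .inr .p₂ => weightedShift (0, -1) fun m => (-h * (m.2 + 1 / 2))⁻¹

/-- The shift of the exponents by one half makes `-h d/dx` invertible on the powers of `x`: the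
factor produced by differentiation never vanishes. -/
lemma half_integer_ne_zero (m : ℤ) : (m : ℂ) + 1 / 2 ≠ 0 := by
  intro e
  have h1 : ((2 * m + 1 : ℤ) : ℂ) = 0 := by push_cast; linear_combination 2 * e
  have : 2 * m + 1 = 0 := by exact_mod_cast h1
  omega

lemma half_integer_ne_zero' (m : ℤ) : (m : ℂ) + 3 / 2 ≠ 0 := by
  have := half_integer_ne_zero (m + 1)
  push_cast at this
  rwa [add_assoc, show (1 : ℂ) + 1 / 2 = 3 / 2 by norm_num] at this

lemma latticeOp_rel {h : ℂ} (hh : h ≠ 0) ⦃x y : FreeAlgebra ℂ (Var ⊕ Var)⦄ (e : LocRel h x y) :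
    FreeAlgebra.lift ℂ (latticeOp h) x = FreeAlgebra.lift ℂ (latticeOp h) y := by
  induction e with
  | comm u v =>
    simp only [map_sub, map_mul, FreeAlgebra.lift_ι_apply, AlgHom.commutes]
    cases u <;> cases v <;> simp only [latticeOp, weightedShift_mul] <;> ext f m <;>
      simp [weightedShift, pairing, show ((0 : ℤ), (0 : ℤ)) = 0 from rfl] <;> (try ring_nf)
  | mul_inv u =>
    simp only [map_mul, FreeAlgebra.lift_ι_apply, map_one]
    have h1 := fun m => half_integer_ne_zero m
    have h2 := fun m => half_integer_ne_zero' m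
    cases u <;> simp only [latticeOp, weightedShift_mul] <;> ext f m <;>
      simp [weightedShift, show ((0 : ℤ), (0 : ℤ)) = 0 from rfl]
    · have := h2 m.1
      rw [show (m.1 : ℂ) + 1 + 2⁻¹ = m.1 + 3 / 2 by ring]
      have : (m.1 : ℂ) * 2 + 3 ≠ 0 := fun e => this (by linear_combination e / 2)
      field_simp
    · have := h2 m.2
      rw [show (m.2 : ℂ) + 1 + 2⁻¹ = m.2 + 3 / 2 by ring]
      have : (m.2 : ℂ) * 2 + 3 ≠ 0 := fun e => this (by linear_combination e / 2)
      field_simp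
  | inv_mul u =>
    simp only [map_mul, FreeAlgebra.lift_ι_apply, map_one]
    have h1 := fun m => half_integer_ne_zero m
    cases u <;> simp only [latticeOp, weightedShift_mul] <;> ext f m <;>
      simp [weightedShift, show ((0 : ℤ), (0 : ℤ)) = 0 from rfl]
    · have := h1 m.1
      rw [show (m.1 : ℂ) + -1 + 3 / 2 = m.1 + 1 / 2 by ring, ← one_div]
      have : (m.1 : ℂ) * 2 + 1 ≠ 0 := fun e => this (by linear_combination e / 2)
      field_simp
    · have := h1 m.2
      rw [show (m.2 : ℂ) + -1 + 3 / 2 = m.2 + 1 / 2 by ring, ← one_div]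
      have : (m.2 : ℂ) * 2 + 1 ≠ 0 := fun e => this (by linear_combination e / 2)
      field_simp

/-- A homomorphism to a nonzero ring excludes `1 = 0`. No finer description of the localization is
needed, because independence of monomials follows from nontriviality. -/
lemma nontrivial_loc {h : ℂ} (hh : h ≠ 0) : Nontrivial (Loc h) :=
  (RingQuot.liftAlgHom ℂ
    ⟨FreeAlgebra.lift ℂ (latticeOp h), latticeOp_rel hh⟩ :
      Loc h →ₐ[ℂ] Module.End ℂ (ℤ × ℤ → ℂ)).toRingHom.domain_nontrivial

lemma nontrivial_locK (K : Type*) [Field K] [Algebra ℂ K] {h : ℂ} (hh : h ≠ 0) :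
    Nontrivial (LocK K h) := by
  have := nontrivial_loc hh
  infer_instance

end Nontrivial

/-! ### Frames in the localized Weyl algebra and the subalgebra of polynomials. -/

section LocK

variable (K : Type*) [Field K] [Algebra ℂ K] (h : ℂ)

lemma locVar_comm (u v : Var) :
    locVar K h u * locVar K h v - locVar K h v * locVar K h u
      = algebraMap K (LocK K h) (algebraMap ℂ K (pairing u v * h)) := by
  have e := RingQuot.mkAlgHom_rel ℂ (LocRel.comm (h := h) u v)
  rw [map_sub, map_mul, map_mul, AlgHom.commutes] at e
  simp only [locVar, Algebra.TensorProduct.tmul_mul_tmul, mul_one, ← TensorProduct.tmul_sub, e]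
  rw [Algebra.TensorProduct.algebraMap_apply, Algebra.algebraMap_self_apply,
    Algebra.algebraMap_eq_smul_one, TensorProduct.tmul_smul, TensorProduct.smul_tmul',
    Algebra.algebraMap_eq_smul_one]

/-- A canonical variable as a unit. -/
noncomputable def locUnit (v : Var) : (LocK K h)ˣ where
  val := locVar K h v
  inv := locInv K h v
  val_inv := by
    have e := RingQuot.mkAlgHom_rel ℂ (LocRel.mul_inv (h := h) v)
    rw [map_mul, map_one] at e
    simp only [locVar, locInv, Algebra.TensorProduct.tmul_mul_tmul, mul_one, e]
    rfl
  inv_val := by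
    have e := RingQuot.mkAlgHom_rel ℂ (LocRel.inv_mul (h := h) v)
    rw [map_mul, map_one] at e
    simp only [locVar, locInv, Algebra.TensorProduct.tmul_mul_tmul, mul_one, e]
    rfl

@[simp] lemma val_locUnit (v : Var) : (locUnit K h v : LocK K h) = locVar K h v := rfl
@[simp] lemma val_inv_locUnit (v : Var) : (↑(locUnit K h v)⁻¹ : LocK K h) = locInv K h v := rfl

lemma locVar_commute {u v : Var} (e : pairing u v = 0) : Commute (locVar K h u) (locVar K h v) := by
  have := locVar_comm K h u v
  rw [e, zero_mul, map_zero, map_zero, sub_eq_zero] at this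
  exact this

lemma neg_mul_eq_mul_neg_sub {A : Type*} [Ring A] (a b : A) :
    -a * b = b * -a - (a * b - b * a) := by noncomm_ring

/-- The frame whose units are `q₁`, `q₂`, each of which is replaced by the conjugate variable when
the corresponding Boolean is true. -/
noncomputable def frame (b₁ b₂ : Bool) : Frame (LocK K h) (algebraMap ℂ K h) where
  X₁ := bif b₁ then locUnit K h .p₁ else locUnit K h .q₁
  X₂ := bif b₂ then locUnit K h .p₂ else locUnit K h .q₂
  -- The sign keeps the pair canonical after the exchange: `[p, -q] = [q, p] = h`.
  Y₁ := bif b₁ then -locVar K h .q₁ else locVar K h .p₁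
  Y₂ := bif b₂ then -locVar K h .q₂ else locVar K h .p₂
  xx := by
    cases b₁ <;> cases b₂ <;> exact Units.ext (locVar_commute K h rfl)
  yx₁ := by
    have e := locVar_comm K h .q₁ .p₁
    simp only [pairing, one_mul] at e
    cases b₁
    · simp [← e]
    · exact (neg_mul_eq_mul_neg_sub _ _).trans (congrArg _ e)
  yx₂ := by
    have e := locVar_comm K h .q₂ .p₂
    simp only [pairing, one_mul] at e
    cases b₂
    · simp [← e]
    · exact (neg_mul_eq_mul_neg_sub _ _).trans (congrArg _ e)
  y₁x₂ := by
    have c := fun u v e => locVar_commute K h (u := u) (v := v) e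
    cases b₁ <;> cases b₂
    · exact c .p₁ .q₂ rfl
    · exact c .p₁ .p₂ rfl
    · exact (c .q₁ .q₂ rfl).neg_left
    · exact (c .q₁ .p₂ rfl).neg_left
  y₂x₁ := by
    have c := fun u v e => locVar_commute K h (u := u) (v := v) e
    cases b₁ <;> cases b₂
    · exact c .p₂ .q₁ rfl
    · exact (c .q₂ .q₁ rfl).neg_left
    · exact c .p₂ .p₁ rfl
    · exact (c .q₂ .p₁ rfl).neg_left
  yy := by
    have c := fun u v e => locVar_commute K h (u := u) (v := v) e
    cases b₁ <;> cases b₂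
    · exact c .p₁ .p₂ rfl
    · exact (c .p₁ .q₂ rfl).neg_right
    · exact (c .q₁ .p₂ rfl).neg_left
    · exact (c .q₁ .q₂ rfl).neg_left.neg_right

lemma isUnit_frame_Y₁ (b₁ b₂ : Bool) : IsUnit (frame K h b₁ b₂).Y₁ := by
  cases b₁
  · exact (locUnit K h .p₁).isUnit
  · exact (locUnit K h .q₁).isUnit.neg

lemma isUnit_frame_Y₂ (b₁ b₂ : Bool) : IsUnit (frame K h b₁ b₂).Y₂ := by
  cases b₂
  · exact (locUnit K h .p₂).isUnit
  · exact (locUnit K h .q₂).isUnit.neg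

/-- The polynomials in the canonical variables. -/
noncomputable def polynomials : Subalgebra K (LocK K h) :=
  (FreeAlgebra.lift K (locVar K h)).range

variable {K h}

lemma locVar_mem_polynomials (v : Var) : locVar K h v ∈ polynomials K h :=
  ⟨FreeAlgebra.ι K v, FreeAlgebra.lift_ι_apply _ _⟩

lemma mem_polynomials_iff {z : LocK K h} :
    z ∈ polynomials K h ↔ ∃ G, FreeAlgebra.lift K (locVar K h) G = z := AlgHom.mem_range _

lemma frame_mem_polynomials (b₁ b₂ : Bool) :
    (↑(frame K h b₁ b₂).X₁ : LocK K h) ∈ polynomials K h ∧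
    (↑(frame K h b₁ b₂).X₂ : LocK K h) ∈ polynomials K h ∧
    (frame K h b₁ b₂).Y₁ ∈ polynomials K h ∧ (frame K h b₁ b₂).Y₂ ∈ polynomials K h := by
  refine ⟨?_, ?_, ?_, ?_⟩ <;> cases b₁ <;> cases b₂ <;>
    simp [frame, locVar_mem_polynomials]

/-- The exponents of the monomials without negative powers. -/
def nonneg : Set Frame.Exps := {i | 0 ≤ i.1 ∧ 0 ≤ i.2.1}

lemma mono_mem_polynomials (b₁ b₂ : Bool) {i : Frame.Exps} (hi : i ∈ nonneg) :
    (frame K h b₁ b₂).mono i ∈ polynomials K h := by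
  obtain ⟨a, b, c, d⟩ := i
  obtain ⟨ha, hb⟩ := hi
  obtain ⟨h₁, h₂, h₃, h₄⟩ := frame_mem_polynomials (K := K) (h := h) b₁ b₂
  simp only at ha hb
  lift a to ℕ using ha
  lift b to ℕ using hb
  simp only [Frame.mono, zpow_natCast, Units.val_pow_eq_pow_val]
  exact mul_mem (mul_mem (mul_mem (pow_mem h₁ _) (pow_mem h₂ _)) (pow_mem h₃ _)) (pow_mem h₄ _)

/-- Only the derivative terms could leave the span, because they lower the exponent of `X₁` or `X₂`.
They carry this exponent as a factor and so disappear when it is zero. -/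
lemma frame_mul_mem (b₁ b₂ : Bool) {z : LocK K h}
    (hz : z ∈ Submodule.span K ((frame K h b₁ b₂).mono '' nonneg)) :
    (frame K h b₁ b₂).X₁ * z ∈ Submodule.span K ((frame K h b₁ b₂).mono '' nonneg) ∧
    (frame K h b₁ b₂).X₂ * z ∈ Submodule.span K ((frame K h b₁ b₂).mono '' nonneg) ∧
    (frame K h b₁ b₂).Y₁ * z ∈ Submodule.span K ((frame K h b₁ b₂).mono '' nonneg) ∧
    (frame K h b₁ b₂).Y₂ * z ∈ Submodule.span K ((frame K h b₁ b₂).mono '' nonneg) := by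
  induction hz using Submodule.span_induction with
  | zero => simp
  | add x y _ _ hx hy =>
    simp only [mul_add]
    exact ⟨add_mem hx.1 hy.1, add_mem hx.2.1 hy.2.1, add_mem hx.2.2.1 hy.2.2.1,
      add_mem hx.2.2.2 hy.2.2.2⟩
  | smul k x _ hx =>
    simp only [mul_smul_comm]
    exact ⟨Submodule.smul_mem _ _ hx.1, Submodule.smul_mem _ _ hx.2.1,
      Submodule.smul_mem _ _ hx.2.2.1, Submodule.smul_mem _ _ hx.2.2.2⟩
  | mem x hx =>
    obtain ⟨⟨a, b, c, d⟩, hi, rfl⟩ := hx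
    have sub : ∀ j ∈ nonneg, (frame K h b₁ b₂).mono j
        ∈ Submodule.span K ((frame K h b₁ b₂).mono '' nonneg) :=
      fun j hj => Submodule.subset_span ⟨j, hj, rfl⟩
    obtain ⟨ha, hb⟩ := hi
    simp only at ha hb
    refine ⟨?_, ?_, ?_, ?_⟩
    · rw [Frame.X₁_mul_mono]; exact sub _ ⟨by simp only; omega, hb⟩
    · rw [Frame.X₂_mul_mono]; exact sub _ ⟨ha, by simp only; omega⟩
    · rw [Frame.Y₁_mul_mono]
      refine sub_mem (sub _ ⟨ha, hb⟩) ?_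
      rcases ha.eq_or_lt with rfl | h0
      · simp
      · exact Submodule.smul_mem _ _ (sub _ ⟨by simp only; omega, hb⟩)
    · rw [Frame.Y₂_mul_mono]
      refine sub_mem (sub _ ⟨ha, hb⟩) ?_
      rcases hb.eq_or_lt with rfl | h0
      · simp
      · exact Submodule.smul_mem _ _ (sub _ ⟨ha, by simp only; omega⟩)

/-- Left multiplication by any canonical variable preserves the span of the monomials without
negative exponents. Therefore left multiplication by a polynomial does so as well, and it is applied
to `1`. -/
lemma exists_comb_of_mem_polynomials (b₁ b₂ : Bool) {z : LocK K h} (hz : z ∈ polynomials K h) :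
    ∃ u : Frame.Exps →₀ K, (∀ i, u i ≠ 0 → i ∈ nonneg) ∧ (frame K h b₁ b₂).comb u = z := by
  have key : ∀ G : FreeAlgebra K Var, ∀ z ∈ Submodule.span K ((frame K h b₁ b₂).mono '' nonneg),
      FreeAlgebra.lift K (locVar K h) G * z
        ∈ Submodule.span K ((frame K h b₁ b₂).mono '' nonneg) := by
    intro G
    induction G using FreeAlgebra.induction with
    | grade0 k =>
      intro z hz
      rw [AlgHom.commutes, ← Algebra.smul_def]
      exact Submodule.smul_mem _ _ hz
    | grade1 v =>
      intro z hz
      rw [FreeAlgebra.lift_ι_apply]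
      obtain ⟨h₁, h₂, h₃, h₄⟩ := frame_mul_mem b₁ b₂ hz
      cases b₁ <;> cases b₂ <;>
        simp only [frame, cond_true, cond_false, val_locUnit] at h₁ h₂ h₃ h₄ ⊢ <;> cases v <;>
        first | assumption | (rw [← neg_mem_iff, ← neg_mul]; assumption)
    | mul a b ha hb =>
      intro z hz
      rw [map_mul, mul_assoc]
      exact ha _ (hb _ hz)
    | add a b ha hb =>
      intro z hz
      rw [map_add, add_mul]
      exact add_mem (ha _ hz) (hb _ hz)
  obtain ⟨G, rfl⟩ := mem_polynomials_iff.1 hz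
  have h1 := key G 1 (Submodule.subset_span ⟨(0, 0, 0, 0), by simp [nonneg], by simp [Frame.mono]⟩)
  rw [mul_one] at h1
  obtain ⟨u, hu, e⟩ := (Finsupp.mem_span_image_iff_linearCombination K).1 h1
  exact ⟨u, fun i hi => hu (Finsupp.mem_support_iff.2 hi), e⟩

lemma partialTime_mul (D : Derivation ℂ K K) (x y : LocK K h) :
    partialTime D (x * y) = partialTime D x * y + x * partialTime D y := by
  induction x using TensorProduct.induction_on with
  | zero => simp
  | add a b ha hb => simp only [add_mul, map_add, ha, hb]; abel
  | tmul a b =>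
    induction y using TensorProduct.induction_on with
    | zero => simp
    | add a b ha hb => simp only [mul_add, map_add, ha, hb]; abel
    | tmul c d =>
      simp [partialTime, Algebra.TensorProduct.tmul_mul_tmul, TensorProduct.add_tmul, mul_comm,
        add_comm]

lemma partialTime_locVar (D : Derivation ℂ K K) (v : Var) : partialTime D (locVar K h v) = 0 := by
  simp [partialTime, locVar]

lemma partialTime_locInv (D : Derivation ℂ K K) (v : Var) : partialTime D (locInv K h v) = 0 := by
  simp [partialTime, locInv]

lemma partialTime_algebraMap (D : Derivation ℂ K K) (k : K) :
    partialTime D (algebraMap K (LocK K h) k) = algebraMap K (LocK K h) (D k) := by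
  simp [partialTime, Algebra.TensorProduct.algebraMap_apply]

/-- The canonical commutation relations. -/
def Canonical (h : ℂ) {A : Type*} [Ring A] [Algebra K A] (r : Var → A) : Prop :=
  ∀ u v, r u * r v - r v * r u = algebraMap K A (algebraMap ℂ K (pairing u v * h))

/-- By the universal property of the Weyl algebra a canonical substitution factors through `toWeyl`.
So its value depends only on the class of the free polynomial. -/
lemma lift_eq_of_toWeyl_eq {A : Type*} [Ring A] [Algebra K A] {r : Var → A}
    (hr : Canonical (K := K) h r) {F G : FreeAlgebra K Var} (e : toWeyl h F = toWeyl h G) :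
    FreeAlgebra.lift K r F = FreeAlgebra.lift K r G := by
  -- The Weyl algebra is defined over `ℂ`, so the target is regarded as a complex algebra through
  -- `K`.
  let : Algebra ℂ A := Algebra.compHom A (algebraMap ℂ K)
  have : IsScalarTower ℂ K A :=
    IsScalarTower.of_algebraMap_eq (R := ℂ) (S := K) (A := A) fun _ => rfl
  let g : Weyl h →ₐ[ℂ] A := RingQuot.liftAlgHom ℂ ⟨FreeAlgebra.lift ℂ r, by
    rintro _ _ ⟨u, v⟩
    simp only [map_sub, map_mul, FreeAlgebra.lift_ι_apply, AlgHom.commutes]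
    rw [← map_mul]
    exact hr u v⟩
  let f : WeylK K h →ₐ[K] A := Algebra.TensorProduct.lift (Algebra.ofId K A) g
    fun k _ => Algebra.commutes k _
  have hf : f.comp (toWeyl h) = FreeAlgebra.lift K r := by
    ext v
    simp only [AlgHom.comp_apply, Function.comp_apply, toWeyl,
      FreeAlgebra.lift_ι_apply, weylVar]
    refine (Algebra.TensorProduct.lift_tmul _ _ _ _ _).trans ?_
    rw [map_one, one_mul]
    exact (RingQuot.liftAlgHom_mkAlgHom_apply ℂ _ _ _).trans (FreeAlgebra.lift_ι_apply _ _)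
  have h1 := congrArg f e
  rwa [← AlgHom.comp_apply, ← AlgHom.comp_apply, hf] at h1

end LocK

/-! ### Arithmetic of encoded linear combinations. -/

/-- Linear combinations with integer coefficients of objects encoded by natural numbers. -/
abbrev Terms := List (ℕ × ℤ)

namespace Terms

/-- Add a term, unless its coefficient is zero. -/
def consNZ (k : ℕ) : ℤ → Terms → Terms
  | .ofNat 0, l => l
  | .ofNat (n + 1), l => (k, .ofNat (n + 1)) :: l
  | .negSucc n, l => (k, .negSucc n) :: l

/-- The inner recursion of `merge`, which passes `merge xs` as `f`. Each of the two recursions is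
structural in one of the lists. -/
def mergeAux (x : ℕ × ℤ) (f : Terms → Terms) (xs : Terms) : Terms → Terms
  | [] => x :: xs
  | y :: ys =>
    bif Nat.blt x.1 y.1 then x :: f (y :: ys)
    else bif Nat.blt y.1 x.1 then y :: mergeAux x f xs ys
    else consNZ x.1 (x.2.add y.2) (f ys)

/-- The sum of two linear combinations, sorted if both of them are. -/
def merge : Terms → Terms → Terms
  | [] => fun ys => ys
  | x :: xs => mergeAux x (merge xs) xs

/-- Apply a function to the keys and multiply the coefficients by a number. -/
def mapKey (g : ℕ → ℕ) (z : ℤ) : Terms → Terms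
  | [] => []
  | (k, y) :: l => (g k, z.mul y) :: mapKey g z l

section

variable {M N : Type*} [AddCommGroup M] [AddCommGroup N]

/-- The value of a linear combination. -/
def eval (f : ℕ → M) : Terms → M
  | [] => 0
  | (k, z) :: l => z • f k + eval f l

/-- All keys satisfy a predicate. -/
def Keys (P : ℕ → Prop) (l : Terms) : Prop := ∀ t ∈ l, P t.1

@[simp] lemma eval_nil (f : ℕ → M) : eval f [] = 0 := rfl
@[simp] lemma eval_cons (f : ℕ → M) (t : ℕ × ℤ) (l : Terms) :
    eval f (t :: l) = t.2 • f t.1 + eval f l := rfl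

lemma keys_nil (P : ℕ → Prop) : Keys P [] := by simp [Keys]
lemma keys_cons {P : ℕ → Prop} {t : ℕ × ℤ} {l : Terms} :
    Keys P (t :: l) ↔ P t.1 ∧ Keys P l := by simp [Keys]

lemma Keys.mono {P Q : ℕ → Prop} (e : ∀ k, P k → Q k) {l : Terms} (hl : Keys P l) : Keys Q l :=
  fun t ht => e _ (hl t ht)

lemma eval_consNZ (f : ℕ → M) (k : ℕ) (z : ℤ) (l : Terms) :
    eval f (consNZ k z l) = z • f k + eval f l := by
  match z with
  | .ofNat 0 => simp [consNZ]
  | .ofNat (n + 1) => rfl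
  | .negSucc n => rfl

lemma keys_consNZ {P : ℕ → Prop} {k : ℕ} (z : ℤ) {l : Terms} (hk : P k) (hl : Keys P l) :
    Keys P (consNZ k z l) := by
  match z with
  | .ofNat 0 => exact hl
  | .ofNat (n + 1) => exact keys_cons.2 ⟨hk, hl⟩
  | .negSucc n => exact keys_cons.2 ⟨hk, hl⟩

/-- Sortedness is not assumed. The comparisons only decide which equal keys get combined, and the
value of the sum is the same in every branch. -/
lemma eval_merge (f : ℕ → M) (l m : Terms) : eval f (merge l m) = eval f l + eval f m := by
  induction l generalizing m with
  | nil => simp [merge]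
  | cons x xs ih =>
    induction m with
    | nil => simp [merge, mergeAux]
    | cons y ys ihy =>
      simp only [merge, mergeAux] at ihy ⊢
      by_cases h1 : Nat.blt x.1 y.1
      · simp only [h1, cond_true, eval_cons, ih, add_assoc]
      · by_cases h2 : Nat.blt y.1 x.1
        · simp only [h1, h2, cond_true, cond_false, eval_cons, ihy]; abel
        · simp only [h1, h2, cond_false, eval_consNZ, ih, eval_cons]
          simp only [Nat.blt_eq, not_lt] at h1 h2
          rw [le_antisymm h2 h1, show x.2.add y.2 = x.2 + y.2 from rfl, add_smul]; abel

lemma keys_merge {P : ℕ → Prop} {l m : Terms} (hl : Keys P l) (hm : Keys P m) :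
    Keys P (merge l m) := by
  induction l generalizing m with
  | nil => simpa [merge]
  | cons x xs ih =>
    obtain ⟨hx, hxs⟩ := keys_cons.1 hl
    induction m with
    | nil => simpa [merge, mergeAux]
    | cons y ys ihy =>
      obtain ⟨hy, hys⟩ := keys_cons.1 hm
      have ihy := ihy hys
      simp only [merge, mergeAux] at ihy ⊢
      by_cases h1 : Nat.blt x.1 y.1
      · simp only [h1, cond_true]; exact keys_cons.2 ⟨hx, ih hxs hm⟩
      · by_cases h2 : Nat.blt y.1 x.1
        · simp only [h1, h2, cond_true, cond_false]; exact keys_cons.2 ⟨hy, ihy⟩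
        · simp only [h1, h2, cond_false]; exact keys_consNZ _ hx (ih hxs hys)

lemma eval_mapKey {f : ℕ → M} {f' : ℕ → N} (T : M →+ N) {g : ℕ → ℕ} {z : ℤ} {l : Terms}
    (e : ∀ t ∈ l, f' (g t.1) = T (f t.1)) : eval f' (mapKey g z l) = z • T (eval f l) := by
  induction l with
  | nil => simp [mapKey]
  | cons t l ih =>
    obtain ⟨h1, h2⟩ := List.forall_mem_cons.1 e
    simp only [mapKey, eval_cons, ih h2, h1, map_add, map_zsmul, smul_add, smul_smul]
    rfl

lemma keys_mapKey {P : ℕ → Prop} {g : ℕ → ℕ} {z : ℤ} {l : Terms} (e : ∀ t ∈ l, P (g t.1)) :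
    Keys P (mapKey g z l) := by
  induction l with
  | nil => simp [mapKey, Keys]
  | cons t l ih =>
    obtain ⟨h1, h2⟩ := List.forall_mem_cons.1 e
    exact keys_cons.2 ⟨h1, ih h2⟩

end

end Terms

/-! ### Monomials in the parameters, packed in base 256. -/

section Parameters

/-- The first `n` digits in base 256 of a number are at most `b`, and there are no others. -/
def DigitsLE (b : ℕ) : ℕ → ℕ → Prop
  | 0, e => e = 0
  | n + 1, e => e % 256 ≤ b ∧ DigitsLE b n (e / 256)

lemma DigitsLE.mono {b b' n e : ℕ} (hb : b ≤ b') (h : DigitsLE b n e) : DigitsLE b' n e := by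
  induction n generalizing e with
  | zero => exact h
  | succ n ih => exact ⟨h.1.trans hb, ih h.2⟩

lemma DigitsLE.lt {b n e : ℕ} (h : DigitsLE b n e) : e < 256 ^ n := by
  induction n generalizing e with
  | zero => simp [show e = 0 from h]
  | succ n ih => have := ih h.2; rw [pow_succ]; omega

/-- The sum of two digits stays below 256, so no carry occurs and the digits add independently. -/
lemma DigitsLE.add {b b' n e e' : ℕ} (h : DigitsLE b n e) (h' : DigitsLE b' n e')
    (hb : b + b' ≤ 255) : DigitsLE (b + b') n (e + e') := by
  induction n generalizing e e' with
  | zero => simp [DigitsLE, show e = 0 from h, show e' = 0 from h']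
  | succ n ih =>
    have h1 := h.1
    have h2 := h'.1
    refine ⟨by omega, ?_⟩
    rw [show (e + e') / 256 = e / 256 + e' / 256 by omega]
    exact ih h.2 h'.2

lemma digitsLE_zero (b n : ℕ) : DigitsLE b n 0 := by
  induction n with
  | zero => rfl
  | succ n ih => exact ⟨by simp, by simpa using ih⟩

variable {K : Type*} [Field K]

/-- The monomial in the parameters `p i, p (i + 1), …, p (i + n - 1)` whose exponents are the digits
in base 256 of a number. -/
def parVal (p : ℕ → K) : ℕ → ℕ → ℕ → K
  | _, 0, _ => 1
  | i, n + 1, e => p i ^ (e % 256) * parVal p (i + 1) n (e / 256)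

lemma parVal_zero (p : ℕ → K) (i n : ℕ) : parVal p i n 0 = 1 := by
  induction n generalizing i with
  | zero => rfl
  | succ n ih => simp [parVal, ih]

/-- In the absence of carries, adding codes adds exponents, which multiplies the monomials. -/
lemma parVal_add (p : ℕ → K) {b b' i n e e' : ℕ} (h : DigitsLE b n e) (h' : DigitsLE b' n e')
    (hb : b + b' ≤ 255) : parVal p i n (e + e') = parVal p i n e * parVal p i n e' := by
  induction n generalizing e e' i with
  | zero => simp [parVal]
  | succ n ih =>
    have h1 := h.1
    have h2 := h'.1
    simp only [parVal]
    rw [show (e + e') / 256 = e / 256 + e' / 256 by omega,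
      show (e + e') % 256 = e % 256 + e' % 256 by omega, ih h.2 h'.2, pow_add]
    ring

lemma digitsLE_pow {i n : ℕ} (hi : i < n) : DigitsLE 1 n (256 ^ i) := by
  induction n generalizing i with
  | zero => omega
  | succ n ih =>
    cases i with
    | zero => exact ⟨by norm_num, by simpa using digitsLE_zero 1 n⟩
    | succ i =>
      refine ⟨by simp [pow_succ], ?_⟩
      rw [pow_succ, Nat.mul_div_cancel _ (by norm_num)]
      exact ih (by omega)

lemma parVal_pow (p : ℕ → K) {i j n : ℕ} (hi : i < n) : parVal p j n (256 ^ i) = p (j + i) := by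
  induction n generalizing i j with
  | zero => omega
  | succ n ih =>
    cases i with
    | zero => simp [parVal, parVal_zero]
    | succ i =>
      rw [parVal, pow_succ, Nat.mul_div_cancel _ (by norm_num), ih (by omega)]
      simp [show j + 1 + i = j + (i + 1) by ring]

end Parameters

/-! ### Encoded elements of the algebra of a frame -/

/-- The code of the monomial with parameter part `e`, powers `c, d` of `Y₁, Y₂` and powers
`a - 128, b - 128` of `X₁, X₂`. -/
def encode (e c d a b : ℕ) : ℕ :=
  e + c * 256 ^ 11 + d * 256 ^ 12 + a * 256 ^ 13 + b * 256 ^ 14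

/-- The exponents of an encoded monomial, without its parameter part. -/
def expsOf (k : ℕ) : Frame.Exps :=
  ((k / 256 ^ 2 % 256 : ℕ) - 128, (k / 256 ^ 3 : ℕ) - 128, k % 256, k / 256 % 256)

/-- The code of a monomial whose exponents are small. -/
def Fits (n k : ℕ) : Prop :=
  ∃ e c d a b, k = encode e c d a b ∧ DigitsLE n 10 e ∧ c ≤ n ∧ d ≤ n ∧
    (128 ≤ a + n ∧ a ≤ 128 + n) ∧ 128 ≤ b + n ∧ b ≤ 128 + n

lemma Fits.mono {n n' k : ℕ} (hn : n ≤ n') (h : Fits n k) : Fits n' k := by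
  obtain ⟨e, c, d, a, b, rfl, he, hc, hd, ha, hb⟩ := h
  exact ⟨e, c, d, a, b, rfl, he.mono hn, by omega, by omega, by omega, by omega⟩

namespace Frame

variable {K A : Type*} [Field K] [Ring A] [Algebra K A] {h : K} (F : Frame A h) (p : ℕ → K)

/-- The element with a given code. -/
def val (k : ℕ) : A := parVal p 0 10 (k % 256 ^ 10) • F.mono (expsOf (k / 256 ^ 11))

lemma encode_parts {e c d a b : ℕ} (he : e < 256 ^ 10) (hc : c < 256) (hd : d < 256)
    (ha : a < 256) :
    encode e c d a b % 256 ^ 10 = e ∧ encode e c d a b % 256 ^ 11 = e ∧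
    encode e c d a b / 256 ^ 11 % 256 = c ∧ encode e c d a b / 256 ^ 12 % 256 = d ∧
    encode e c d a b / 256 ^ 13 % 256 = a ∧ encode e c d a b / 256 ^ 14 = b ∧
    encode e c d a b / 256 ^ 13 = a + 256 * b := by
  unfold encode
  norm_num at he ⊢
  omega

lemma val_encode {e c d a b : ℕ} (he : e < 256 ^ 10) (hc : c < 256) (hd : d < 256)
    (ha : a < 256) :
    F.val p (encode e c d a b) = parVal p 0 10 e • F.mono ((a : ℤ) - 128, (b : ℤ) - 128, c, d) := by
  obtain ⟨h1, h2, h3, h4, h5, h6, h7⟩ := encode_parts (b := b) he hc hd ha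
  simp only [val, expsOf, h1, Nat.div_div_eq_div_mul, ← pow_add, ← pow_succ, Nat.reduceAdd, h3, h4,
    h5, h6]

end Frame

namespace Terms

/-- Left multiplication by `Y₁` or `Y₂`, given the positions of the digits of the powers of this
element and of its conjugate. -/
def up (s : ℕ) : Terms → Terms
  | [] => []
  | (k, y) :: l => (k + s, y) :: up s l

/-- The derivative part of the left multiplication by `Y₁` or `Y₂`. -/
def down (s : ℕ) : Terms → Terms
  | [] => []
  | (k, y) :: l =>
    -- Exponents of `X₁, X₂` are stored with offset 128. The digit 128 thus means exponent zero, and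
    -- the derivative vanishes.
    bif Nat.beq (k / s % 256) 128 then down s l
    -- Adding 1 multiplies by the parameter of number zero, which is `h`; subtracting `s` lowers the
    -- exponent. The coefficient is minus the exponent, as in `Frame.Y₁_mul_mono`.
    else (k + 1 - s, (Int.subNatNat 128 (k / s % 256)).mul y) :: down s l

def mulY (s s' : ℕ) (l : Terms) : Terms := merge (up s l) (down s' l)

def iter {α : Type} (f : α → α) : ℕ → α → α
  | 0, a => a
  | n + 1, a => f (iter f n a)

/-- The code of a product `z * z'` where `z` has code `e` and does not contain `Y₁, Y₂`. -/
def mulX (e k : ℕ) : ℕ := k + e - (128 * 256 ^ 13 + 128 * 256 ^ 14)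

/-- The product. -/
def star : Terms → Terms → Terms
  | [], _ => []
  | (s, z) :: l, v =>
    -- A left factor `X₁ᵃ X₂ᵇ Y₁ᶜ Y₂ᵈ` is applied from its right end: first `Y₂`, then `Y₁`, then
    -- the part in `X₁, X₂` and the parameters. The argument of `mulX` is the code with the digits
    -- of `Y₁, Y₂` erased.
    merge (mapKey (mulX (s % 256 ^ 11 + s / 256 ^ 13 * 256 ^ 13)) z
      (iter (mulY (256 ^ 11) (256 ^ 13)) (s / 256 ^ 11 % 256)
        (iter (mulY (256 ^ 12) (256 ^ 14)) (s / 256 ^ 12 % 256) v))) (star l v)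

section

variable {K A : Type*} [Field K] [Ring A] [Algebra K A] {h : K} (F : Frame A h) {p : ℕ → K}

omit [Field K] [Ring A] [Algebra K A] in
lemma encode_up (e c d a b : ℕ) : encode e c d a b + 256 ^ 11 = encode e (c + 1) d a b ∧
    encode e c d a b + 256 ^ 12 = encode e c (d + 1) a b := by
  unfold encode; constructor <;> ring

omit [Field K] [Ring A] [Algebra K A] in
lemma encode_down (e c d a b : ℕ) :
    encode e c d (a + 1) b + 1 - 256 ^ 13 = encode (e + 1) c d a b ∧
    encode e c d a (b + 1) + 1 - 256 ^ 14 = encode (e + 1) c d a b := by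
  unfold encode; norm_num; omega

include F

/-- Every digit moves by at most one, so the bound grows by one. The restriction to 126 keeps the
digits inside their range before and after the step. -/
lemma val_Y₁ (hp : p 0 = h) {n : ℕ} (hn : n ≤ 126) {k : ℕ} (hk : Fits n k) :
    Fits (n + 1) (k + 256 ^ 11) ∧ Fits (n + 1) (k + 1 - 256 ^ 13) ∧
      F.val p (k + 256 ^ 11) + Int.subNatNat 128 (k / 256 ^ 13 % 256) • F.val p (k + 1 - 256 ^ 13)
        = F.Y₁ * F.val p k := by
  obtain ⟨e, c, d, a, b, rfl, he, hc, hd, ha, hb⟩ := hk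
  -- The stored digit is positive because `128 ≤ a + n` and `n ≤ 126`. Hence the truncated
  -- subtraction in the code is exact.
  obtain ⟨a, rfl⟩ : ∃ a', a = a' + 1 := ⟨a - 1, by omega⟩
  have h1 : DigitsLE 1 10 1 := digitsLE_pow (i := 0) (by norm_num)
  have hp1 : parVal p 0 10 1 = h := by rw [← hp]; exact parVal_pow p (i := 0) (by norm_num)
  have he' := he.add h1 (by omega)
  rw [(encode_up e c d (a + 1) b).1, (encode_down e c d a b).1]
  refine ⟨⟨e, c + 1, d, a + 1, b, rfl, he.mono (by omega), by omega, by omega, by omega, by omega⟩,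
    ⟨e + 1, c, d, a, b, rfl, he', by omega, by omega, by omega, by omega⟩, ?_⟩
  rw [F.val_encode p he.lt (by omega) (by omega) (by omega),
    F.val_encode p he.lt (by omega) (by omega) (by omega),
    F.val_encode p he'.lt (by omega) (by omega) (by omega),
    (Frame.encode_parts he.lt (by omega) (by omega) (by omega)).2.2.2.2.1,
    parVal_add p he h1 (by omega), hp1, mul_smul_comm, F.Y₁_mul_mono, Int.subNatNat_eq_coe,
    ← Int.cast_smul_eq_zsmul K, smul_smul, smul_sub, smul_smul]
  refine (congrArg₂ (· + ·) rfl ?_).trans (sub_eq_add_neg _ _).symm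
  rw [← neg_smul]
  congr 2
  · push_cast; ring
  · push_cast; ring_nf

lemma val_Y₂ (hp : p 0 = h) {n : ℕ} (hn : n ≤ 126) {k : ℕ} (hk : Fits n k) :
    Fits (n + 1) (k + 256 ^ 12) ∧ Fits (n + 1) (k + 1 - 256 ^ 14) ∧
      F.val p (k + 256 ^ 12) + Int.subNatNat 128 (k / 256 ^ 14 % 256) • F.val p (k + 1 - 256 ^ 14)
        = F.Y₂ * F.val p k := by
  obtain ⟨e, c, d, a, b, rfl, he, hc, hd, ha, hb⟩ := hk
  obtain ⟨b, rfl⟩ : ∃ b', b = b' + 1 := ⟨b - 1, by omega⟩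
  have h1 : DigitsLE 1 10 1 := digitsLE_pow (i := 0) (by norm_num)
  have hp1 : parVal p 0 10 1 = h := by rw [← hp]; exact parVal_pow p (i := 0) (by norm_num)
  have he' := he.add h1 (by omega)
  rw [(encode_up e c d a (b + 1)).2, (encode_down e c d a b).2]
  refine ⟨⟨e, c, d + 1, a, b + 1, rfl, he.mono (by omega), by omega, by omega, by omega, by omega⟩,
    ⟨e + 1, c, d, a, b, rfl, he', by omega, by omega, by omega, by omega⟩, ?_⟩
  rw [F.val_encode p he.lt (by omega) (by omega) (by omega),
    F.val_encode p he.lt (by omega) (by omega) (by omega),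
    F.val_encode p he'.lt (by omega) (by omega) (by omega),
    (Frame.encode_parts he.lt (by omega) (by omega) (by omega)).2.2.2.2.2.1,
    Nat.mod_eq_of_lt (by omega : b + 1 < 256),
    parVal_add p he h1 (by omega), hp1, mul_smul_comm, F.Y₂_mul_mono, Int.subNatNat_eq_coe,
    ← Int.cast_smul_eq_zsmul K, smul_smul, smul_sub, smul_smul]
  refine (congrArg₂ (· + ·) rfl ?_).trans (sub_eq_add_neg _ _).symm
  rw [← neg_smul]
  congr 2
  · push_cast; ring
  · push_cast; ring_nf

lemma eval_mulY {s s' n : ℕ} {y : A}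
    (hy : ∀ k, Fits n k → Fits (n + 1) (k + s) ∧ Fits (n + 1) (k + 1 - s') ∧
      F.val p (k + s) + Int.subNatNat 128 (k / s' % 256) • F.val p (k + 1 - s') = y * F.val p k)
    {l : Terms} (hl : Keys (Fits n) l) :
    Keys (Fits (n + 1)) (mulY s s' l) ∧ eval (F.val p) (mulY s s' l) = y * eval (F.val p) l := by
  have key : Keys (Fits (n + 1)) (up s l) ∧ Keys (Fits (n + 1)) (down s' l) ∧
      eval (F.val p) (up s l) + eval (F.val p) (down s' l) = y * eval (F.val p) l := by
    induction l with
    | nil => simp [up, down, Keys]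
    | cons t l ih =>
      obtain ⟨h1, h2⟩ := keys_cons.1 hl
      obtain ⟨e1, e2, e3⟩ := ih h2
      obtain ⟨k, z⟩ := t
      obtain ⟨f1, f2, f3⟩ := hy k h1
      simp only [up, down]
      refine ⟨keys_cons.2 ⟨f1, e1⟩, ?_⟩
      by_cases h0 : Nat.beq (k / s' % 256) 128
      · simp only [h0, cond_true]
        refine ⟨e2, ?_⟩
        have h0 := Nat.eq_of_beq_eq_true h0
        rw [h0, show Int.subNatNat 128 128 = 0 from rfl, zero_smul, add_zero] at f3
        rw [eval_cons, eval_cons, mul_add, mul_smul_comm, ← f3, ← e3, add_assoc]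
      · simp only [h0, cond_false]
        refine ⟨keys_cons.2 ⟨f2, e2⟩, ?_⟩
        rw [eval_cons, eval_cons, eval_cons, mul_add, mul_smul_comm, ← f3, ← e3,
          show ∀ a b : ℤ, a.mul b = b * a from fun a b => mul_comm a b, mul_smul, smul_add]
        simp only
        abel
  exact ⟨keys_merge key.1 key.2.1, by rw [mulY, eval_merge, key.2.2]⟩

lemma eval_iter_mulY {s s' : ℕ} {y : A}
    (hy : ∀ n ≤ 126, ∀ k, Fits n k → Fits (n + 1) (k + s) ∧ Fits (n + 1) (k + 1 - s') ∧
      F.val p (k + s) + Int.subNatNat 128 (k / s' % 256) • F.val p (k + 1 - s') = y * F.val p k)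
    {l : Terms} {n : ℕ} (hl : Keys (Fits n) l) (c : ℕ) (hc : n + c ≤ 127) :
    Keys (Fits (n + c)) (iter (mulY s s') c l) ∧
      eval (F.val p) (iter (mulY s s') c l) = y ^ c * eval (F.val p) l := by
  induction c with
  | zero => simpa [iter]
  | succ c ih =>
    obtain ⟨h1, h2⟩ := ih (by omega)
    obtain ⟨h3, h4⟩ := eval_mulY F (hy (n + c) (by omega)) h1
    exact ⟨h3, by rw [iter, h4, h2, pow_succ', mul_assoc]⟩

lemma val_mul_X {n n' : ℕ} {e a b : ℕ} (hn : n + n' ≤ 127) (he : DigitsLE n 10 e)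
    (ha : 128 ≤ a + n ∧ a ≤ 128 + n) (hb : 128 ≤ b + n ∧ b ≤ 128 + n) {k : ℕ} (hk : Fits n' k) :
    Fits (n + n') (mulX (e + (a + 256 * b) * 256 ^ 13) k) ∧
    F.val p (mulX (e + (a + 256 * b) * 256 ^ 13) k)
      = (parVal p 0 10 e • (↑(F.X₁ ^ ((a : ℤ) - 128)) * ↑(F.X₂ ^ ((b : ℤ) - 128)) : A))
        * F.val p k := by
  obtain ⟨e', c, d, a', b', rfl, he', hc, hd, ha', hb'⟩ := hk
  have e1 : mulX (e + (a + 256 * b) * 256 ^ 13) (encode e' c d a' b')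
      = encode (e + e') c d (a + a' - 128) (b + b' - 128) := by
    unfold mulX encode; norm_num; omega
  have he2 := he.add he' (by omega)
  rw [e1]
  refine ⟨⟨_, _, _, _, _, rfl, he2, by omega, by omega, by omega, by omega⟩, ?_⟩
  rw [F.val_encode p he2.lt (by omega) (by omega) (by omega),
    F.val_encode p he'.lt (by omega) (by omega) (by omega), parVal_add p he he' (by omega),
    smul_mul_assoc, mul_smul_comm, F.X_mul_mono, smul_smul]
  refine congrArg (fun i => _ • F.mono i) (Prod.ext ?_ (Prod.ext ?_ rfl))
  · simp only; push_cast [show 128 ≤ a + a' by omega]; ring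
  · simp only; push_cast [show 128 ≤ b + b' by omega]; ring

/-- The bound `3 * n + n'` arises because a term on the left acts by at most `n` factors `Y₂`, at
most `n` factors `Y₁`, and a monomial in `X₁, X₂` and the parameters with exponents at most `n`. -/
lemma eval_star (hp : p 0 = h) {l v : Terms} {n n' : ℕ} (hn : 3 * n + n' ≤ 127)
    (hl : Keys (Fits n) l) (hv : Keys (Fits n') v) :
    Keys (Fits (3 * n + n')) (star l v) ∧
      eval (F.val p) (star l v) = eval (F.val p) l * eval (F.val p) v := by
  induction l with
  | nil => simp [star, Keys]
  | cons t l ih =>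
    obtain ⟨h1, h2⟩ := keys_cons.1 hl
    obtain ⟨i1, i2⟩ := ih h2
    obtain ⟨s, z⟩ := t
    obtain ⟨e, c, d, a, b, hs, he, hc, hd, ha, hb⟩ := h1
    obtain ⟨q1, q2, q3, q4, q5, q6, q7⟩ :=
      Frame.encode_parts (b := b) he.lt (by omega : c < 256) (by omega : d < 256)
        (by omega : a < 256)
    simp only at hs
    rw [← hs] at q1 q2 q3 q4 q5 q6 q7
    obtain ⟨y1, y2⟩ := eval_iter_mulY F (y := F.Y₂) (p := p)
      (fun n hn k hk => val_Y₂ F hp hn hk) hv d (by omega)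
    obtain ⟨z1, z2⟩ := eval_iter_mulY F (y := F.Y₁) (p := p)
      (fun n hn k hk => val_Y₁ F hp hn hk) y1 c (by omega)
    have w := fun t ht => (val_mul_X F (p := p) (by omega : n + (n' + d + c) ≤ 127) he ha hb
      (z1 t ht)).2
    have w' := fun t ht => (val_mul_X F (p := p) (by omega : n + (n' + d + c) ≤ 127) he ha hb
      (z1 t ht)).1
    simp only [star, q2, q3, q4, q7]
    constructor
    · exact keys_merge (keys_mapKey fun t ht => (w' t ht).mono (by omega)) i1
    · rw [eval_merge, i2, eval_cons,
        eval_mapKey (f := F.val p) (AddMonoidHom.mulLeft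
          (parVal p 0 10 e • (↑(F.X₁ ^ ((a : ℤ) - 128)) * ↑(F.X₂ ^ ((b : ℤ) - 128)) : A))) w,
        AddMonoidHom.coe_mulLeft, z2, y2, add_mul (_ • _)]
      simp only [hs]
      rw [F.val_encode p he.lt (by omega) (by omega) (by omega), Frame.mono]
      simp only [smul_mul_assoc, mul_assoc]

end

end Terms

/-! ### Expressions and their formal derivatives. -/

/-- Noncommutative polynomial expressions with integer coefficients. -/
inductive Ex
  | var (i : ℕ)
  | int (z : ℤ)
  | add (a b : Ex)
  | neg (a : Ex)
  | mul (a b : Ex)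

namespace Ex

instance : Add Ex := ⟨add⟩
instance : Mul Ex := ⟨mul⟩
instance : Neg Ex := ⟨neg⟩
instance : Sub Ex := ⟨fun a b => add a (neg b)⟩
instance (n : ℕ) : OfNat Ex n := ⟨int n⟩

def npow (a : Ex) : ℕ → Ex
  | 0 => int 1
  | 1 => a
  | n + 2 => mul a (npow a (n + 1))

instance : Pow Ex ℕ := ⟨npow⟩

section

variable {R : Type*} [Ring R] (g : ℕ → R)

/-- The value of an expression. -/
def eval : Ex → R
  | var i => g i
  | int z => z
  | add a b => eval a + eval b
  | neg a => -eval a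
  | mul a b => eval a * eval b

@[simp] lemma eval_var (i : ℕ) : eval g (var i) = g i := rfl
@[simp] lemma eval_int (z : ℤ) : eval g (int z) = z := rfl
@[simp] lemma eval_add (a b : Ex) : eval g (a + b) = eval g a + eval g b := rfl
@[simp] lemma eval_sub (a b : Ex) : eval g (a - b) = eval g a - eval g b :=
  (sub_eq_add_neg _ _).symm
@[simp] lemma eval_neg (a : Ex) : eval g (-a) = -eval g a := rfl
@[simp] lemma eval_mul (a b : Ex) : eval g (a * b) = eval g a * eval g b := rfl
@[simp] lemma eval_pow (a : Ex) (n : ℕ) : eval g (a ^ n) = eval g a ^ n := by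
  change eval g (npow a n) = _
  induction n using npow.induct with
  | case1 => simp [npow]
  | case2 => simp [npow]
  | case3 n ih => rw [npow, pow_succ', ← ih]; rfl

lemma map_eval {R' : Type*} [Ring R'] (f : R →+* R') (a : Ex) :
    f (eval g a) = eval (fun i => f (g i)) a := by
  induction a with
  | var i => rfl
  | int z => simp
  | add a b ha hb => simp only [eval, map_add, ha, hb]
  | neg a ha => simp only [eval, map_neg, ha]
  | mul a b ha hb => simp only [eval, map_mul, ha, hb]

/-- All variables of an expression satisfy a predicate. -/
def uses (f : ℕ → Bool) : Ex → Bool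
  | var i => f i
  | int _ => true
  | add a b => uses f a && uses f b
  | neg a => uses f a
  | mul a b => uses f a && uses f b

lemma eval_congr {f : ℕ → Bool} {g g' : ℕ → R} (e : ∀ i, f i = true → g i = g' i) {a : Ex}
    (ha : uses f a = true) : eval g a = eval g' a := by
  induction a with
  | var i => exact e i ha
  | int z => rfl
  | add a b iha ihb =>
    simp only [uses, Bool.and_eq_true] at ha; simp only [eval, iha ha.1, ihb ha.2]
  | neg a iha => simp only [eval, iha ha]
  | mul a b iha ihb =>
    simp only [uses, Bool.and_eq_true] at ha; simp only [eval, iha ha.1, ihb ha.2]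

lemma commute_eval {f : ℕ → Bool} {z : R} (e : ∀ i, f i = true → Commute z (g i)) {a : Ex}
    (ha : uses f a = true) : Commute z (eval g a) := by
  induction a with
  | var i => exact e i ha
  | int n => exact Int.commute_cast z n
  | add a b iha ihb =>
    simp only [uses, Bool.and_eq_true] at ha; exact (iha ha.1).add_right (ihb ha.2)
  | neg a iha => exact (iha ha).neg_right
  | mul a b iha ihb =>
    simp only [uses, Bool.and_eq_true] at ha; exact (iha ha.1).mul_right (ihb ha.2)

end

/-- The formal derivative, given the derivatives of the variables. -/
def der (dv : ℕ → Ex) : Ex → Ex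
  | var i => dv i
  | int _ => int 0
  | add a b => add (der dv a) (der dv b)
  | neg a => neg (der dv a)
  | mul a b => add (mul (der dv a) b) (mul a (der dv b))

/-- The map `c • partialTime D` satisfies the Leibniz rule, so it suffices to know it on the
letters. The factor `c` is there to make the derivatives of the parameters polynomial. -/
lemma eval_der {K : Type*} [Field K] [Algebra ℂ K] {h : ℂ} (D : Derivation ℂ K K) (c : K)
    {g : ℕ → LocK K h} {dv : ℕ → Ex} (e : ∀ i, c • partialTime D (g i) = eval g (dv i)) (a : Ex) :
    c • partialTime D (eval g a) = eval g (der dv a) := by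
  induction a with
  | var i => exact e i
  | int z =>
    have := partialTime_algebraMap (h := h) D (z : K)
    rw [map_intCast] at this
    simp [eval, der, this]
  | add a b ha hb => simp only [eval, der, map_add, smul_add, ha, hb]
  | neg a ha => simp only [eval, der, map_neg, smul_neg, ha]
  | mul a b ha hb =>
    simp only [eval, der, partialTime_mul, smul_add, ← ha, ← hb, smul_mul_assoc, mul_smul_comm]

end Ex

/-! ### Evaluation of expressions with bounds on the exponents. -/

/-- An encoded element together with a bound for the exponents. -/
structure Bdd where
  n : ℕ
  l : Terms

namespace Bdd

def digitsLE (b : ℕ) : ℕ → ℕ → Bool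
  | 0, e => Nat.beq e 0
  | n + 1, e => Nat.ble (e % 256) b && digitsLE b n (e / 256)

lemma digitsLE_sound {b n e : ℕ} (he : digitsLE b n e = true) : DigitsLE b n e := by
  induction n generalizing e with
  | zero => exact Nat.eq_of_beq_eq_true he
  | succ n ih =>
    simp only [digitsLE, Bool.and_eq_true] at he
    exact ⟨Nat.le_of_ble_eq_true he.1, ih he.2⟩

def fits (n k : ℕ) : Bool :=
  digitsLE n 10 (k % 256 ^ 11) && Nat.ble (k / 256 ^ 11 % 256) n && Nat.ble (k / 256 ^ 12 % 256) n
    && (Nat.ble 128 (k / 256 ^ 13 % 256 + n) && Nat.ble (k / 256 ^ 13 % 256) (128 + n))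
    && (Nat.ble 128 (k / 256 ^ 14 + n) && Nat.ble (k / 256 ^ 14) (128 + n))

lemma fits_sound {n k : ℕ} (hk : fits n k = true) : Fits n k := by
  simp only [fits, Bool.and_eq_true, Nat.ble_eq] at hk
  obtain ⟨⟨⟨⟨h1, h2⟩, h3⟩, h4⟩, h5⟩ := hk
  refine ⟨_, _, _, _, _, ?_, digitsLE_sound h1, h2, h3, h4, h5⟩
  unfold encode
  norm_num
  omega

def allKeys (f : ℕ → Bool) : Terms → Bool
  | [] => true
  | (k, _) :: l => f k && allKeys f l

lemma allKeys_sound {f : ℕ → Bool} {l : Terms} (hl : allKeys f l = true) :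
    Terms.Keys (fun k => f k = true) l := by
  induction l with
  | nil => exact Terms.keys_nil _
  | cons t l ih =>
    simp only [allKeys, Bool.and_eq_true] at hl
    exact Terms.keys_cons.2 ⟨hl.1, ih hl.2⟩

/-- Replace the bound, if possible. -/
def tighten (n : ℕ) (b : Bdd) : Bdd :=
  -- The bound 128 signals failure: nothing is asserted about elements whose bound exceeds 127.
  bif Nat.ble b.n 127 && allKeys (fits n) b.l then ⟨n, b.l⟩ else ⟨128, []⟩

def star (a b : Bdd) : Bdd := ⟨3 * a.n + b.n, Terms.star a.l b.l⟩

/-- The product of an expression and an encoded element. -/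
def app (f : ℕ → Bdd) : Ex → Bdd → Bdd
  | .var i, v => star (f i) v
  -- Zero gives the empty list rather than terms with coefficient zero, since a zero result is
  -- recognized by emptiness.
  | .int (.ofNat 0), _ => ⟨0, []⟩
  | .int z, v => ⟨v.n, Terms.mapKey id z v.l⟩
  | .add a b, v => ⟨max (app f a v).n (app f b v).n, Terms.merge (app f a v).l (app f b v).l⟩
  | .neg a, v => ⟨(app f a v).n, Terms.mapKey id (-1) (app f a v).l⟩
  | .mul a b, v => app f a (app f b v)

def one : Bdd := ⟨0, [(encode 0 0 0 128 128, 1)]⟩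

/-- The codes of `X₁, X₁⁻¹, X₂, X₂⁻¹, Y₁, Y₂` and (from 10 on) the parameters. -/
def letter : ℕ → Bdd
  | 0 => ⟨1, [(encode 0 0 0 129 128, 1)]⟩
  | 1 => ⟨1, [(encode 0 0 0 127 128, 1)]⟩
  | 2 => ⟨1, [(encode 0 0 0 128 129, 1)]⟩
  | 3 => ⟨1, [(encode 0 0 0 128 127, 1)]⟩
  | 4 => ⟨1, [(encode 0 1 0 128 128, 1)]⟩
  | 5 => ⟨1, [(encode 0 0 1 128 128, 1)]⟩
  | i => bif Nat.ble 10 i && Nat.ble i 19 then ⟨1, [(encode (256 ^ (i - 10)) 0 0 128 128, 1)]⟩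
    else ⟨128, []⟩

/-- The letters from 6 to 9 stand for the values of a substitution. -/
def letterSubst (r : Var → Ex) : ℕ → Bdd
  -- The bound computed along an expression is much too large for repeated multiplication. All
  -- exponents in the transformations are at most 4, and then each further factor costs 12, so that
  -- ten factors stay below 127.
  | 6 => tighten 4 (app letter (r .q₁) one)
  | 7 => tighten 4 (app letter (r .p₁) one)
  | 8 => tighten 4 (app letter (r .q₂) one)
  | 9 => tighten 4 (app letter (r .p₂) one)
  | i => letter i

section

variable {K A : Type*} [Field K] [Ring A] [Algebra K A] {h : K} (F : Frame A h) (p : ℕ → K)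

/-- The bounded encoded element represents an element of the algebra, provided that the bound is
small enough. -/
def Rep (b : Bdd) (z : A) : Prop :=
  b.n ≤ 127 → Terms.Keys (Fits b.n) b.l ∧ Terms.eval (F.val p) b.l = z

variable {F p}

lemma Rep.tighten {b : Bdd} {z : A} (hb : Rep F p b z) (n : ℕ) : Rep F p (b.tighten n) z := by
  unfold Bdd.tighten
  intro h
  by_cases hc : (Nat.ble b.n 127 && allKeys (fits n) b.l)
  · simp only [hc, cond_true]
    simp only [Bool.and_eq_true, Nat.ble_eq] at hc
    exact ⟨(allKeys_sound hc.2).mono fun _ => fits_sound, (hb hc.1).2⟩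
  · simp [hc] at h

lemma Rep.star (hp : p 0 = h) {a b : Bdd} {y z : A} (ha : Rep F p a y) (hb : Rep F p b z) :
    Rep F p (a.star b) (y * z) := by
  intro hn
  simp only [Bdd.star] at hn ⊢
  obtain ⟨h1, h2⟩ := ha (by omega)
  obtain ⟨h3, h4⟩ := hb (by omega)
  rw [← h2, ← h4]
  exact Terms.eval_star F hp hn h1 h3

lemma Rep.zsmul {b : Bdd} {y : A} (hb : Rep F p b y) (z : ℤ) :
    Rep F p ⟨b.n, Terms.mapKey id z b.l⟩ (z * y) := by
  intro hn
  obtain ⟨h1, h2⟩ := hb hn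
  refine ⟨Terms.keys_mapKey h1, ?_⟩
  rw [Terms.eval_mapKey (f := F.val p) (AddMonoidHom.id A) (fun _ _ => rfl), ← h2,
    zsmul_eq_mul]
  rfl

/-- An expression is never multiplied out by itself; it acts from the left on an encoded element. A
product acts by successive application, so only left multiplication by letters has to be understood.
-/
lemma Rep.app (hp : p 0 = h) {f : ℕ → Bdd} {g : ℕ → A} (hf : ∀ i, Rep F p (f i) (g i)) (a : Ex)
    {b : Bdd} {z : A} (hb : Rep F p b z) : Rep F p (b.app f a) (a.eval g * z) := by
  induction a generalizing b z with
  | var i => exact (hf i).star hp hb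
  | int y =>
    match y with
    | .ofNat 0 => intro _; exact ⟨Terms.keys_nil _, by change (0 : A) = ((0 : ℤ) : A) * z; simp⟩
    | .ofNat (n + 1) => exact hb.zsmul _
    | .negSucc n => exact hb.zsmul _
  | add a b iha ihb =>
    intro hn
    simp only [Bdd.app] at hn ⊢
    obtain ⟨h1, h2⟩ := iha hb (by omega)
    obtain ⟨h3, h4⟩ := ihb hb (by omega)
    refine ⟨Terms.keys_merge (h1.mono fun k hk => hk.mono (le_max_left _ _))
      (h3.mono fun k hk => hk.mono (le_max_right _ _)), ?_⟩
    rw [Terms.eval_merge, h2, h4, Ex.eval, add_mul]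
  | neg a iha =>
    have := (iha hb).zsmul (-1)
    rwa [Int.cast_neg, Int.cast_one, neg_one_mul, ← neg_mul] at this
  | mul a b iha ihb =>
    have := iha (ihb hb)
    rwa [← mul_assoc] at this

variable (F p)

/-- The values of the letters. -/
def letterVal : ℕ → A
  | 0 => F.X₁
  | 1 => ↑F.X₁⁻¹
  | 2 => F.X₂
  | 3 => ↑F.X₂⁻¹
  | 4 => F.Y₁
  | 5 => F.Y₂
  | i => algebraMap K A (p (i - 10))

def letterSubstVal (r : Var → Ex) : ℕ → A
  | 6 => (r .q₁).eval (letterVal F p)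
  | 7 => (r .p₁).eval (letterVal F p)
  | 8 => (r .q₂).eval (letterVal F p)
  | 9 => (r .p₂).eval (letterVal F p)
  | i => letterVal F p i

lemma rep_encode {e c d a b : ℕ} (he : DigitsLE 1 10 e) (hc : c ≤ 1) (hd : d ≤ 1)
    (ha : 127 ≤ a ∧ a ≤ 129) (hb : 127 ≤ b ∧ b ≤ 129) :
    Rep F p ⟨1, [(encode e c d a b, 1)]⟩
      (parVal p 0 10 e • F.mono ((a : ℤ) - 128, (b : ℤ) - 128, c, d)) := by
  intro _
  have ha' : 128 ≤ a + 1 ∧ a ≤ 128 + 1 := by omega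
  have hb' : 128 ≤ b + 1 ∧ b ≤ 128 + 1 := by omega
  refine ⟨Terms.keys_cons.2 ⟨⟨e, c, d, a, b, rfl, he, hc, hd, ha', hb'⟩, Terms.keys_nil _⟩, ?_⟩
  rw [Terms.eval_cons, Terms.eval_nil, add_zero,
    F.val_encode p he.lt (by omega) (by omega) (by omega), one_smul]

lemma rep_one : Rep F p one 1 := by
  intro _
  refine ⟨Terms.keys_cons.2 ⟨⟨0, 0, 0, 128, 128, rfl, digitsLE_zero _ _, le_rfl, le_rfl, by decide,
    by decide⟩, Terms.keys_nil _⟩, ?_⟩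
  simp only [one, Terms.eval_cons, Terms.eval_nil]
  rw [F.val_encode p (by norm_num) (by norm_num) (by norm_num) (by norm_num), parVal_zero]
  simp [Frame.mono]

lemma rep_letter (i : ℕ) : Rep F p (letter i) (letterVal F p i) := by
  unfold letter letterVal
  split
  · simpa [parVal_zero, Frame.mono] using rep_encode F p (e := 0) (c := 0) (d := 0) (a := 129)
      (b := 128) (digitsLE_zero _ _) (by simp) (by simp) (by simp) (by simp)
  · simpa [parVal_zero, Frame.mono] using rep_encode F p (e := 0) (c := 0) (d := 0) (a := 127)
      (b := 128) (digitsLE_zero _ _) (by simp) (by simp) (by simp) (by simp)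
  · simpa [parVal_zero, Frame.mono] using rep_encode F p (e := 0) (c := 0) (d := 0) (a := 128)
      (b := 129) (digitsLE_zero _ _) (by simp) (by simp) (by simp) (by simp)
  · simpa [parVal_zero, Frame.mono] using rep_encode F p (e := 0) (c := 0) (d := 0) (a := 128)
      (b := 127) (digitsLE_zero _ _) (by simp) (by simp) (by simp) (by simp)
  · simpa [parVal_zero, Frame.mono] using rep_encode F p (e := 0) (c := 1) (d := 0) (a := 128)
      (b := 128) (digitsLE_zero _ _) (by simp) (by simp) (by simp) (by simp)
  · simpa [parVal_zero, Frame.mono] using rep_encode F p (e := 0) (c := 0) (d := 1) (a := 128)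
      (b := 128) (digitsLE_zero _ _) (by simp) (by simp) (by simp) (by simp)
  · by_cases hi : (Nat.ble 10 i && Nat.ble i 19)
    · simp only [hi, cond_true]
      simp only [Bool.and_eq_true, Nat.ble_eq] at hi
      have := rep_encode F p (e := 256 ^ (i - 10)) (c := 0) (d := 0) (a := 128) (b := 128)
        (digitsLE_pow (by omega)) (by simp) (by simp) (by simp) (by simp)
      rw [parVal_pow p (by omega), zero_add] at this
      simpa [Frame.mono, Algebra.algebraMap_eq_smul_one] using this
    · simp only [hi, cond_false]
      intro h
      simp at h

variable {F p}

lemma rep_app (hp : p 0 = h) (a : Ex) : Rep F p (one.app letter a) (a.eval (letterVal F p)) := by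
  simpa using (rep_one F p).app hp (rep_letter F p) a

lemma rep_letterSubst (hp : p 0 = h) (r : Var → Ex) (i : ℕ) :
    Rep F p (letterSubst r i) (letterSubstVal F p r i) := by
  unfold letterSubst letterSubstVal
  split
  · exact (rep_app hp _).tighten 4
  · exact (rep_app hp _).tighten 4
  · exact (rep_app hp _).tighten 4
  · exact (rep_app hp _).tighten 4
  · exact rep_letter F p i

lemma rep_appSubst (hp : p 0 = h) (r : Var → Ex) (a : Ex) :
    Rep F p (one.app (letterSubst r) a) (a.eval (letterSubstVal F p r)) := by
  simpa using (rep_one F p).app hp (rep_letterSubst hp r) a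

end

end Bdd

/-! ### The subalgebra of combinations of normally ordered monomials. -/

namespace Frame

variable {K A : Type*} [Field K] [Ring A] [Algebra K A] {h : K} (F : Frame A h)

lemma mul_mem_range_comb {y : A} (hy : ∀ i, y * F.mono i ∈ LinearMap.range F.comb) {z : A}
    (hz : z ∈ LinearMap.range F.comb) : y * z ∈ LinearMap.range F.comb := by
  obtain ⟨u, rfl⟩ := hz
  induction u using Finsupp.induction_linear with
  | zero => simp
  | add u v hu hv => rw [map_add, mul_add]; exact add_mem hu hv
  | single i k => rw [comb_single, mul_smul_comm]; exact Submodule.smul_mem _ _ (hy i)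

lemma mono_mem_range_comb (i : Exps) : F.mono i ∈ LinearMap.range F.comb :=
  ⟨Finsupp.single i 1, by simp⟩

/-- The commutation rules show that left multiplication by `Y₁`, by `Y₂` and by powers of `X₁, X₂`
preserves the span of the monomials. Every monomial is a product of such factors. -/
lemma mul_mem_range {y z : A} (hy : y ∈ LinearMap.range F.comb)
    (hz : z ∈ LinearMap.range F.comb) : y * z ∈ LinearMap.range F.comb := by
  have h1 : ∀ z ∈ LinearMap.range F.comb, F.Y₁ * z ∈ LinearMap.range F.comb := fun z hz =>
    F.mul_mem_range_comb (fun i => by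
      rw [show i = (i.1, i.2.1, i.2.2.1, i.2.2.2) from rfl, Y₁_mul_mono]
      exact sub_mem (F.mono_mem_range_comb _) (Submodule.smul_mem _ _ (F.mono_mem_range_comb _))) hz
  have h2 : ∀ z ∈ LinearMap.range F.comb, F.Y₂ * z ∈ LinearMap.range F.comb := fun z hz =>
    F.mul_mem_range_comb (fun i => by
      rw [show i = (i.1, i.2.1, i.2.2.1, i.2.2.2) from rfl, Y₂_mul_mono]
      exact sub_mem (F.mono_mem_range_comb _) (Submodule.smul_mem _ _ (F.mono_mem_range_comb _))) hz
  obtain ⟨u, rfl⟩ := hy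
  induction u using Finsupp.induction_linear with
  | zero => simp
  | add u v hu hv => rw [map_add, add_mul]; exact add_mem hu hv
  | single i k =>
    rw [comb_single, smul_mul_assoc]
    refine Submodule.smul_mem _ _ ?_
    have h3 : ∀ n : ℕ, ∀ z ∈ LinearMap.range F.comb, F.Y₁ ^ n * z ∈ LinearMap.range F.comb := by
      intro n
      induction n with
      | zero => simp
      | succ n ih => intro z hz; rw [pow_succ', mul_assoc]; exact h1 _ (ih _ hz)
    have h4 : ∀ n : ℕ, ∀ z ∈ LinearMap.range F.comb, F.Y₂ ^ n * z ∈ LinearMap.range F.comb := by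
      intro n
      induction n with
      | zero => simp
      | succ n ih => intro z hz; rw [pow_succ', mul_assoc]; exact h2 _ (ih _ hz)
    rw [mono, mul_assoc, mul_assoc]
    refine F.mul_mem_range_comb (fun j => ?_) (h3 _ _ (h4 _ _ hz))
    rw [show j = (j.1, j.2.1, j.2.2.1, j.2.2.2) from rfl, X_mul_mono]
    exact F.mono_mem_range_comb _

/-- The elements which are linear combinations of normally ordered monomials. -/
noncomputable def combs : Subalgebra K A where
  carrier := LinearMap.range F.comb
  mul_mem' := F.mul_mem_range
  add_mem' := add_mem
  algebraMap_mem' k := ⟨Finsupp.single 0 k, by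
    rw [comb_single, Algebra.algebraMap_eq_smul_one]; simp [mono]⟩

lemma letterVal_mem_combs (p : ℕ → K) (i : ℕ) : Bdd.letterVal F p i ∈ F.combs := by
  have key : ∀ a b c d, F.mono (a, b, c, d) ∈ F.combs := fun a b c d => F.mono_mem_range_comb _
  unfold Bdd.letterVal
  split
  · simpa [mono] using key 1 0 0 0
  · simpa [mono] using key (-1) 0 0 0
  · simpa [mono] using key 0 1 0 0
  · simpa [mono] using key 0 (-1) 0 0
  · simpa [mono] using key 0 0 1 0
  · simpa [mono] using key 0 0 0 1
  · exact Subalgebra.algebraMap_mem _ _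

end Frame

lemma Ex.eval_mem {K A : Type*} [Field K] [Ring A] [Algebra K A] {S : Subalgebra K A} {g : ℕ → A}
    (hg : ∀ i, g i ∈ S) (a : Ex) : a.eval g ∈ S := by
  induction a with
  | var i => exact hg i
  | int z => exact intCast_mem S z
  | add a b ha hb => exact add_mem ha hb
  | neg a ha => exact neg_mem ha
  | mul a b ha hb => exact mul_mem ha hb

lemma lift_mem {K A : Type*} [Field K] [Ring A] [Algebra K A] {S : Subalgebra K A} {r : Var → A}
    (hr : ∀ v, r v ∈ S) (H : FreeAlgebra K Var) : FreeAlgebra.lift K r H ∈ S := by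
  induction H using FreeAlgebra.induction with
  | grade0 k => rw [AlgHom.commutes]; exact Subalgebra.algebraMap_mem _ _
  | grade1 v => rw [FreeAlgebra.lift_ι_apply]; exact hr v
  | mul a b ha hb => rw [map_mul]; exact mul_mem ha hb
  | add a b ha hb => rw [map_add]; exact add_mem ha hb

/-! ### Boolean tests for identities, polynomiality, invertibility and flows. -/

namespace Bdd

def isNil : Terms → Bool
  | [] => true
  | _ :: _ => false

/-- Whether an expression in the letters has the value zero. -/
def isZero (r : Var → Ex) (a : Ex) : Bool :=
  Nat.ble (app (letterSubst r) a one).n 127 && isNil (app (letterSubst r) a one).l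

/-- Whether a code has no negative exponents. -/
def nonpolar (k : ℕ) : Bool := Nat.ble 128 (k / 256 ^ 13 % 256) && Nat.ble 128 (k / 256 ^ 14)

/-- Whether the value of an expression in the letters is a polynomial. -/
def isPoly (r : Var → Ex) (a : Ex) : Bool :=
  Nat.ble (app (letterSubst r) a one).n 127 &&
    allKeys nonpolar (app (letterSubst r) a one).l

section

variable {K A : Type*} [Field K] [Ring A] [Algebra K A] {h : K} {F : Frame A h} {p : ℕ → K}

lemma isZero_sound (hp : p 0 = h) {r : Var → Ex} {a : Ex} (ha : isZero r a = true) :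
    a.eval (letterSubstVal F p r) = 0 := by
  simp only [isZero, Bool.and_eq_true, Nat.ble_eq] at ha
  rw [← (rep_appSubst hp r a ha.1).2]
  match e : (app (letterSubst r) a one).l with
  | [] => rfl
  | _ :: _ => rw [e] at ha; simp [isNil] at ha

/-- The letters 0, 1 and 2, 3 are units and their inverses. What commutes with one of them commutes
with the other, so a known letter makes its partner known. -/
def partner : ℕ → ℕ
  | 0 => 1
  | 1 => 0
  | 2 => 3
  | 3 => 2
  | i => i

def elem (i : ℕ) : List ℕ → Bool
  | [] => false
  | j :: l => Nat.beq i j || elem i l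

lemma elem_sound {i : ℕ} {l : List ℕ} (hi : elem i l = true) : i ∈ l := by
  induction l with
  | nil => simp [elem] at hi
  | cons j l ih =>
    simp only [elem, Bool.or_eq_true] at hi
    rcases hi with hi | hi
    · rw [Nat.eq_of_beq_eq_true hi]; exact List.mem_cons_self
    · exact List.mem_cons_of_mem _ (ih hi)

/-- Whether the given expressions for letters are correct and express them through letters which
are already known. -/
def generates (r : Var → Ex) : List (ℕ × Ex) → List ℕ → Bool
  | [], known => elem 0 known && elem 2 known && elem 4 known && elem 5 known
  | (i, a) :: l, known => a.uses (fun j => Nat.ble 10 j || elem j known) &&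
      isZero r (.var i - a) && generates r l (i :: partner i :: known)

lemma letterVal_param {i : ℕ} (hi : 6 ≤ i) : letterVal F p i = algebraMap K A (p (i - 10)) := by
  unfold letterVal
  split
  any_goals omega
  rfl

lemma commute_letter (r : Var → Ex) {z : A} {i : ℕ} (hi : 10 ≤ i) :
    Commute z (letterSubstVal F p r i) := by
  unfold letterSubstVal
  split
  any_goals omega
  rw [letterVal_param (by omega)]
  exact Algebra.commute_algebraMap_right _ _

lemma commute_partner (r : Var → Ex) {z : A} {i : ℕ} (hi : Commute z (letterSubstVal F p r i)) :
    Commute z (letterSubstVal F p r (partner i)) := by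
  unfold partner
  split
  · exact Commute.units_inv_right (u := F.X₁) hi
  · exact Commute.units_inv_right_iff (u := F.X₁).1 hi
  · exact Commute.units_inv_right (u := F.X₂) hi
  · exact Commute.units_inv_right_iff (u := F.X₂).1 hi
  · exact hi

/-- Each entry of the certificate expresses a letter by central parameters and letters with which
`z` is already known to commute. Starting from the values of a transformation, this is its
invertibility in the form needed here. -/
lemma generates_sound (hp : p 0 = h) {r : Var → Ex} {l : List (ℕ × Ex)} {known : List ℕ}
    (hl : generates r l known = true) {z : A}
    (hz : ∀ i ∈ known, Commute z (letterSubstVal F p r i)) :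
    Commute z F.X₁ ∧ Commute z F.X₂ ∧ Commute z F.Y₁ ∧ Commute z F.Y₂ := by
  induction l generalizing known with
  | nil =>
    simp only [generates, Bool.and_eq_true] at hl
    exact ⟨hz 0 (elem_sound hl.1.1.1), hz 2 (elem_sound hl.1.1.2), hz 4 (elem_sound hl.1.2),
      hz 5 (elem_sound hl.2)⟩
  | cons t l ih =>
    obtain ⟨i, a⟩ := t
    simp only [generates, Bool.and_eq_true] at hl
    obtain ⟨⟨h1, h2⟩, h3⟩ := hl
    have h4 : letterSubstVal F p r i = a.eval (letterSubstVal F p r) := by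
      have := isZero_sound (F := F) hp h2
      rwa [Ex.eval_sub, sub_eq_zero] at this
    have h5 : Commute z (letterSubstVal F p r i) := by
      rw [h4]
      refine Ex.commute_eval _ (fun j hj => ?_) h1
      rw [Bool.or_eq_true] at hj
      rcases hj with hj | hj
      · exact commute_letter r (Nat.le_of_ble_eq_true hj)
      · exact hz j (elem_sound hj)
    refine ih h3 fun j hj => ?_
    simp only [List.mem_cons] at hj
    rcases hj with rfl | rfl | hj
    · exact h5
    · exact commute_partner r h5
    · exact hz j hj

/-- Whether a substitution satisfies the canonical commutation relations. -/
def isCanonical (r : Var → Ex) : Bool :=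
  isZero r (.var 6 * .var 7 - .var 7 * .var 6 - .var 10) &&
  isZero r (.var 8 * .var 9 - .var 9 * .var 8 - .var 10) &&
  isZero r (.var 6 * .var 8 - .var 8 * .var 6) && isZero r (.var 6 * .var 9 - .var 9 * .var 6) &&
  isZero r (.var 7 * .var 8 - .var 8 * .var 7) && isZero r (.var 7 * .var 9 - .var 9 * .var 7)

/-- The elements given by a substitution. -/
def values (F : Frame A h) (p : ℕ → K) (r : Var → Ex) (v : Var) : A := (r v).eval (letterVal F p)

lemma isCanonical_sound [Algebra ℂ K] {η : ℂ} (hη : h = algebraMap ℂ K η) (hp : p 0 = h)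
    {r : Var → Ex} (hr : isCanonical r = true) : Canonical (K := K) η (values F p r) := by
  simp only [isCanonical, Bool.and_eq_true] at hr
  obtain ⟨⟨⟨⟨⟨h1, h2⟩, h3⟩, h4⟩, h5⟩, h6⟩ := hr
  have e1 := isZero_sound (F := F) hp h1
  have e2 := isZero_sound (F := F) hp h2
  have e3 := isZero_sound (F := F) hp h3
  have e4 := isZero_sound (F := F) hp h4
  have e5 := isZero_sound (F := F) hp h5
  have e6 := isZero_sound (F := F) hp h6
  simp only [Ex.eval_sub, Ex.eval_mul, Ex.eval_var, sub_eq_zero] at e1 e2 e3 e4 e5 e6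
  change _ - _ = algebraMap K A (p 0) at e1
  change _ - _ = algebraMap K A (p 0) at e2
  change values F p r .q₁ * values F p r .p₁ - values F p r .p₁ * values F p r .q₁ = _ at e1
  change values F p r .q₂ * values F p r .p₂ - values F p r .p₂ * values F p r .q₂ = _ at e2
  change values F p r .q₁ * values F p r .q₂ = values F p r .q₂ * values F p r .q₁ at e3
  change values F p r .q₁ * values F p r .p₂ = values F p r .p₂ * values F p r .q₁ at e4
  change values F p r .p₁ * values F p r .q₂ = values F p r .q₂ * values F p r .p₁ at e5
  change values F p r .p₁ * values F p r .p₂ = values F p r .p₂ * values F p r .p₁ at e6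
  replace e1 := e1.trans (congrArg (algebraMap K A) (hp.trans hη))
  replace e2 := e2.trans (congrArg (algebraMap K A) (hp.trans hη))
  intro u v
  cases u <;> cases v <;> simp only [pairing, zero_mul, map_zero, one_mul, neg_mul, map_neg,
    sub_self, sub_eq_zero] <;>
  first | assumption | (symm; assumption) | (rw [← e1]; abel_nf; done) | (rw [← e2]; abel)

/-- The derivatives of the letters, given those of the parameters. -/
def derLetter (d : List Ex) (i : ℕ) : Ex :=
  bif Nat.ble i 9 then .int 0 else d.getD (i - 10) (.int 0)

/-- Whether `[r v, R] = h ∂(r v)`, where the derivatives of the parameters are given. -/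
def isFlow (r : Var → Ex) (d : List Ex) (R : Ex) (v : Var) (i : ℕ) : Bool :=
  -- The letters 6 to 9 are excluded because their values with and without the substitution differ.
  ((r v).der (derLetter d)).uses (fun j => Nat.ble j 5 || Nat.ble 10 j) &&
    isZero r (.var i * R - R * .var i - .var 10 * (r v).der (derLetter d))

end

end Bdd

namespace Bdd

section

variable {K : Type*} [Field K] [Algebra ℂ K] {h : ℂ} {b₁ b₂ : Bool} {p : ℕ → K}

lemma isPoly_sound (hp : p 0 = algebraMap ℂ K h) {r : Var → Ex} {a : Ex} (ha : isPoly r a = true) :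
    a.eval (letterSubstVal (frame K h b₁ b₂) p r) ∈ polynomials K h := by
  simp only [isPoly, Bool.and_eq_true, Nat.ble_eq] at ha
  rw [← (rep_appSubst hp r a ha.1).2]
  have h1 := allKeys_sound ha.2
  generalize (app (letterSubst r) a one).l = l at h1
  induction l with
  | nil => exact zero_mem _
  | cons t l ih =>
    obtain ⟨h2, h3⟩ := Terms.keys_cons.1 h1
    refine add_mem (zsmul_mem (Subalgebra.smul_mem _ (mono_mem_polynomials b₁ b₂ ?_) _) _) (ih h3)
    simp only [nonpolar, Bool.and_eq_true, Nat.ble_eq] at h2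
    constructor
    · simp only [expsOf, Nat.div_div_eq_div_mul, ← pow_add, Nat.reduceAdd]; omega
    · simp only [expsOf, Nat.div_div_eq_div_mul, ← pow_add, Nat.reduceAdd]; omega

lemma partialTime_frame (D : Derivation ℂ K K) (b₁ b₂ : Bool) :
    partialTime D ((frame K h b₁ b₂).X₁ : LocK K h) = 0 ∧
    partialTime D (↑(frame K h b₁ b₂).X₁⁻¹ : LocK K h) = 0 ∧
    partialTime D ((frame K h b₁ b₂).X₂ : LocK K h) = 0 ∧
    partialTime D (↑(frame K h b₁ b₂).X₂⁻¹ : LocK K h) = 0 ∧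
    partialTime D (frame K h b₁ b₂).Y₁ = 0 ∧ partialTime D (frame K h b₁ b₂).Y₂ = 0 := by
  refine ⟨?_, ?_, ?_, ?_, ?_, ?_⟩
  · cases b₁ <;> exact partialTime_locVar D _
  · cases b₁ <;> exact partialTime_locInv D _
  · cases b₂ <;> exact partialTime_locVar D _
  · cases b₂ <;> exact partialTime_locInv D _
  · cases b₁
    · exact partialTime_locVar D _
    · exact (map_neg _ _).trans (by rw [partialTime_locVar, neg_zero])
  · cases b₂
    · exact partialTime_locVar D _
    · exact (map_neg _ _).trans (by rw [partialTime_locVar, neg_zero])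

lemma partialTime_letterVal (D : Derivation ℂ K K) (hp : p 0 = algebraMap ℂ K h) {d : List Ex}
    {c : K} (hu : ∀ j, (d.getD j (.int 0)).uses (Nat.ble 10) = true)
    (hd : ∀ j, c * D (p j) = (d.getD j (.int 0)).eval fun i => p (i - 10)) (i : ℕ) :
    c • partialTime D (letterVal (frame K h b₁ b₂) p i)
      = (derLetter d i).eval (letterVal (frame K h b₁ b₂) p) := by
  by_cases h9 : i ≤ 9
  · have e : derLetter d i = .int 0 := by simp [derLetter, Nat.ble_eq_true_of_le h9]
    rw [e, Ex.eval_int, Int.cast_zero]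
    obtain ⟨h0, h1, h2, h3, h4, h5⟩ := partialTime_frame (h := h) D b₁ b₂
    by_cases h6 : 6 ≤ i
    · rw [letterVal_param h6, show i - 10 = 0 by omega, hp, partialTime_algebraMap,
        D.map_algebraMap, map_zero, smul_zero]
    · have h7 : partialTime D (letterVal (frame K h b₁ b₂) p i) = 0 := by
        match i, h6 with
        | 0, _ => exact h0
        | 1, _ => exact h1
        | 2, _ => exact h2
        | 3, _ => exact h3
        | 4, _ => exact h4
        | 5, _ => exact h5
        | i + 6, h6 => omega
      rw [h7, smul_zero]
  · have e : derLetter d i = d.getD (i - 10) (.int 0) := by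
      rw [derLetter, show Nat.ble i 9 = false from
        Bool.eq_false_iff.2 fun e => h9 (Nat.le_of_ble_eq_true e)]; rfl
    have hc : ∀ k : K, c • algebraMap K (LocK K h) k = algebraMap K (LocK K h) (c * k) := by
      intro k; rw [map_mul]; exact Algebra.smul_def (R := K) (A := LocK K h) _ _
    rw [e, letterVal_param (by omega), partialTime_algebraMap, hc, hd, Ex.map_eval]
    refine Ex.eval_congr (fun j hj => ?_) (hu _)
    rw [letterVal_param (by have := Nat.le_of_ble_eq_true hj; omega)]

lemma isFlow_sound (D : Derivation ℂ K K) (hp : p 0 = algebraMap ℂ K h) {d : List Ex} {c : K}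
    (hu : ∀ j, (d.getD j (.int 0)).uses (Nat.ble 10) = true)
    (hd : ∀ j, c * D (p j) = (d.getD j (.int 0)).eval fun i => p (i - 10)) {r : Var → Ex} {R : Ex}
    {v : Var} {i : ℕ}
    (hi : letterSubstVal (frame K h b₁ b₂) p r i = values (frame K h b₁ b₂) p r v)
    (hr : isFlow r d R v i = true) :
    comm (values (frame K h b₁ b₂) p r v) (R.eval (letterSubstVal (frame K h b₁ b₂) p r))
      = (algebraMap ℂ K h * c) • partialTime D (values (frame K h b₁ b₂) p r v) := by
  simp only [isFlow, Bool.and_eq_true] at hr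
  have e := isZero_sound (F := frame K h b₁ b₂) hp hr.2
  simp only [Ex.eval_sub, Ex.eval_mul, Ex.eval_var, sub_eq_zero, hi] at e
  rw [comm, e, mul_smul, values,
    Ex.eval_der D c (partialTime_letterVal D hp hu hd)]
  refine Eq.trans ?_ (Algebra.smul_def (R := K) (A := LocK K h) _ _).symm
  congr 1
  · exact congrArg (algebraMap K (LocK K h)) hp
  · refine Ex.eval_congr (fun j hj => ?_) hr.1
    simp only [Bool.or_eq_true, Nat.ble_eq] at hj
    unfold letterSubstVal
    split
    any_goals omega
    rfl

end

end Bdd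

/-! ### Transformed flows and their Hamiltonians. -/

section Flow

lemma comm_add {A : Type*} [Ring A] (x x' y : A) : comm (x + x') y = comm x y + comm x' y := by
  simp only [comm]; noncomm_ring

lemma commute_sub_of_comm_eq {A : Type*} [Ring A] {x y z : A} (e : comm x z = comm y z) :
    Commute (x - y) z := by
  rw [commute_iff_eq, ← sub_eq_zero, ← sub_eq_zero.2 e, comm, comm]; noncomm_ring

variable {K : Type*} [Field K] [Algebra ℂ K] {h : ℂ} {b₁ b₂ : Bool} {p : ℕ → K}

/-- The Hamiltonian of a transformed flow is determined up to a central element. -/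
lemma flowTransforms_iff {κ : ℂ} (hh : h ≠ 0) (hκ : κ ≠ 0) (D : Derivation ℂ K K)
    {r : Var → LocK K h} {R : LocK K h} (hr : ∀ v, r v ∈ (frame K h b₁ b₂).combs)
    (hR : R ∈ (frame K h b₁ b₂).combs)
    (hflow : ∀ v, comm (r v) R = h • partialTime D (r v))
    (hcent : ∀ z, (∀ v, Commute z (r v)) → Commute z (frame K h b₁ b₂).X₁ ∧
      Commute z (frame K h b₁ b₂).X₂ ∧ Commute z (frame K h b₁ b₂).Y₁ ∧
      Commute z (frame K h b₁ b₂).Y₂) (H : FreeAlgebra K Var) :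
    FlowTransformsToPolynomial κ D r H ↔
      FreeAlgebra.lift K r H + (κ * h)⁻¹ • R ∈ polynomials K h := by
  have := nontrivial_locK K hh
  have : CharZero K := charZero_of_injective_algebraMap (algebraMap ℂ K).injective
  have hmul : ∀ (c : ℂ) (x y : LocK K h), comm (c • x) y = c • comm x y := by
    intro c x y; simp only [comm, smul_sub, smul_mul_assoc, mul_smul_comm]
  have hadd : ∀ x x' y : LocK K h, comm (x + x') y = comm x y + comm x' y := comm_add
  -- The explicit time derivative is an inner derivation on the values of `r`, with Hamiltonian a
  -- multiple of `R`. It can thus be absorbed into the transformed Hamiltonian.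
  have hneg : ∀ v, κ • comm ((κ * h)⁻¹ • R) (r v) = -partialTime D (r v) := by
    intro v
    have : comm R (r v) = -(h • partialTime D (r v)) := by rw [← hflow, comm, comm, neg_sub]
    rw [hmul, this, smul_neg, smul_neg, smul_smul, smul_smul, neg_inj]
    rw [show κ * (κ * h)⁻¹ * h = 1 by field_simp, one_smul]
  constructor
  · rintro ⟨G, hG⟩
    set P := FreeAlgebra.lift K (locVar K h) G with hP
    have hPm : P ∈ polynomials K h := mem_polynomials_iff.2 ⟨G, rfl⟩
    -- `P` and `r(H) + (κh)⁻¹R` induce the same evolution of the values `r v`. Hence their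
    -- difference commutes with these values.
    have hz : ∀ v, Commute (FreeAlgebra.lift K r H + (κ * h)⁻¹ • R - P) (r v) := by
      intro v
      have h1 : κ • comm (FreeAlgebra.lift K r H + (κ * h)⁻¹ • R) (r v) = κ • comm P (r v) := by
        rw [hadd, smul_add, hneg, ← hG v]; abel
      exact commute_sub_of_comm_eq (smul_right_injective (LocK K h) hκ h1)
    obtain ⟨c₁, c₂, c₃, c₄⟩ := hcent _ hz
    -- The central elements have been determined only among combinations of normally ordered
    -- monomials, so membership in this subalgebra must be checked.
    have hm : FreeAlgebra.lift K r H + (κ * h)⁻¹ • R - P ∈ (frame K h b₁ b₂).combs := by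
      refine sub_mem (add_mem (lift_mem hr H) ?_) ?_
      · rw [algebra_compatible_smul K]; exact Subalgebra.smul_mem _ hR _
      · obtain ⟨u, -, hu⟩ := exists_comb_of_mem_polynomials b₁ b₂ hPm
        exact ⟨u, hu⟩
    obtain ⟨u, hu⟩ := hm
    rw [← hu] at c₁ c₂ c₃ c₄
    obtain ⟨k, hk⟩ := Frame.comb_central (frame K h b₁ b₂)
      ((map_ne_zero (algebraMap ℂ K)).2 hh) (isUnit_frame_Y₁ K h b₁ b₂) (isUnit_frame_Y₂ K h b₁ b₂)
      u c₁ c₂ c₃ c₄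
    rw [hu, sub_eq_iff_eq_add] at hk
    rw [hk]
    exact add_mem (Subalgebra.algebraMap_mem _ _) hPm
  · intro hm
    obtain ⟨G, hG⟩ := mem_polynomials_iff.1 hm
    refine ⟨G, fun v => ?_⟩
    rw [hG, hadd, smul_add, hneg]; abel

end Flow

/-! ### The elimination algorithm for the polar equations. -/

namespace Linear

section Words

variable {α β : Type*}

/-- The list `[v, f v, …, fⁿ v]`. -/
def orbit (f : α → α) : ℕ → α → List α
  | 0, v => [v]
  | n + 1, v => v :: orbit f n (f v)

/-- The concatenation of the lists which a function, whose first argument decreases, assigns to the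
members of a list. -/
def flat (g : ℕ → α → List β) : ℕ → List α → List β
  | _, [] => []
  | n, a :: l => g n a ++ flat g (n - 1) l

/-- All `f₁ᵃ f₂ᵇ f₃ᶜ f₄ᵈ v` with `a + b + c + d ≤ n`. -/
def words (f₁ f₂ f₃ f₄ : α → α) (n : ℕ) (v : α) : List α :=
  flat (fun n v => flat (fun n v => flat (orbit f₁) n (orbit f₂ n v)) n (orbit f₃ n v)) n
    (orbit f₄ n v)

end Words

/-- The values of the words of length at most five in the letters 6, 8, 7, 9. -/
def images (r : Var → Ex) : List Bdd :=
  words (Bdd.star (Bdd.letterSubst r 6)) (Bdd.star (Bdd.letterSubst r 8))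
    (Bdd.star (Bdd.letterSubst r 7)) (Bdd.star (Bdd.letterSubst r 9)) 5 Bdd.one

/-- A digit in base two. -/
def bit (m i : ℕ) : Bool := Nat.beq (Nat.land (Nat.shiftRight m i) 1) 1

def setBit (m i : ℕ) : ℕ := Nat.lor m (Nat.shiftLeft 1 i)

/-- Rows with the polar exponents to which they belong. -/
abbrev Table := List (ℕ × Terms)

def insertTerm (κ : ℕ) (t : ℕ × ℤ) : Table → Table
  | [] => [(κ, [t])]
  | (κ', r) :: T => bif Nat.beq κ κ' then (κ', t :: r) :: T else (κ, [t]) :: (κ', r) :: T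

/-- The polar terms of an element, grouped by exponents. The digit in position 10 of a key becomes
the number of an unknown. -/
def group (j : ℕ) : Terms → Table
  | [] => []
  | (k, z) :: l => bif Bdd.nonpolar k then group j l else
      insertTerm (k / 256 ^ 11) (k % 256 ^ 10 + j * 256 ^ 10, z) (group j l)

def mergeAux (x : ℕ × Terms) (f : Table → Table) (xs : Table) : Table → Table
  | [] => x :: xs
  | y :: ys =>
    bif Nat.blt x.1 y.1 then x :: f (y :: ys)
    else bif Nat.blt y.1 x.1 then y :: mergeAux x f xs ys
    else (x.1, x.2 ++ y.2) :: f ys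

def merge : Table → Table → Table
  | [] => fun ys => ys
  | x :: xs => mergeAux x (merge xs) xs

def mergePairs : List Table → List Table
  | a :: b :: l => merge a b :: mergePairs l
  | l => l

def mergeAll (l : List Table) : Table :=
  -- Seven rounds of pairwise merging combine up to `2 ^ 7 = 128` tables into one, which suffices
  -- for 126 words.
  (Terms.iter mergePairs 7 l).foldr merge []

/-- The grouped polar parts of the elements of a list, apart from those whose number is in a given
set. -/
def groups (zeros : ℕ) : ℕ → List Bdd → List Table
  | _, [] => []
  | i, b :: l => bif bit zeros i then groups zeros (i + 1) l else
      group i b.l :: groups zeros (i + 1) l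

/-- Whether the bounds of the elements which are used are admissible. -/
def bounded (zeros : ℕ) : ℕ → List Bdd → Bool
  | _, [] => true
  | i, b :: l => (bit zeros i || Nat.ble b.n 127) && bounded zeros (i + 1) l

/-- The linear equation for the unknowns given by the vanishing of a polar coefficient. -/
def select (κ : ℕ) : Table → Terms
  | [] => []
  | (κ', l) :: T => bif Nat.beq κ κ' then l ++ select κ T else select κ T

/-- The mask consists of the top bits of the ten parameter digits. If they are all zero, the digits
are at most 127, and two such codes can be added without a carry. -/
def small (k : ℕ) : Bool := Nat.beq (Nat.land k 0x80808080808080808080) 0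

/-- The empty row is the trivial equation `0 = 0`. A row that fails the test is lost, but no false
equation arises. -/
def guard (l : Terms) : Terms := bif Bdd.allKeys small l then l else []

def dropAll (zeros : ℕ) : Terms → Terms
  | [] => []
  | (k, z) :: l =>
    bif bit zeros (k / 256 ^ 10) then dropAll zeros l else (k, z) :: dropAll zeros l

/-- The coefficient of an unknown. -/
def coeff (j : ℕ) : Terms → Terms
  | [] => []
  | (k, z) :: l => bif Nat.beq (k / 256 ^ 10) j then (k % 256 ^ 10, z) :: coeff j l else coeff j l

/-- The terms with the other unknowns. -/
def drop (j : ℕ) : Terms → Terms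
  | [] => []
  | (k, z) :: l => bif Nat.beq (k / 256 ^ 10) j then drop j l else (k, z) :: drop j l

def pmul : Terms → Terms → Terms
  | [], _ => []
  | (s, z) :: l, v => Terms.merge (Terms.mapKey (fun k => k + s) z v) (pmul l v)

/-- A linear equation solved for the unknown `j`. -/
structure Fact where
  j : ℕ
  piv : Terms
  rest : Terms

/-- Cross multiplication of the row with the solved equation, without division. If nothing remains
besides the pivot, the unknown is zero and its terms are simply deleted. -/
def eliminate (f : Fact) (row : Terms) : Terms :=
  match f.rest with
  | [] => drop f.j row
  | rest@(_ :: _) => guard (Terms.merge (pmul f.piv (drop f.j row))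
      (pmul (Terms.mapKey id (-1) (coeff f.j row)) rest))

/-- The set of the unknowns which occur in a row. -/
def mask : Terms → ℕ
  | [] => 0
  | (k, _) :: l => setBit (mask l) (k / 256 ^ 10)

def reduceAux (f : Fact) (m : ℕ) (row : Terms) (c : ℕ → Terms → Terms) : Terms :=
  bif bit m f.j then (fun row => c (mask row) row) (eliminate f row) else c m row

/-- Use the given equations, the last one first, to eliminate unknowns. -/
def reduce : List Fact → (ℕ → Terms → Terms) → ℕ → Terms → Terms
  | [], c => c
  -- The oldest equation is at the end of the list and is used first. A later equation has been
  -- reduced by the earlier ones before it was recorded, so using it does not bring their unknowns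
  -- back and one pass is enough.
  | f :: l, c => reduce l fun m row => reduceAux f m row c

def content : Terms → ℕ
  | [] => 0
  | (_, z) :: l => Nat.gcd z.natAbs (content l)

def minDigit (i : ℕ) : Terms → ℕ
  | [] => 127
  | (k, _) :: l =>
    (fun a b => bif Nat.ble a b then a else b) (k / 256 ^ i % 256) (minDigit i l)

/-- The greatest common monomial divisor in the parameters which are known to be invertible. -/
def commonMonomial (l : Terms) : ℕ → List Bool → ℕ
  | _, [] => 0
  | i, b :: u => bif b then minDigit i l * 256 ^ i + commonMonomial l (i + 1) u
      else commonMonomial l (i + 1) u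

def divide (g e : ℕ) : Terms → Terms
  | [] => []
  | (k, z) :: l => (k - e, z / (g : ℤ)) :: divide g e l

def eqInt : ℤ → ℤ → Bool
  | .ofNat a, .ofNat b => Nat.beq a b
  | .negSucc a, .negSucc b => Nat.beq a b
  | _, _ => false

def eqTerms : Terms → Terms → Bool
  | [], [] => true
  | (k, z) :: l, (k', z') :: l' => Nat.beq k k' && eqInt z z' && eqTerms l l'
  | _, _ => false

/-- Whether the monomial in the parameters with a given code is known to be invertible. -/
def isUnit : List Bool → ℕ → Bool
  | [], e => Nat.beq e 0
  | b :: u, e => (b || Nat.beq (e % 256) 0) && isUnit u (e / 256)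

/-- Divide by a common factor, if this is possible. -/
def cancel (u : List Bool) (g e : ℕ) (l l' : Terms) : Terms :=
  -- The quotient is verified by multiplying back, so that nothing has to be known about `content`,
  -- `commonMonomial` and `divide`.
  bif Nat.blt 0 g && isUnit u e && Bdd.digitsLE 127 10 e &&
    eqTerms (Terms.mapKey (fun k => k + e) g (guard l')) l then guard l' else l

def normalize (u : List Bool) (l : Terms) : Terms :=
  cancel u (content l) (commonMonomial l 0 u) l (divide (content l) (commonMonomial l 0 u) l)

/-- A pivot with one term must be a monomial in invertible parameters with nonzero coefficient. A
pivot with several terms must occur in a list of polynomials whose nonvanishing is proved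
separately. -/
def isPivot (u : List Bool) (sp : List Terms) : Terms → Bool
  | [] => false
  | [(e, z)] => isUnit u e && Bdd.digitsLE 127 10 e && !eqInt z 0
  | l@(_ :: _ :: _) => sp.any (eqTerms l)

structure State where
  tables : List Table
  facts : List Fact
  zeros : ℕ

/-- A step of the solution of the equations: use a further transformation, or solve an equation from
one of the previous tables for an unknown. -/
inductive Step
  | load (i : ℕ)
  | solve (i j κ : ℕ)

def addFact (u : List Bool) (sp : List Terms) (s : State) (j : ℕ) (piv rest : Terms) : State :=
  bif isPivot u sp piv then
    ⟨s.tables, ⟨j, piv, rest⟩ :: s.facts, bif Bdd.isNil rest then setBit s.zeros j else s.zeros⟩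
  else s

def solveRow (u : List Bool) (sp : List Terms) (s : State) (j : ℕ) (row : Terms) : State :=
  addFact u sp s j (coeff j row) (drop j row)

def step (u : List Bool) (sp : List Terms) (im : ℕ → List Bdd) (s : State) : Step → State
  | .load i => bif bounded s.zeros 0 (im i) then
      ⟨s.tables ++ [mergeAll (groups s.zeros 0 (im i))], s.facts, s.zeros⟩ else s
  -- Only coefficients of monomials with a negative exponent are known to vanish; any other request
  -- leaves the state unchanged.
  | .solve i j κ => bif Bdd.nonpolar (κ * 256 ^ 11) then s else
      (fun row => solveRow u sp s j (normalize u (reduce s.facts (fun _ r => r) (mask row) row)))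
        (guard (dropAll s.zeros (select κ (s.tables.getD i []))))

def run (u : List Bool) (sp : List Terms) (im : ℕ → List Bdd) : State → List Step → State
  | s, [] => s
  | s, t :: l => run u sp im (step u sp im s t) l

/-- The set of the unknowns which are shown to vanish by a triangular system of equations. -/
def vanishing : List Fact → ℕ → ℕ
  | [], Z => Z
  | f :: l, Z =>
    -- Back substitution: the list begins with the equation found last, and the earlier ones may
    -- contain its unknown.
    vanishing l (bif Bdd.allKeys (fun k => bit Z (k / 256 ^ 10)) f.rest then setBit Z f.j else Z)

def allBits (Z : ℕ) : ℕ → Bool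
  | 0 => true
  | n + 1 => bit Z (n + 1) && allBits Z n

/-- Whether the given steps show that all unknowns, except that of number zero, vanish. -/
def solves (u : List Bool) (sp : List Terms) (im : ℕ → List Bdd) (l : List Step) : Bool :=
  -- There are 126 words, and the word of number zero is `1`. Its coefficient, the additive
  -- constant, is the only one left free.
  allBits (vanishing (run u sp im ⟨[], [], 0⟩ l).facts 0) 125

end Linear

/-! ### The transformations, Hamiltonians and elimination steps of the seven systems. -/

namespace Data

open Linear

abbrev X₁ : Ex := .var 0
abbrev I₁ : Ex := .var 1
abbrev X₂ : Ex := .var 2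
abbrev I₂ : Ex := .var 3
abbrev Y₁ : Ex := .var 4
abbrev Y₂ : Ex := .var 5
abbrev Q₁ : Ex := .var 6
abbrev P₁ : Ex := .var 7
abbrev Q₂ : Ex := .var 8
abbrev P₂ : Ex := .var 9

/-- A parameter. -/
abbrev par (i : ℕ) : Ex := .var (10 + i)

/-- The new canonical variables through the letters of a frame. Only those inverses may be used
which are letters of the frame. -/
def chart (b₁ b₂ : Bool) : Chart Ex where
  x₁ := bif b₁ then -Y₁ else X₁
  y₁ := bif b₁ then X₁ else Y₁
  x₂ := bif b₂ then -Y₂ else X₂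
  y₂ := bif b₂ then X₂ else Y₂
  ix₁ := I₁
  iy₁ := I₁
  ix₂ := I₂
  iy₂ := I₂

/-- A transformation in the letters of a frame, the products of the denominators of the
Hamiltonians with the corrections which generate its explicit dependence on the times, and the
expressions for the letters which show that it is invertible. -/
structure Trans where
  (b₁ b₂ : Bool)
  r : Var → Ex
  (R₁ R₂ : Ex)
  gen : List (ℕ × Ex)

/-- The change of projective coordinates, with a parameter. -/
def projective₁ (a : Ex) : Trans where
  b₁ := false
  b₂ := false
  r := subst I₁ (-(X₁ ^ 2 * Y₁) - X₁ * X₂ * Y₂ - a * X₁) (X₂ * I₁) (X₁ * Y₂)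
  R₁ := 0
  R₂ := 0
  gen := [(1, Q₁), (2, Q₂ * X₁), (5, I₁ * P₂), (4, -(I₁ ^ 2 * (P₁ + X₁ * X₂ * Y₂ + a * X₁)))]

def projective₂ (a : Ex) : Trans where
  b₁ := false
  b₂ := false
  r := subst (X₁ * I₂) (X₂ * Y₁) I₂ (-(X₂ ^ 2 * Y₂) - X₁ * X₂ * Y₁ - a * X₂)
  R₁ := 0
  R₂ := 0
  gen := [(3, Q₂), (0, Q₁ * X₂), (4, I₂ * P₁), (5, -(I₂ ^ 2 * (P₂ + X₁ * X₂ * Y₁ + a * X₂)))]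

def inversion₁ (a : Ex) : Trans where
  b₁ := false
  b₂ := false
  r := subst I₁ (-(X₁ ^ 2 * Y₁) - a * X₁) X₂ Y₂
  R₁ := 0
  R₂ := 0
  gen := [(1, Q₁), (2, Q₂), (5, P₂), (4, -(I₁ ^ 2 * (P₁ + a * X₁)))]

def inversion₂ (a : Ex) : Trans where
  b₁ := false
  b₂ := false
  r := subst X₁ Y₁ I₂ (-(X₂ ^ 2 * Y₂) - a * X₂)
  R₁ := 0
  R₂ := 0
  gen := [(3, Q₂), (0, Q₁), (4, P₁), (5, -(I₂ ^ 2 * (P₂ + a * X₂)))]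

def dualInversion₁ (a : Ex) : Trans where
  b₁ := true
  b₂ := false
  r := (fun c => subst (-(c.x₁ * c.y₁ ^ 2) + a * c.y₁) c.iy₁ c.x₂ c.y₂) (chart true false)
  R₁ := 0
  R₂ := 0
  gen := [(1, P₁), (2, Q₂), (5, P₂), (4, (Q₁ - a * X₁) * I₁ ^ 2)]

def dualInversion₂ (a : Ex) : Trans where
  b₁ := false
  b₂ := true
  r := (fun c => subst c.x₁ c.y₁ (-(c.x₂ * c.y₂ ^ 2) + a * c.y₂) c.iy₂) (chart false true)
  R₁ := 0
  R₂ := 0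
  gen := [(3, P₂), (0, Q₁), (4, P₁), (5, (Q₂ - a * X₂) * I₂ ^ 2)]

def shiftedInversion (t t₁ a R₁ R₂ : Ex) : Trans where
  b₁ := true
  b₂ := false
  r := (fun c => subst (-(c.x₁ * c.y₁ ^ 2) - t * c.x₂ + a * c.y₁ + t₁) c.iy₁ c.x₂
    (t * c.iy₁ + c.y₂)) (chart true false)
  R₁ := R₁
  R₂ := R₂
  gen := [(1, P₁), (2, Q₂), (5, P₂ - t * I₁), (4, (Q₁ + t * X₂ - a * X₁ - t₁) * I₁ ^ 2)]

/-- The data of one system: the parameters which are invertible, the derivatives of the parameters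
with respect to the two times and the Hamiltonians, each multiplied by the denominators of the
Hamiltonians, the transformations, further pivots, and the steps of the uniqueness proof. -/
structure System where
  units : List Bool
  (d₁ d₂ : List Ex)
  (H₁ H₂ : Ex)
  trans : List Trans
  pivots : List Terms
  steps : List Step

/-! ### The system `G(1,1,1,1,1)` -/

namespace G11111

abbrev h : Ex := par 0
abbrev a₁ : Ex := par 1
abbrev δ : Ex := par 2
abbrev a₃ : Ex := par 3
abbrev a₄ : Ex := par 4
abbrev a₅ : Ex := par 5
abbrev S : Ex := par 6
abbrev t : Ex := par 7
abbrev t₂ : Ex := par 8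
-- The differences and sums which have to be nonzero, `δ` and `S`, serve as independent parameters
-- in place of `α₂` and `α₆`. Most pivots thereby become monomials. The quotient `t = t₁ / t₂` makes
-- the sixth transformation polynomial in the parameters.
abbrev a₂ : Ex := a₁ - δ
abbrev a₆ : Ex := h - a₁ - a₂ - a₃ - a₄ - a₅ - S
abbrev t₁ : Ex := t * t₂

def H₁ : Ex :=
  (t₂ - t₁) * (Q₁ ^ 3 * P₁ ^ 2) + (2 * (t₂ - t₁)) * (Q₁ ^ 2 * Q₂ * P₁ * P₂)
    + (t₂ - t₁) * (Q₁ * Q₂ ^ 2 * P₂ ^ 2) + ((t₁ + 1) * (t₁ - t₂)) * (Q₁ ^ 2 * P₁ ^ 2)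
    - (2 * t₁ * (t₂ - 1)) * (Q₁ * Q₂ * P₁ * P₂) + (t₁ * (t₁ - 1)) * (Q₁ * Q₂ * P₁ ^ 2)
    + (t₂ * (t₁ - 1)) * (Q₁ * Q₂ * P₂ ^ 2)
    - ((h - a₁ - a₂) * (t₂ - t₁)) * (Q₁ * (Q₁ * P₁ + Q₂ * P₂))
    - (t₁ * (t₁ - t₂)) * (Q₁ * P₁ ^ 2)
    + (h * (t₂ - t₁) + (a₁ + a₂) * (t₁ - t₂) + a₃ * t₁ * (t₂ - t₁) + a₄ * t₂ * (t₁ - 1)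
        - a₅ * (t₁ ^ 2 - t₁ + t₂ - t₁ * t₂)) * (Q₁ * P₁)
    - (a₄ * t₂ * (t₁ - 1)) * (Q₁ * P₂) - (a₃ * t₁ * (t₁ - 1)) * (Q₂ * P₁)
    + (a₃ * t₁ * (t₂ - 1)) * (Q₂ * P₂) + (a₁ * a₂ * (t₂ - t₁)) * Q₁
    + (a₃ * t₁ * (t₁ - t₂)) * P₁

def H₂ : Ex :=
  (t₁ - t₂) * (Q₂ ^ 3 * P₂ ^ 2) - (2 * (t₂ - t₁)) * (Q₁ * Q₂ ^ 2 * P₁ * P₂)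
    + (t₁ - t₂) * (Q₁ ^ 2 * Q₂ * P₁ ^ 2) + ((t₂ + 1) * (t₂ - t₁)) * (Q₂ ^ 2 * P₂ ^ 2)
    - (2 * t₂ * (t₁ - 1)) * (Q₁ * Q₂ * P₁ * P₂) + (t₁ * (t₂ - 1)) * (Q₁ * Q₂ * P₁ ^ 2)
    + (t₂ * (t₂ - 1)) * (Q₁ * Q₂ * P₂ ^ 2)
    + ((h - a₁ - a₂) * (t₂ - t₁)) * (Q₁ * Q₂ * P₁ + Q₂ ^ 2 * P₂)
    - (t₂ * (t₂ - t₁)) * (Q₂ * P₂ ^ 2)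
    + (a₄ * t₂) * ((t₁ - 1) * (Q₁ * P₁) - (t₂ - 1) * (Q₁ * P₂))
    - (a₃ * t₁ * (t₂ - 1)) * (Q₂ * P₁)
    + (h * (t₁ - t₂) + (a₁ + a₂) * (t₂ - t₁) + a₃ * t₁ * (t₂ - 1) + a₄ * t₂ * (t₁ - t₂)
        - a₅ * (t₁ + t₂ ^ 2 - t₂ - t₁ * t₂)) * (Q₂ * P₂)
    - (a₁ * a₂ * (t₂ - t₁)) * Q₂ + (a₄ * t₂ * (t₂ - t₁)) * P₂

/-- The polynomial `t - 1`. -/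
def tMinusOne : Terms := [(0, -1), (256 ^ 7, 1)]

/-- The polynomial `t₁ - 1`. -/
def t₁MinusOne : Terms := [(0, -1), (256 ^ 7 + 256 ^ 8, 1)]

/-- The polynomial `t₂ - 1`. -/
def t₂MinusOne : Terms := [(0, -1), (256 ^ 8, 1)]

def system : System where
  units := [true, false, true, false, false, false, true, true, true]
  d₁ := [0, 0, 0, 0, 0, 0, 0, S * t * (t * t₂ - 1) * (t * t₂ - t₂), 0]
  d₂ := [0, 0, 0, 0, 0, 0, 0, -(S * t * (t₂ - 1) * (t₂ - t * t₂)),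
    S * t₂ * (t₂ - 1) * (t₂ - t * t₂)]
  H₁ := H₁
  H₂ := H₂
  trans := [projective₁ a₁, projective₁ a₂, dualInversion₁ a₃, dualInversion₂ a₄,
    shiftedInversion 1 1 a₅ 0 0,
    -- The dependence of the values for `q₁` and `p₂` on `t₁` is generated by `P₁ - P₁ Q₂ / t₂`, and
    -- that on `t₂` by a multiple of `P₁ Q₂`. Both are multiplied by the denominators of the
    -- Hamiltonians.
    shiftedInversion t t₁ a₆ (S * t * (t * t₂ - 1) * (t - 1) * t₂ * (t₂ * P₁ - P₁ * Q₂))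
      (S * t₂ * (t₂ - 1) * (1 - t) * t * (P₁ * Q₂))]
  -- The nonmonomial pivots which the elimination meets. Up to integer factors they are products of
  -- `t - 1`, `t₁ - 1` and `t₂ - 1`.
  pivots := [tMinusOne, t₁MinusOne, pmul [(0, 2)] t₁MinusOne,
    pmul [(0, -1)] (pmul t₁MinusOne (pmul t₁MinusOne t₁MinusOne)),
    pmul (pmul tMinusOne tMinusOne) (pmul t₂MinusOne t₁MinusOne)]
  -- The last entry of a step encodes the monomial `X₁ᵃ X₂ᵇ Y₁ᶜ Y₂ᵈ` as `c + 256 d + 256² (a + 128)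
  -- + 256³ (b + 128)`; for instance 2155806720 is `X₁⁻¹`. The second entry is the number of the
  -- unknown. The order of the steps is mere data, since each of them is checked.
  steps := [
    .load 0, .solve 0 33 2206138369, .solve 0 45 2239693312, .solve 0 18 2222718976,
    .solve 0 35 2222850049, .solve 0 20 2239430656, .solve 0 31 2189361153, .solve 0 16 2205941760,
    .solve 0 34 2206072833, .solve 0 19 2222653440, .solve 0 28 2172583937, .solve 0 13 2189164544,
    .solve 0 32 2189295617, .solve 0 17 2205876224, .solve 0 59 2155741440, .solve 0 94 2155807232,
    .solve 0 24 2155806721, .solve 0 9 2172387328, .solve 0 29 2172518401, .solve 0 14 2189099008,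
    .solve 0 4 2155610112, .solve 0 60 2155675904, .solve 0 25 2155741185, .solve 0 10 2172321792,
    .solve 0 5 2155544576, .solve 0 11 2189295616, .solve 0 68 2206073088, .solve 0 15 2206007296,
    .solve 0 70 2222784768, .solve 0 7 2172518400, .solve 0 66 2189295872, .solve 0 12 2189230080,
    .solve 0 69 2206007552, .solve 0 2 2155741184, .solve 0 63 2172518656, .solve 0 8 2172452864,
    .solve 0 67 2189230336, .solve 0 3 2155675648, .solve 0 64 2172453120, .solve 0 97 2172584448,
    .solve 0 58 2155806976, .solve 0 100 2206138880, .solve 0 99 2189361664, .solve 0 6 2172583936,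
    .solve 0 1 2155806720, .solve 0 65 2189361408, .solve 0 62 2172584192, .load 1,
    .solve 1 74 2155806976, .solve 1 79 2189361408, .solve 1 77 2172584192, .solve 1 27 2172583936,
    .solve 1 23 2155806720, .load 2, .solve 2 117 2155807488, .solve 2 124 2155807744,
    .solve 2 107 2155741696, .solve 2 120 2155741952, .solve 2 87 2155675904,
    .solve 2 110 2155676160, .solve 2 52 2155610112, .solve 2 90 2155610368, .solve 2 55 2155544576,
    .solve 2 104 2172584448, .solve 2 119 2172584704, .solve 2 84 2172518656,
    .solve 2 109 2172518912, .solve 2 49 2172452864, .solve 2 89 2172453120, .solve 2 54 2172387328,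
    .solve 2 78 2189361408, .solve 2 106 2189361664, .solve 2 43 2189295616, .solve 2 86 2189295872,
    .solve 2 51 2189230080, .solve 2 80 2206138624, .solve 2 47 2155806721, .solve 2 88 2155806977,
    .solve 2 53 2155741185, .solve 2 50 2172583937, .solve 0 44 2222916096, .solve 2 36 2155741184,
    .solve 2 81 2155741440, .solve 2 46 2155675648, .solve 2 40 2172518400, .solve 2 30 2189361152,
    .solve 2 71 2155806976, .solve 2 101 2155807232, .solve 2 26 2172583936, .solve 2 75 2172584192,
    .solve 2 21 2155806720, .load 3, .solve 3 121 2088763392, .solve 3 125 2071986176,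
    .solve 3 114 2139095296, .solve 3 123 2122318080, .solve 3 112 2105606144,
    .solve 3 122 2088828928, .solve 3 102 2122383361, .solve 3 118 2105606145,
    .solve 3 82 2139160578, .solve 3 108 2122383362, .solve 3 115 2139160832,
    .solve 3 93 2122448896, .solve 3 113 2105671680, .solve 3 73 2139226113,
    .solve 3 103 2122448897, .solve 3 83 2139226114, .solve 3 91 2122317824,
    .solve 3 111 2105540608, .solve 3 92 2122383360, .solve 3 57 2139160576, .solve 3 72 2139160577,
    .solve 3 56 2139095040, .load 4, .solve 4 48 2155675648, .solve 4 105 2172584448,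
    .solve 4 85 2172452864, .solve 4 116 2189361664, .solve 4 61 2172583936, .solve 4 22 2155806720,
    .load 5, .solve 4 37 2155741184, .solve 4 98 2189295616, .solve 4 95 2172584192,
    .solve 4 42 2189361408, .solve 5 41 2189295616, .solve 5 38 2155741184, .solve 5 96 2172584192,
    .solve 5 39 2155806720, .solve 5 76 2172583936]

end G11111

/-! ### The system `G(1,1,1,2)` -/

namespace G1112

abbrev h : Ex := par 0
abbrev a₁ : Ex := par 1
abbrev a₂ : Ex := par 2
abbrev a₃ : Ex := par 3
abbrev δ : Ex := par 4
abbrev S : Ex := par 5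
abbrev η : Ex := par 6
abbrev t : Ex := par 7
abbrev t₂ : Ex := par 8
-- As before, `δ = α₃ - α₄`, the constant `S` and `t = t₁ / t₂` are made independent parameters, so
-- that the nondegeneracy conditions are invertibility of parameters.
abbrev a₄ : Ex := a₃ - δ
abbrev a₅ : Ex := S - h + a₁ - a₂ - a₃ - a₄
abbrev t₁ : Ex := t * t₂

def H₁ : Ex :=
  Q₁ ^ 3 * P₁ ^ 2 + 2 * Q₁ ^ 2 * Q₂ * P₁ * P₂ + Q₁ * Q₂ ^ 2 * P₂ ^ 2
    - t₁ * (Q₁ ^ 2 * P₁ ^ 2) - t₂ * (Q₁ * Q₂ * P₂ ^ 2)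
    + (a₃ + a₄ - h) * (Q₁ ^ 2 * P₁ + Q₁ * Q₂ * P₂)
    + (η + (2 * h - a₁) * t₁) * (Q₁ * P₁) + (a₂ * t₂) * (Q₁ * P₂) + (η * t₁) * (Q₂ * P₁)
    + (η * (1 - t₂)) * (Q₂ * P₂) + (a₃ * a₄) * Q₁ - (η * t₁) * P₁

def H₂ : Ex :=
  t₁ * (Q₁ ^ 2 * Q₂ * P₁ ^ 2 + Q₂ ^ 3 * P₂ ^ 2 + 2 * Q₁ * Q₂ ^ 2 * P₁ * P₂)
    + (t₂ * (t₂ - 1)) * (Q₁ * Q₂ * P₂ ^ 2)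
    - t₁ * ((2 * t₂) * (Q₁ * Q₂ * P₁ * P₂) + (t₂ + 1) * (Q₂ ^ 2 * P₂ ^ 2))
    + ((a₃ + a₄ - h) * t₁) * (Q₁ * Q₂ * P₁ + Q₂ ^ 2 * P₂) + (t₁ * t₂) * (Q₂ * P₂ ^ 2)
    + (a₂ * t₁ * t₂) * (Q₁ * P₁) + (a₂ * t₂ * (1 - t₂)) * (Q₁ * P₂)
    + (η * t₁ * (1 - t₂)) * (Q₂ * P₁)
    + (t₁ * (-(a₁ * (t₂ - 1)) + a₂ * t₂ - a₃ - a₄ + (2 * t₂ - 1) * h)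
        + η * t₂ * (t₂ - 1)) * (Q₂ * P₂)
    + (a₃ * a₄ * t₁) * Q₂ - (a₂ * t₁ * t₂) * P₂

def system : System where
  units := [true, false, false, false, true, true, true, true, true]
  d₁ := [0, 0, 0, 0, 0, 0, 0, S * t ^ 2 * t₂, 0]
  d₂ := [0, 0, 0, 0, 0, 0, 0, -(S * t ^ 2 * t₂ * (t₂ - 1)), S * t * t₂ ^ 2 * (t₂ - 1)]
  H₁ := H₁
  H₂ := H₂
  trans := [projective₁ a₃, projective₁ a₄,
    { b₁ := false
      b₂ := false
      r := subst X₁ (η * (I₁ ^ 2 * (X₂ - 1)) - a₁ * I₁ + Y₁) X₂ (-(η * I₁) + Y₂)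
      R₁ := 0
      R₂ := 0
      gen := [(0, Q₁), (2, Q₂), (5, P₂ + η * I₁), (4, P₁ - η * (I₁ ^ 2 * (X₂ - 1)) + a₁ * I₁)] },
    dualInversion₂ a₂,
    shiftedInversion t t₁ a₅ (S * t ^ 2 * t₂ * (t₂ * P₁ - P₁ * Q₂))
      (S * t ^ 2 * t₂ * (t₂ - 1) * (P₁ * Q₂))]
  pivots := [[(0, 1), (256 ^ 8, -1)]]
  -- Tables are numbered in the order of loading: table 2 comes from the transformation of index 3,
  -- and table 3 from that of index 2.
  steps := [
    .load 0, .solve 0 33 2206138369, .solve 0 45 2239693312, .solve 0 18 2222718976,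
    .solve 0 35 2222850049, .solve 0 20 2239430656, .solve 0 31 2189361153, .solve 0 16 2205941760,
    .solve 0 34 2206072833, .solve 0 19 2222653440, .solve 0 28 2172583937, .solve 0 13 2189164544,
    .solve 0 32 2189295617, .solve 0 17 2205876224, .solve 0 59 2155741440, .solve 0 94 2155807232,
    .solve 0 24 2155806721, .solve 0 9 2172387328, .solve 0 29 2172518401, .solve 0 14 2189099008,
    .solve 0 4 2155610112, .solve 0 60 2155675904, .solve 0 25 2155741185, .solve 0 10 2172321792,
    .solve 0 5 2155544576, .solve 0 11 2189295616, .solve 0 68 2206073088, .solve 0 15 2206007296,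
    .solve 0 70 2222784768, .solve 0 7 2172518400, .solve 0 66 2189295872, .solve 0 12 2189230080,
    .solve 0 69 2206007552, .solve 0 2 2155741184, .solve 0 63 2172518656, .solve 0 8 2172452864,
    .solve 0 67 2189230336, .solve 0 3 2155675648, .solve 0 64 2172453120, .solve 0 97 2172584448,
    .solve 0 58 2155806976, .solve 0 100 2206138880, .solve 0 99 2189361664, .solve 0 6 2172583936,
    .solve 0 1 2155806720, .solve 0 65 2189361408, .solve 0 62 2172584192, .load 1,
    .solve 1 74 2155806976, .solve 1 79 2189361408, .solve 1 77 2172584192, .solve 1 27 2172583936,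
    .solve 1 23 2155806720, .load 3, .solve 2 121 2088763392, .solve 2 125 2071986176,
    .solve 2 117 2105540609, .solve 2 124 2088763393, .solve 2 107 2122317826,
    .solve 2 120 2105540610, .solve 2 87 2139095043, .solve 2 110 2122317827,
    .solve 2 90 2139095044, .solve 2 114 2139095296, .solve 2 123 2122318080,
    .solve 2 119 2139095297, .solve 2 112 2105606144, .solve 2 122 2088828928,
    .solve 2 102 2122383361, .solve 2 118 2105606145, .solve 2 82 2139160578,
    .solve 2 108 2122383362, .solve 2 88 2139160579, .solve 2 115 2139160832,
    .solve 2 93 2122448896, .solve 2 113 2105671680, .solve 2 73 2139226113,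
    .solve 2 103 2122448897, .solve 2 83 2139226114, .solve 2 91 2122317824,
    .solve 2 111 2105540608, .solve 2 101 2122317825, .solve 2 92 2122383360,
    .solve 2 71 2139095041, .solve 2 81 2139095042, .solve 2 57 2139160576, .solve 2 72 2139160577,
    .solve 2 56 2139095040, .load 2, .solve 3 109 2172387840, .solve 3 89 2189033728,
    .solve 3 55 2239102976, .solve 3 54 2239234048, .solve 3 106 2206073344, .solve 3 43 2222718976,
    .solve 3 86 2222719232, .solve 3 51 2239365120, .solve 3 80 2222850304, .solve 3 104 2172518912,
    .solve 3 84 2172518657, .solve 3 52 2155741187, .solve 3 53 2172583939, .solve 3 85 2189361409,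
    .solve 3 49 2189295618, .solve 3 50 2189361154, .solve 0 44 2222916096, .solve 3 78 2206073088,
    .solve 3 105 2172584448, .solve 3 46 2155741186, .solve 3 47 2172583938, .solve 0 30 2206138624,
    .solve 3 41 2206007296, .solve 3 75 2172518656, .solve 3 116 2189361664, .load 4,
    .solve 4 48 2155675648, .solve 3 40 2205941760, .solve 3 36 2155610112, .solve 3 37 2172583937,
    .solve 3 21 2155741184, .solve 3 95 2172584192, .solve 4 38 2155741184, .solve 3 98 2189361408,
    .solve 3 22 2155806720, .solve 3 26 2189295616, .solve 3 61 2172583936, .solve 4 76 2189295616,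
    .solve 4 39 2189361408, .solve 4 96 2172583936, .solve 4 42 2155806720]

end G1112

/-! ### The system `G(1,1,3)` -/

namespace G113

abbrev h : Ex := par 0
abbrev a₁ : Ex := par 1
abbrev a₂ : Ex := par 2
abbrev a₃ : Ex := par 3
abbrev S : Ex := par 4
abbrev u : Ex := par 5
abbrev t₂ : Ex := par 6
abbrev a₄ : Ex := h - a₁ - a₂ - a₃ - S
-- The difference `u = t₁ - t₂` is the essential factor of the denominators and is taken as a
-- parameter, so that it can be inverted as a monomial.
abbrev t₁ : Ex := t₂ + u

def H₁ : Ex :=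
  Q₁ ^ 2 * P₁ * P₂ + Q₂ ^ 2 * P₁ * P₂ - 2 * Q₁ * Q₂ * P₁ * P₂
    + (t₁ - t₂) * (Q₁ ^ 2 * P₁ - 2 * Q₁ * P₁ ^ 2 - 2 * Q₂ * P₁ * P₂)
    + (2 * t₁ ^ 2 - 2 * t₁ * t₂ - a₃) * (Q₁ * P₁) + a₂ * (Q₁ * P₂) + a₃ * (Q₂ * P₁)
    - a₂ * (Q₂ * P₂) + (a₂ * (t₁ - t₂)) * Q₁ + (2 * a₁ * (t₁ - t₂)) * P₁

def H₂ : Ex :=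
  Q₁ ^ 2 * P₁ * P₂ + Q₂ ^ 2 * P₁ * P₂ - 2 * Q₁ * Q₂ * P₁ * P₂
    - (t₁ - t₂) * (Q₂ ^ 2 * P₂ - 2 * Q₂ * P₂ ^ 2 - 2 * Q₁ * P₁ * P₂)
    - a₃ * (Q₁ * P₁) + a₂ * (Q₁ * P₂) + a₃ * (Q₂ * P₁)
    - (2 * t₁ * t₂ - 2 * t₂ ^ 2 + a₂) * (Q₂ * P₂) - (a₃ * (t₁ - t₂)) * Q₂
    - (2 * a₁ * (t₁ - t₂)) * P₂

def system : System where
  units := [true, false, false, false, true, true, true]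
  d₁ := [0, 0, 0, 0, 0, S * u, 0]
  d₂ := [0, 0, 0, 0, 0, S * u, -(S * u)]
  H₁ := H₁
  H₂ := H₂
  trans := [
    { b₁ := true
      b₂ := false
      r := (fun c => subst (-(c.x₁ * c.y₁ ^ 2) - c.x₂ * c.y₁ * c.y₂ + a₁ * c.y₁) c.iy₁
        (c.x₂ * c.y₁) (c.y₂ * c.iy₁)) (chart true false)
      R₁ := 0
      R₂ := 0
      gen := [(1, P₁), (2, Q₂ * I₁), (5, P₂ * X₁), (4, (Q₁ + X₂ * X₁ * Y₂ - a₁ * X₁) * I₁ ^ 2)] },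
    inversion₁ a₂, inversion₂ a₃,
    { b₁ := true
      b₂ := false
      r := (fun c => subst (-(c.x₁ * c.y₁ ^ 2) - c.x₂ * c.y₁ * c.y₂ + 2 * c.iy₁ * (c.y₂ + 1)
        + a₄ * c.y₁ - 2 * t₁) c.iy₁ (c.x₂ * c.y₁ + 2 * c.iy₁ * (c.y₂ + 1) - 2 * t₂)
        (c.y₂ * c.iy₁)) (chart true false)
      -- Up to the denominators, the shifts `-2 t₁` and `-2 t₂` are generated by `-2 P₁` and `-2
      -- P₂`. The signs differ because the denominators are `S u` and `-S u`.
      R₁ := -(2 * S * u * P₁)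
      R₂ := 2 * S * u * P₂
      gen := [(1, P₁), (5, P₂ * X₁), (2, (Q₂ - 2 * I₁ * (Y₂ + 1) + 2 * t₂) * I₁),
        (4, (Q₁ + X₂ * X₁ * Y₂ - 2 * I₁ * (Y₂ + 1) - a₄ * X₁ + 2 * t₁) * I₁ ^ 2)] }]
  pivots := []
  steps := [
    .load 0, .solve 0 121 2155611136, .solve 0 125 2155545856, .solve 0 117 2155610880,
    .solve 0 124 2155545600, .solve 0 107 2155610624, .solve 0 120 2155545344,
    .solve 0 87 2155610368, .solve 0 110 2155545088, .solve 0 52 2155610112, .solve 0 90 2155544832,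
    .solve 0 55 2155544576, .solve 0 49 2172518400, .solve 0 54 2172452864, .solve 0 51 2189361152,
    .solve 0 112 2155807489, .solve 0 122 2155742209, .solve 0 102 2155807233,
    .solve 0 118 2155741953, .solve 0 82 2155806977, .solve 0 108 2155741697,
    .solve 0 47 2155806721, .solve 0 88 2155741441, .solve 0 53 2155741185, .solve 0 113 2189362432,
    .solve 0 114 2172519168, .solve 0 91 2155741696, .solve 0 123 2172453888,
    .solve 0 111 2155676416, .solve 0 104 2172518912, .solve 0 71 2155741440,
    .solve 0 119 2172453632, .solve 0 101 2155676160, .solve 0 84 2172518656,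
    .solve 0 36 2155741184, .solve 0 109 2172453376, .solve 0 81 2155675904, .solve 0 89 2172453120,
    .solve 0 46 2155675648, .solve 0 86 2189361408, .solve 0 40 2172583936, .solve 0 116 2189361920,
    .solve 0 106 2189361664, .solve 0 56 2155806976, .solve 0 21 2155806720, .solve 0 95 2172584448,
    .solve 0 75 2172584192, .load 1, .solve 1 96 2172584448, .solve 1 115 2172584704,
    .solve 1 66 2189361408, .solve 1 99 2189361664, .solve 1 16 2206138368, .solve 1 69 2206138624,
    .solve 1 19 2222915584, .solve 1 93 2155741696, .solve 1 63 2172518656, .solve 1 97 2172518912,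
    .solve 1 13 2189295616, .solve 1 67 2189295872, .solve 1 17 2206072832, .solve 1 59 2155675904,
    .solve 1 94 2155676160, .solve 1 24 2155806721, .solve 1 74 2155806977, .solve 1 9 2172452864,
    .solve 1 64 2172453120, .solve 1 29 2172583937, .solve 1 14 2189230080, .solve 1 4 2155610112,
    .solve 1 60 2155610368, .solve 1 25 2155741185, .solve 1 10 2172387328, .solve 1 5 2155544576,
    .solve 0 103 2189362176, .solve 1 2 2155741184, .solve 1 58 2155741440, .solve 1 8 2172518400,
    .solve 1 3 2155675648, .solve 1 92 2155807232, .solve 1 57 2155806976, .solve 1 7 2172583936,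
    .solve 1 62 2172584192, .solve 1 12 2189361152, .solve 1 1 2155806720, .load 2,
    .solve 2 43 2122317826, .solve 2 68 2139095296, .solve 2 33 2105540609, .solve 2 80 2139095297,
    .solve 2 45 2105540610, .solve 2 18 2088763392, .solve 2 70 2122318080, .solve 2 35 2088763393,
    .solve 2 20 2071986176, .solve 2 41 2139160578, .solve 2 50 2139160579, .solve 2 31 2122383361,
    .solve 2 44 2122383362, .solve 2 34 2105606145, .solve 2 28 2139226113, .solve 2 42 2139226114,
    .solve 2 32 2122448897, .solve 2 11 2122317824, .solve 2 30 2122317825, .solve 2 15 2105540608,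
    .solve 2 26 2139095041, .solve 2 27 2139160577, .solve 2 6 2139095040, .load 3,
    .solve 3 79 2189361408, .solve 3 77 2189362176, .solve 3 105 2155741953, .solve 3 22 2155741184,
    .solve 3 76 2155807233, .solve 3 61 2155741696, .solve 3 72 2155676416, .solve 3 37 2155675648,
    .solve 3 98 2155611136, .solve 3 83 2172519168, .solve 3 100 2155545856, .solve 3 39 2189361920,
    .solve 3 48 2155544576, .solve 3 85 2155545088, .solve 3 38 2155806721, .solve 3 65 2172584448,
    .solve 3 23 2155806976, .solve 3 73 2155610880, .solve 3 78 2155806720]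

end G113

/-! ### The system `G(1,2,2)` -/

namespace G122

abbrev h : Ex := par 0
abbrev a₁ : Ex := par 1
abbrev S : Ex := par 2
abbrev a₃ : Ex := par 3
abbrev a₄ : Ex := par 4
abbrev t₁ : Ex := par 5
abbrev t : Ex := par 6
-- Replacing `α₂` by `S` makes the denominator an independent parameter, and `t = t₂ / t₁` removes
-- the fraction from the last transformation.
abbrev a₂ : Ex := S - 2 * h - a₁ - a₃ - 2 * a₄
abbrev t₂ : Ex := t * t₁

def H₁ : Ex :=
  (t₁ - t₂) * (Q₁ ^ 2 * P₁ ^ 2) + (2 * t₁) * (Q₁ * Q₂ * P₁ * P₂) - t₂ * (Q₁ ^ 2 * P₁ * P₂)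
    - t₁ * (Q₂ ^ 2 * P₁ * P₂) + (t₂ - t₁) * (Q₁ ^ 2 * P₁)
    + ((a₁ + a₂ + a₃) * t₁ - (a₁ + a₂) * t₂) * (Q₁ * P₁) - (a₁ * t₂) * (Q₁ * P₂)
    - (a₃ * t₁) * (Q₂ * P₁) + (a₁ * t₁) * (Q₂ * P₂) - (a₁ * (t₁ - t₂)) * Q₁
    + (t₁ * (t₁ - t₂)) * P₁

def H₂ : Ex :=
  (t₁ - t₂) * (Q₂ ^ 2 * P₂ ^ 2) - (2 * t₂) * (Q₁ * Q₂ * P₁ * P₂) + t₂ * (Q₁ ^ 2 * P₁ * P₂)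
    + t₁ * (Q₂ ^ 2 * P₁ * P₂) + (t₂ - t₁) * (Q₂ ^ 2 * P₂) - (a₃ * t₂) * (Q₁ * P₁)
    + (a₁ * t₂) * (Q₁ * P₂) + (a₃ * t₁) * (Q₂ * P₁)
    + ((a₂ + a₃) * t₁ - (a₁ + a₂ + a₃) * t₂) * (Q₂ * P₂) - (a₃ * (t₁ - t₂)) * Q₂
    + (t₂ * (t₁ - t₂)) * P₂

def system : System where
  units := [true, false, true, false, false, true, true]
  d₁ := [0, 0, 0, 0, 0, S * t₁ * (t₁ - t * t₁), -(S * t * (t₁ - t * t₁))]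
  d₂ := [0, 0, 0, 0, 0, 0, S * t * (t₁ - t * t₁)]
  H₁ := H₁
  H₂ := H₂
  trans := [inversion₁ a₁,
    { b₁ := false
      b₂ := false
      r := subst I₁ (-(X₁ ^ 2 * Y₁) - a₂ * X₁ - Y₂ + 1) (I₁ + X₂) Y₂
      R₁ := 0
      R₂ := 0
      gen := [(1, Q₁), (2, Q₂ - I₁), (5, P₂), (4, -(I₁ ^ 2 * (P₁ + a₂ * X₁ + Y₂ - 1)))] },
    inversion₂ a₃,
    { b₁ := false
      b₂ := false
      r := subst X₁
        (-(t * (I₁ ^ 2 * Y₂)) - 2 * X₂ * I₁ * Y₂ - t₁ * I₁ ^ 2 + (2 * a₄) * I₁ + Y₁)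
        (X₁ ^ 2 * X₂ + t * X₁) (I₁ ^ 2 * Y₂)
      R₁ := S * t₁ * (1 - t) * (-(t * (Q₁ * P₂)) - t₁ * I₁)
      R₂ := S * t * t₁ * (1 - t) * (Q₁ * P₂)
      gen := [(0, Q₁), (5, X₁ ^ 2 * P₂), (2, I₁ ^ 2 * (Q₂ - t * X₁)),
        (4, P₁ + t * (I₁ ^ 2 * Y₂) + 2 * X₂ * I₁ * Y₂ + t₁ * I₁ ^ 2 - (2 * a₄) * I₁)] }]
  pivots := [[(0, 1), (256 ^ 6, -1)]]
  steps := [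
    .load 0, .solve 0 112 2155807488, .solve 0 122 2155807744, .solve 0 96 2172584448,
    .solve 0 115 2172584704, .solve 0 66 2189361408, .solve 0 99 2189361664, .solve 0 16 2206138368,
    .solve 0 69 2206138624, .solve 0 19 2222915584, .solve 0 93 2155741696, .solve 0 113 2155741952,
    .solve 0 63 2172518656, .solve 0 97 2172518912, .solve 0 13 2189295616, .solve 0 67 2189295872,
    .solve 0 17 2206072832, .solve 0 59 2155675904, .solve 0 94 2155676160, .solve 0 24 2155806721,
    .solve 0 74 2155806977, .solve 0 9 2172452864, .solve 0 64 2172453120, .solve 0 29 2172583937,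
    .solve 0 14 2189230080, .solve 0 4 2155610112, .solve 0 60 2155610368, .solve 0 25 2155741185,
    .solve 0 10 2172387328, .solve 0 5 2155544576, .solve 0 2 2155741184, .solve 0 58 2155741440,
    .solve 0 8 2172518400, .solve 0 3 2155675648, .solve 0 57 2155806976, .solve 0 92 2155807232,
    .solve 0 7 2172583936, .solve 0 62 2172584192, .solve 0 12 2189361152, .solve 0 1 2155806720,
    .load 2, .solve 1 49 2139095043, .solve 1 54 2139095044, .solve 1 43 2122317826,
    .solve 1 51 2122317827, .solve 1 68 2139095296, .solve 1 33 2105540609, .solve 1 80 2139095297,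
    .solve 1 45 2105540610, .solve 1 18 2088763392, .solve 1 70 2122318080, .solve 1 35 2088763393,
    .solve 1 20 2071986176, .solve 1 41 2139160578, .solve 1 50 2139160579, .solve 1 31 2122383361,
    .solve 1 44 2122383362, .solve 1 34 2105606145, .solve 1 28 2139226113, .solve 1 42 2139226114,
    .solve 1 32 2122448897, .solve 1 11 2122317824, .solve 1 30 2122317825, .solve 1 15 2105540608,
    .solve 1 26 2139095041, .solve 1 40 2139095042, .solve 1 27 2139160577, .solve 1 6 2139095040,
    .load 1, .solve 2 39 2155675648, .solve 2 79 2189361408, .solve 2 77 2155675904,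
    .solve 2 100 2189361664, .solve 2 123 2155807744, .load 3, .solve 3 52 2222720000,
    .solve 3 55 2239431936, .solve 3 86 2206138880, .solve 3 53 2155806723, .solve 3 87 2205877248,
    .solve 3 90 2222589184, .solve 3 89 2222785536, .solve 3 46 2155741186, .solve 3 107 2189034496,
    .solve 3 110 2205746432, .solve 3 88 2155806979, .solve 3 47 2155806722,
    .solve 3 117 2172191744, .solve 3 120 2188903680, .solve 3 109 2205942784,
    .solve 3 81 2155741442, .solve 3 84 2206073600, .solve 3 121 2155348992,
    .solve 3 124 2172060928, .solve 3 108 2155676162, .solve 3 82 2155806978,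
    .solve 3 125 2155218176, .solve 3 119 2189100032, .solve 3 101 2155610625,
    .solve 3 104 2189230848, .solve 3 118 2155545345, .solve 3 102 2155676161,
    .solve 3 111 2155479808, .solve 3 114 2155545344, .solve 2 23 2155741184,
    .solve 2 65 2172584192, .solve 3 36 2155610112, .solve 3 48 2155741185, .solve 3 85 2172453120,
    .solve 3 37 2155806721, .solve 3 106 2206139136, .solve 3 75 2172518656, .solve 3 91 2155610624,
    .solve 3 56 2155741440, .solve 3 21 2155741184, .solve 3 71 2155610368, .solve 3 83 2155741441,
    .solve 3 105 2172453376, .solve 3 72 2155806977, .solve 3 103 2155741697,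
    .solve 2 116 2172584704, .solve 3 95 2172518912, .solve 2 61 2155806976, .solve 3 22 2155806720,
    .solve 2 98 2172584448, .solve 2 73 2155741440, .solve 3 76 2172584192, .solve 2 38 2155806720,
    .solve 3 78 2155806976]

end G122

/-! ### The system `G(1,4)` -/

namespace G14

abbrev h : Ex := par 0
abbrev a₁ : Ex := par 1
abbrev a₂ : Ex := par 2
abbrev S : Ex := par 3
abbrev u : Ex := par 4
abbrev t₂ : Ex := par 5
abbrev a₃ : Ex := S - 2 * h - a₁ - a₂
-- Half the difference of the times is the parameter `u`. With it all coefficients are integers.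
abbrev t₁ : Ex := t₂ + 2 * u

def H₁ : Ex :=
  -(Q₁ ^ 2 * P₁ * P₂) - Q₂ ^ 2 * P₁ * P₂ + 2 * Q₁ * Q₂ * P₁ * P₂ + (t₂ - t₁) * (Q₁ ^ 2 * P₁)
    + a₂ * (Q₁ * P₁) - a₁ * (Q₁ * P₂) - a₂ * (Q₂ * P₁) + a₁ * (Q₂ * P₂)
    + u * (P₁ * (P₁ + P₂)) - (a₁ * (t₁ - t₂)) * Q₁ - (t₁ * u) * P₁

def H₂ : Ex :=
  Q₁ ^ 2 * P₁ * P₂ + Q₂ ^ 2 * P₁ * P₂ - 2 * Q₁ * Q₂ * P₁ * P₂ + (t₂ - t₁) * (Q₂ ^ 2 * P₂)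
    - a₂ * (Q₁ * P₁) + a₁ * (Q₁ * P₂) + a₂ * (Q₂ * P₁) - a₁ * (Q₂ * P₂)
    + u * (P₁ * P₂ + P₂ ^ 2) - (a₂ * (t₁ - t₂)) * Q₂ - (t₂ * u) * P₂

def system : System where
  units := [true, false, false, true, true, true]
  d₁ := [0, 0, 0, 0, S * u, 0]
  d₂ := [0, 0, 0, 0, -(S * u), 2 * S * u]
  H₁ := H₁
  H₂ := H₂
  trans := [inversion₁ a₁, inversion₂ a₂,
    { b₁ := false
      b₂ := false
      r := subst I₁
        (-(X₁ ^ 2 * Y₁) + 2 * X₁ * X₂ * Y₂ - I₁ ^ 2 * Y₂ + 2 * I₁ ^ 2 - a₃ * X₁ + u * Y₂ + t₁)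
        (X₁ ^ 2 * X₂ + u * X₁ + I₁) (I₁ ^ 2 * Y₂)
      R₁ := S * u * (X₁ * P₂ - 2 * I₁)
      R₂ := -(S * u * (X₁ * P₂))
      gen := [(1, Q₁), (5, X₁ ^ 2 * P₂), (2, I₁ ^ 2 * (Q₂ - u * X₁ - I₁)),
        (4, -(I₁ ^ 2 * (P₁ - 2 * X₁ * X₂ * Y₂ + I₁ ^ 2 * Y₂ - 2 * I₁ ^ 2 + a₃ * X₁ - u * Y₂
          - t₁)))] }]
  pivots := []
  steps := [
    .load 0, .solve 0 112 2155807488, .solve 0 122 2155807744, .solve 0 96 2172584448,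
    .solve 0 115 2172584704, .solve 0 66 2189361408, .solve 0 99 2189361664, .solve 0 16 2206138368,
    .solve 0 69 2206138624, .solve 0 19 2222915584, .solve 0 93 2155741696, .solve 0 113 2155741952,
    .solve 0 63 2172518656, .solve 0 97 2172518912, .solve 0 13 2189295616, .solve 0 67 2189295872,
    .solve 0 17 2206072832, .solve 0 59 2155675904, .solve 0 94 2155676160, .solve 0 24 2155806721,
    .solve 0 74 2155806977, .solve 0 9 2172452864, .solve 0 64 2172453120, .solve 0 29 2172583937,
    .solve 0 14 2189230080, .solve 0 4 2155610112, .solve 0 60 2155610368, .solve 0 25 2155741185,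
    .solve 0 10 2172387328, .solve 0 5 2155544576, .solve 0 2 2155741184, .solve 0 58 2155741440,
    .solve 0 8 2172518400, .solve 0 3 2155675648, .solve 0 57 2155806976, .solve 0 92 2155807232,
    .solve 0 7 2172583936, .solve 0 62 2172584192, .solve 0 12 2189361152, .solve 0 1 2155806720,
    .load 1, .solve 1 49 2139095043, .solve 1 54 2139095044, .solve 1 43 2122317826,
    .solve 1 51 2122317827, .solve 1 68 2139095296, .solve 1 33 2105540609, .solve 1 80 2139095297,
    .solve 1 45 2105540610, .solve 1 18 2088763392, .solve 1 70 2122318080, .solve 1 35 2088763393,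
    .solve 1 20 2071986176, .solve 1 41 2139160578, .solve 1 50 2139160579, .solve 1 31 2122383361,
    .solve 1 44 2122383362, .solve 1 34 2105606145, .solve 1 28 2139226113, .solve 1 42 2139226114,
    .solve 1 32 2122448897, .solve 1 11 2122317824, .solve 1 30 2122317825, .solve 1 15 2105540608,
    .solve 1 26 2139095041, .solve 1 40 2139095042, .solve 1 27 2139160577, .solve 1 6 2139095040,
    .load 2, .solve 2 55 2155741186, .solve 2 79 2189361408, .solve 2 53 2155806722,
    .solve 2 86 2189295872, .solve 2 90 2155741442, .solve 2 89 2189230592, .solve 2 110 2155741698,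
    .solve 2 88 2155806978, .solve 2 120 2155741954, .solve 2 109 2155676672,
    .solve 2 124 2155480065, .solve 2 108 2155807234, .solve 2 125 2155218176,
    .solve 2 119 2155545600, .solve 2 118 2155545345, .solve 2 123 2155414528,
    .solve 2 121 2155348992, .solve 2 114 2155414272, .solve 2 117 2155610881,
    .solve 2 102 2155676161, .solve 2 100 2155414016, .solve 2 104 2189361920,
    .solve 2 39 2155413504, .solve 2 47 2155675649, .solve 2 21 2155741184, .solve 2 77 2172387584,
    .solve 2 84 2189361664, .solve 2 82 2155413760, .solve 2 22 2155675648, .solve 2 23 2155610112,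
    .solve 2 37 2155544576, .solve 2 75 2172518656, .solve 2 95 2172518912, .solve 2 72 2155544832,
    .solve 2 65 2172584192, .solve 2 116 2155348736, .solve 2 48 2155347968, .solve 2 52 2155610113,
    .solve 2 87 2155742208, .solve 2 85 2172322048, .solve 2 107 2172584705, .solve 2 83 2155348224,
    .solve 2 106 2189296128, .solve 2 105 2172322304, .solve 2 103 2155348480,
    .solve 2 111 2155479808, .solve 2 56 2155741440, .solve 2 61 2155675904,
    .solve 2 101 2155741697, .solve 2 81 2155741952, .solve 2 91 2155610624, .solve 2 46 2155479040,
    .solve 2 38 2155741185, .solve 2 76 2172453120, .solve 2 36 2155806720, .solve 2 73 2155479296,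
    .solve 2 98 2172453376, .solve 2 71 2155610368, .solve 2 78 2155806976]

end G14

/-! ### The system `G(2,3)` -/

namespace G23

abbrev h : Ex := par 0
abbrev a₁ : Ex := par 1
abbrev a₂ : Ex := par 2
abbrev S : Ex := par 3
abbrev η : Ex := par 4
abbrev t₁ : Ex := par 5
abbrev t₂ : Ex := par 6
abbrev ε : Ex := par 7
-- Only integer coefficients are available, so the number `1 / 2` is carried along as the parameter
-- `ε`; the computations are valid for any nonzero value of it. The constant `β` replaces `α₃`
-- through `S`.
abbrev β : Ex := S - 3 * h - a₁ - a₂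

def H₁ : Ex :=
  Q₂ ^ 2 * P₂ ^ 2 - Q₂ * P₁ ^ 2 + ε * (Q₁ * Q₂ * P₁) + ε * (Q₂ ^ 2 * P₂)
    - (η * t₁) * (Q₁ * P₂) + (h + a₁ + β) * (Q₂ * P₂)
    + (a₁ * ε) * Q₂ - (η * t₁) * (P₁ - t₂ * P₂)

def H₂ : Ex :=
  -(ε * (Q₁ ^ 2 * P₁)) - ε * (Q₁ * Q₂ * P₂) + 2 * Q₂ * P₁ * P₂
    + Q₁ * P₁ ^ 2 + (t₂ * ε) * (Q₁ * P₁) + ε * (Q₂ * P₁) - t₂ * P₁ ^ 2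
    - (a₁ * ε) * Q₁ + (h + a₁ + β) * P₁ + (η * t₁) * P₂

def system : System where
  units := [true, false, false, true, true, true, true, true]
  d₁ := [0, 0, 0, 0, 0, S * t₁, 0, 0]
  d₂ := [0, 0, 0, 0, 0, 0, S, 0]
  H₁ := H₁
  H₂ := H₂
  trans := [projective₁ a₁, projective₂ a₁,
    { b₁ := false
      b₂ := false
      r := subst X₁ (-((η * t₁) * I₂) + Y₁) X₂
        ((η * t₁) * (X₁ * I₂ ^ 2) - (η * t₁ * t₂) * I₂ ^ 2 + a₂ * I₂ + Y₂)
      R₁ := S * t₁ * η * ((Q₁ - t₂) * I₂)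
      R₂ := -(S * η * t₁ * I₂)
      gen := [(0, Q₁), (2, Q₂), (4, P₁ + (η * t₁) * I₂),
        (5, P₂ - ((η * t₁) * (X₁ * I₂ ^ 2) - (η * t₁ * t₂) * I₂ ^ 2 + a₂ * I₂))] },
    { b₁ := false
      b₂ := false
      r := subst I₁
        (-(X₁ ^ 2 * Y₁) - X₁ * X₂ * Y₂ - (a₁ + a₂) * X₁ - (η * t₁) * (X₁ * I₂)) (X₂ * I₁)
        (-((η * t₁ * t₂) * (X₁ * I₂) ^ 2) + (η * t₁) * (X₁ * I₂ ^ 2) + X₁ * Y₂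
          + a₂ * (X₁ * I₂))
      R₁ := S * t₁ * η * (I₂ - t₂ * (X₁ * I₂))
      R₂ := -(S * η * t₁ * (X₁ * I₂))
      gen := [(1, Q₁), (2, Q₂ * X₁), (5, I₁ * (P₂ + (η * t₁ * t₂) * (X₁ * I₂) ^ 2
          - (η * t₁) * (X₁ * I₂ ^ 2) - a₂ * (X₁ * I₂))),
        (4, -(I₁ ^ 2 * (P₁ + X₁ * X₂ * Y₂ + (a₁ + a₂) * X₁ + (η * t₁) * (X₁ * I₂))))] },
    { b₁ := false
      b₂ := false
      r := subst I₁ (-(X₁ ^ 2 * Y₁) - X₁ * X₂ * Y₂ - β * X₁ + ε * I₁) (X₂ * I₁) (X₁ * Y₂ - ε)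
      R₁ := 0
      R₂ := 0
      gen := [(1, Q₁), (2, Q₂ * X₁), (5, I₁ * (P₂ + ε)),
        (4, -(I₁ ^ 2 * (P₁ + X₁ * X₂ * Y₂ + β * X₁ - ε * I₁)))] },
    { b₁ := false
      b₂ := false
      r := subst (X₁ * I₂) (ε * (X₁ * I₂) + X₂ * Y₁) I₂
        (-(X₂ ^ 2 * Y₂) - X₁ * X₂ * Y₁ - β * X₂ - ε)
      R₁ := 0
      R₂ := 0
      gen := [(3, Q₂), (0, Q₁ * X₂), (4, I₂ * (P₁ - ε * (X₁ * I₂))),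
        (5, -(I₂ ^ 2 * (P₂ + X₁ * X₂ * Y₁ + β * X₂ + ε)))] }]
  pivots := []
  -- The polar parts of the first, third and fifth transformations already force uniqueness; the
  -- other three are not loaded.
  steps := [
    .load 0, .solve 0 33 2206138369, .solve 0 45 2239693312, .solve 0 18 2222718976,
    .solve 0 35 2222850049, .solve 0 20 2239430656, .solve 0 31 2189361153, .solve 0 16 2205941760,
    .solve 0 34 2206072833, .solve 0 19 2222653440, .solve 0 28 2172583937, .solve 0 13 2189164544,
    .solve 0 32 2189295617, .solve 0 17 2205876224, .solve 0 59 2155741440, .solve 0 94 2155807232,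
    .solve 0 24 2155806721, .solve 0 9 2172387328, .solve 0 29 2172518401, .solve 0 14 2189099008,
    .solve 0 4 2155610112, .solve 0 60 2155675904, .solve 0 25 2155741185, .solve 0 10 2172321792,
    .solve 0 5 2155544576, .solve 0 11 2189295616, .solve 0 68 2206073088, .solve 0 15 2206007296,
    .solve 0 70 2222784768, .solve 0 7 2172518400, .solve 0 66 2189295872, .solve 0 12 2189230080,
    .solve 0 69 2206007552, .solve 0 2 2155741184, .solve 0 63 2172518656, .solve 0 8 2172452864,
    .solve 0 67 2189230336, .solve 0 3 2155675648, .solve 0 64 2172453120, .solve 0 97 2172584448,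
    .solve 0 58 2155806976, .solve 0 100 2206138880, .solve 0 99 2189361664, .solve 0 6 2172583936,
    .solve 0 1 2155806720, .solve 0 65 2189361408, .solve 0 62 2172584192, .load 2,
    .solve 1 125 1988427776, .solve 1 124 2021916673, .solve 1 120 2055405570,
    .solve 1 110 2088894467, .solve 1 90 2122383364, .solve 1 122 2021982208,
    .solve 1 118 2055471105, .solve 1 108 2088960002, .solve 1 88 2122448899,
    .solve 1 93 2089025536, .solve 1 113 2055536640, .solve 1 103 2089025537,
    .solve 1 83 2122514434, .solve 1 74 2139291904, .solve 1 121 2021654528,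
    .solve 1 117 2122318337, .solve 1 107 2122318082, .solve 1 55 2139095044,
    .solve 1 123 2038693888, .solve 1 119 2072182785, .solve 1 87 2122383363,
    .solve 1 109 2139160834, .solve 1 112 2122449408, .solve 1 102 2122449153,
    .solve 1 115 2072248320, .solve 1 82 2122448898, .solve 1 105 2139226369,
    .solve 1 73 2122514433, .solve 1 111 2122318336, .solve 1 101 2088763393,
    .solve 1 114 2139161088, .solve 1 104 2139160833, .solve 1 96 2105737216, .load 4,
    .solve 2 80 2206138369, .solve 0 44 2222916096, .solve 2 51 2189099008, .solve 0 30 2206138624,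
    .solve 2 78 2206138624, .solve 2 43 2189164544, .solve 2 79 2189361153, .solve 2 42 2206007296,
    .solve 2 27 2189295616, .solve 2 22 2155741184, .solve 2 72 2155806976, .solve 2 50 2172321792,
    .solve 2 54 2172518401, .solve 2 86 2189230336, .solve 1 92 2088960000, .solve 1 116 2122449152,
    .solve 1 91 2088894464, .solve 2 40 2172452864, .solve 2 76 2189361408, .solve 2 61 2172583936,
    .solve 1 38 2139226113, .solve 1 52 2139095043, .solve 1 48 2139226114, .solve 1 57 2122448896,
    .solve 2 39 2189230080, .solve 1 77 2139291649, .solve 2 26 2172518400, .solve 2 23 2155675648,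
    .solve 2 21 2155806720, .solve 2 47 2155806721, .solve 2 89 2155610112, .solve 2 84 2172518656,
    .solve 1 81 2122318080, .solve 1 53 2139160579, .solve 1 85 2139160578, .solve 1 46 2139095042,
    .solve 1 106 2122448897, .solve 1 95 2139160832, .solve 1 71 2122317825, .solve 2 41 2172387328,
    .solve 2 49 2172583937, .solve 1 36 2139095041, .solve 2 75 2172584192, .solve 1 98 2139160576,
    .solve 1 56 2122317824, .solve 1 37 2139095040]

end G23

/-! ### The system `G(5)` -/

namespace G5

abbrev h : Ex := par 0
abbrev a₁ : Ex := par 1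
abbrev S : Ex := par 2
abbrev t₁ : Ex := par 3
abbrev t₂ : Ex := par 4
-- This is `α₁ - 2 α₂`, expressed through the independent parameter `S` so that `α₂` disappears.
abbrev β : Ex := S - 3 * h - a₁

def H₁ : Ex :=
  2 * Q₁ * Q₂ * P₁ + Q₂ * P₁ ^ 2 + 2 * Q₂ ^ 2 * P₂ - 2 * Q₁ * P₂ + (2 * t₂) * (Q₂ * P₁)
    + 2 * P₁ * P₂ + (2 * a₁) * Q₂ + (2 * t₁) * P₁ + (2 * t₂) * P₂

def H₂ : Ex :=
  Q₂ ^ 2 * P₁ ^ 2 + 2 * Q₁ ^ 2 * P₁ + 2 * Q₁ * Q₂ * P₂ - Q₁ * P₁ ^ 2 + 2 * Q₂ * P₁ * P₂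
    + (2 * t₁) * (Q₂ * P₁) + (2 * t₂) * (Q₂ * P₂) - t₂ * P₁ ^ 2 + P₂ ^ 2 + (2 * a₁) * Q₁
    - (2 * t₂ ^ 2) * P₁ + (2 * t₁) * P₂

def system : System where
  units := [true, false, true, true, true]
  d₁ := [0, 0, 0, S, 0]
  d₂ := [0, 0, 0, 0, S]
  H₁ := H₁
  H₂ := H₂
  trans := [projective₁ a₁, projective₂ a₁,
    { b₁ := false
      b₂ := false
      r := subst I₁
        (-(2 * (X₂ * I₁) ^ 2) - X₁ ^ 2 * Y₁ - X₁ * X₂ * Y₂ - β * X₁ + 2 * I₁ - 2 * t₂)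
        (X₂ * I₁) (2 * (X₂ * I₁) ^ 3 - 4 * I₁ ^ 2 * X₂ + X₁ * Y₂ - 2 * t₁)
      -- Since `[p₂, q₂] = -h`, the shift of `p₂` by `-2 t₁` is generated by `2 Q₂`. Likewise `2 Q₁`
      -- generates the shift of `p₁` by `-2 t₂`.
      R₁ := 2 * S * Q₂
      R₂ := 2 * S * Q₁
      gen := [(1, Q₁), (2, Q₂ * X₁),
        (5, I₁ * (P₂ - 2 * (X₂ * I₁) ^ 3 + 4 * I₁ ^ 2 * X₂ + 2 * t₁)),
        (4, -(I₁ ^ 2 * (P₁ + 2 * (X₂ * I₁) ^ 2 + X₁ * X₂ * Y₂ + β * X₁ - 2 * I₁ + 2 * t₂)))] },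
    { b₁ := false
      b₂ := false
      r := subst (X₁ * I₂) (2 * X₁ * I₂ - 2 * I₂ ^ 2 + X₂ * Y₁ - 2 * t₂) I₂
        (-(4 * X₁ * I₂ ^ 2) - X₁ * X₂ * Y₁ + 2 * I₂ ^ 3 - X₂ ^ 2 * Y₂ - β * X₂ - 2 * t₁)
      R₁ := 2 * S * Q₂
      R₂ := 2 * S * Q₁
      gen := [(3, Q₂), (0, Q₁ * X₂), (4, I₂ * (P₁ - 2 * X₁ * I₂ + 2 * I₂ ^ 2 + 2 * t₂)),
        (5, -(I₂ ^ 2 * (P₂ + 4 * X₁ * I₂ ^ 2 + X₁ * X₂ * Y₁ - 2 * I₂ ^ 3 + β * X₂ + 2 * t₁)))] }]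
  pivots := []
  -- The first and third transformations suffice for uniqueness.
  steps := [
    .load 0, .solve 0 33 2206138369, .solve 0 45 2239693312, .solve 0 18 2222718976,
    .solve 0 35 2222850049, .solve 0 20 2239430656, .solve 0 31 2189361153, .solve 0 16 2205941760,
    .solve 0 34 2206072833, .solve 0 19 2222653440, .solve 0 28 2172583937, .solve 0 13 2189164544,
    .solve 0 32 2189295617, .solve 0 17 2205876224, .solve 0 59 2155741440, .solve 0 94 2155807232,
    .solve 0 24 2155806721, .solve 0 9 2172387328, .solve 0 29 2172518401, .solve 0 14 2189099008,
    .solve 0 4 2155610112, .solve 0 60 2155675904, .solve 0 25 2155741185, .solve 0 10 2172321792,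
    .solve 0 5 2155544576, .solve 0 11 2189295616, .solve 0 68 2206073088, .solve 0 15 2206007296,
    .solve 0 70 2222784768, .solve 0 7 2172518400, .solve 0 66 2189295872, .solve 0 12 2189230080,
    .solve 0 69 2206007552, .solve 0 2 2155741184, .solve 0 63 2172518656, .solve 0 8 2172452864,
    .solve 0 67 2189230336, .solve 0 3 2155675648, .solve 0 64 2172453120, .solve 0 97 2172584448,
    .solve 0 58 2155806976, .solve 0 100 2206138880, .solve 0 99 2189361664, .solve 0 6 2172583936,
    .solve 0 1 2155806720, .solve 0 65 2189361408, .solve 0 62 2172584192, .load 2,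
    .solve 1 125 2406547456, .solve 1 124 2389835776, .solve 1 120 2339831809,
    .solve 1 110 2289827842, .solve 1 90 2273247745, .solve 1 122 2306277632,
    .solve 1 123 2373124096, .solve 1 118 2256273665, .solve 1 119 2323120129,
    .solve 1 108 2189361154, .solve 1 109 2273116162, .solve 1 113 2205679616,
    .solve 1 121 2356412416, .solve 1 103 2188967936, .solve 1 117 2306408449,
    .solve 1 88 2256470784, .solve 1 115 2322923520, .solve 1 116 2339700736,
    .solve 1 105 2272919553, .solve 1 83 2206138370, .solve 1 112 2206073344,
    .solve 1 74 2172256256, .solve 0 30 2206138624, .solve 0 44 2222916096, .solve 1 73 2155741440,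
    .solve 1 42 2172321792, .solve 1 39 2155544576, .solve 1 38 2155610112, .solve 1 48 2155741185,
    .solve 1 47 2155806721, .solve 1 23 2155675648, .solve 1 93 2189033472, .solve 1 77 2172453120,
    .solve 1 72 2155806976, .solve 1 41 2172387328, .solve 1 89 2273248000, .solve 1 114 2322989056,
    .solve 1 102 2289500160, .solve 1 107 2256404482, .solve 1 106 2289696769,
    .solve 1 85 2256339456, .solve 1 55 2239627521, .solve 1 53 2272919808, .solve 1 22 2155741184,
    .solve 1 92 2172518656, .solve 1 76 2189099008, .solve 1 98 2289565696, .solve 1 95 2272854016,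
    .solve 1 101 2222916096, .solve 1 84 2256404992, .solve 1 51 2189295617, .solve 1 52 2222587904,
    .solve 1 80 2256273409, .solve 1 36 2206138624, .solve 1 81 2239693312, .solve 1 61 2222718976,
    .solve 1 78 2239561729, .solve 1 75 2239561984, .solve 1 37 2189361153, .solve 1 49 2222784768,
    .solve 1 86 2239692802, .solve 1 104 2289697024, .solve 1 71 2206138369, .solve 1 27 2239430656,
    .solve 1 82 2239627776, .solve 1 57 2205941760, .solve 1 26 2172583936, .solve 1 54 2222915841,
    .solve 1 21 2189295616, .solve 1 50 2172583937, .solve 1 87 2172518401, .solve 1 111 2206138880,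
    .solve 1 79 2239365120, .solve 1 96 2205810688, .solve 1 46 2189230080, .solve 1 43 2206073088,
    .solve 1 91 2155806720, .solve 1 56 2206007296, .solve 1 40 2172518400]

end G5

end Data

/-- The verification that one transformation is canonical and invertible, that it is generated by
the corrections, and that it transforms the Hamiltonians into polynomials. -/
def Data.Trans.valid (s : Data.System) (t : Data.Trans) : Bool :=
  Bdd.isCanonical t.r && Bdd.generates t.r t.gen [6, 7, 8, 9] &&
  (Bdd.isFlow t.r s.d₁ t.R₁ .q₁ 6 && Bdd.isFlow t.r s.d₁ t.R₁ .p₁ 7 &&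
    Bdd.isFlow t.r s.d₁ t.R₁ .q₂ 8 && Bdd.isFlow t.r s.d₁ t.R₁ .p₂ 9) &&
  (Bdd.isFlow t.r s.d₂ t.R₂ .q₁ 6 && Bdd.isFlow t.r s.d₂ t.R₂ .p₁ 7 &&
    Bdd.isFlow t.r s.d₂ t.R₂ .q₂ 8 && Bdd.isFlow t.r s.d₂ t.R₂ .p₂ 9) &&
  Bdd.isPoly t.r (s.H₁ - t.R₁) && Bdd.isPoly t.r (s.H₂ - t.R₂)

def Data.System.images (s : Data.System) (i : ℕ) : List Bdd :=
  ((s.trans.map fun t => Linear.images t.r)).getD i []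

def Data.System.unique (s : Data.System) : Bool :=
  Linear.solves s.units s.pivots s.images s.steps

/-! ### Soundness of the elimination. -/

namespace Terms

variable {M N : Type*} [AddCommGroup M] [AddCommGroup N]

lemma eval_append (f : ℕ → M) (l l' : Terms) : eval f (l ++ l') = eval f l + eval f l' := by
  induction l with
  | nil => simp
  | cons t l ih => simp [ih, add_assoc]

lemma eval_congr {f g : ℕ → M} {l : Terms} (e : Keys (fun k => f k = g k) l) :
    eval f l = eval g l := by
  induction l with
  | nil => rfl
  | cons t l ih =>
    obtain ⟨h1, h2⟩ := keys_cons.1 e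
    rw [eval_cons, eval_cons, h1, ih h2]

lemma map_eval (T : M →+ N) (f : ℕ → M) (l : Terms) : T (eval f l) = eval (fun k => T (f k)) l := by
  induction l with
  | nil => simp
  | cons t l ih => simp [ih]

end Terms

namespace Linear

lemma bit_eq (m i : ℕ) : bit m i = m.testBit i := by
  have h : Nat.land (Nat.shiftRight m i) 1 = (m >>> i) % 2 := Nat.and_one_is_mod _
  rw [bit, h, Nat.testBit_eq_decide_div_mod_eq, Nat.shiftRight_eq_div_pow]
  rcases Nat.mod_two_eq_zero_or_one (m / 2 ^ i) with e | e <;> rw [e] <;> rfl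

lemma bit_setBit (m i j : ℕ) : bit (setBit m i) j = (bit m j || decide (i = j)) := by
  rw [bit_eq, bit_eq]
  change (m ||| 1 <<< i).testBit j = _
  rw [Nat.testBit_or, Nat.one_shiftLeft, Nat.testBit_two_pow]

section

variable {K : Type*} [Field K] (p w : ℕ → K)

/-- The value of a monomial in the parameters. -/
abbrev parEval (l : Terms) : K := l.eval (parVal p 0 10)

/-- The value of a monomial in the parameters times an unknown. -/
def rowVal (k : ℕ) : K := parVal p 0 10 (k % 256 ^ 10) * w (k / 256 ^ 10)

/-- The exponents of the parameters are small. -/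
def Small (k : ℕ) : Prop := DigitsLE 127 10 (k % 256 ^ 10)

/-- A linear equation which the unknowns satisfy. -/
def Holds (l : Terms) : Prop := Terms.Keys Small l ∧ l.eval (rowVal p w) = 0

/-- All polar coefficients vanish. -/
def Vanishes (T : Table) : Prop :=
  ∀ κ, Bdd.nonpolar (κ * 256 ^ 11) = false → (select κ T).eval (rowVal p w) = 0

/-- The unknowns in a set vanish. -/
def Zeros (Z : ℕ) : Prop := ∀ j, bit Z j = true → w j = 0

structure Fact.Holds (f : Fact) : Prop where
  keys : Terms.Keys (DigitsLE 127 10) f.piv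
  keys' : Terms.Keys Small f.rest
  ne_zero : parEval p f.piv ≠ 0
  eq_zero : parEval p f.piv * w f.j + f.rest.eval (rowVal p w) = 0

variable {p w}

/-- A digit in base 256 is at most 127 exactly when its bit of position 7 is clear. -/
lemma digitsLE_of_land {n e : ℕ} (he : e < 256 ^ n)
    (h : ∀ i < n, e.testBit (8 * i + 7) = false) : DigitsLE 127 n e := by
  induction n generalizing e with
  | zero => exact Nat.lt_one_iff.1 he
  | succ n ih =>
    refine ⟨?_, ih ?_ fun i hi => ?_⟩
    · have h0 := h 0 (by omega)
      rw [Nat.testBit_eq_decide_div_mod_eq] at h0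
      simp at h0
      omega
    · rw [pow_succ] at he; omega
    · have h0 := h (i + 1) (by omega)
      rw [show (256 : ℕ) = 2 ^ 8 from rfl, Nat.testBit_div_two_pow]
      rwa [show 8 * i + 7 + 8 = 8 * (i + 1) + 7 by ring]

lemma small_sound {k : ℕ} (hk : small k = true) : Small k := by
  have h0 : k &&& 0x80808080808080808080 = 0 := Nat.eq_of_beq_eq_true hk
  refine digitsLE_of_land (Nat.mod_lt _ (by norm_num)) fun i hi => ?_
  have h1 := congrArg (fun m => m.testBit (8 * i + 7)) h0
  simp only [Nat.testBit_and, Nat.zero_testBit] at h1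
  rw [show (256 : ℕ) ^ 10 = 2 ^ 80 by norm_num, Nat.testBit_mod_two_pow]
  have h2 : Nat.testBit 0x80808080808080808080 (8 * i + 7) = true := by
    interval_cases i <;> decide
  rw [h2, Bool.and_true] at h1
  rw [h1, Bool.and_false]

lemma holds_guard {l : Terms} (hl : l.eval (rowVal p w) = 0) : Holds p w (guard l) := by
  unfold guard
  by_cases h : Bdd.allKeys small l
  · rw [h, cond_true]
    exact ⟨(Bdd.allKeys_sound h).mono fun _ => small_sound, hl⟩
  · simp only [h, cond_false]
    exact ⟨Terms.keys_nil _, rfl⟩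

lemma keys_guard (l : Terms) : Terms.Keys Small (guard l) := by
  unfold guard
  by_cases h : Bdd.allKeys small l
  · rw [h, cond_true]
    exact (Bdd.allKeys_sound h).mono fun _ => small_sound
  · simp only [h, cond_false]
    exact Terms.keys_nil _

lemma eval_dropAll {Z : ℕ} (hZ : Zeros w Z) (l : Terms) :
    (dropAll Z l).eval (rowVal p w) = l.eval (rowVal p w) := by
  induction l with
  | nil => rfl
  | cons t l ih =>
    obtain ⟨k, z⟩ := t
    rw [dropAll]
    by_cases h : bit Z (k / 256 ^ 10)
    · rw [h, cond_true, ih, Terms.eval_cons]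
      simp only [rowVal]
      rw [hZ _ h, mul_zero, smul_zero, zero_add]
    · simp only [h, cond_false, Terms.eval_cons, ih]

lemma eval_coeff_drop (j : ℕ) (l : Terms) :
    parEval p (coeff j l) * w j + (drop j l).eval (rowVal p w) = l.eval (rowVal p w) := by
  induction l with
  | nil => simp [coeff, drop]
  | cons t l ih =>
    obtain ⟨k, z⟩ := t
    rw [coeff, drop]
    by_cases h : Nat.beq (k / 256 ^ 10) j
    · simp only [h, cond_true, Terms.eval_cons, ← ih]
      rw [rowVal, Nat.eq_of_beq_eq_true h, add_mul, smul_mul_assoc, add_assoc]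
    · simp only [h, cond_false, Terms.eval_cons, ← ih]
      ring

lemma keys_drop {P : ℕ → Prop} {l : Terms} (hl : Terms.Keys P l) (j : ℕ) :
    Terms.Keys P (drop j l) := by
  induction l with
  | nil => exact hl
  | cons t l ih =>
    obtain ⟨h1, h2⟩ := Terms.keys_cons.1 hl
    obtain ⟨k, z⟩ := t
    rw [drop]
    by_cases h : Nat.beq (k / 256 ^ 10) j
    · rw [h, cond_true]; exact ih h2
    · simp only [h, cond_false]; exact Terms.keys_cons.2 ⟨h1, ih h2⟩

lemma keys_coeff {l : Terms} (hl : Terms.Keys Small l) (j : ℕ) :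
    Terms.Keys (DigitsLE 127 10) (coeff j l) := by
  induction l with
  | nil => exact Terms.keys_nil _
  | cons t l ih =>
    obtain ⟨h1, h2⟩ := Terms.keys_cons.1 hl
    obtain ⟨k, z⟩ := t
    rw [coeff]
    by_cases h : Nat.beq (k / 256 ^ 10) j
    · rw [h, cond_true]; exact Terms.keys_cons.2 ⟨h1, ih h2⟩
    · simp only [h, cond_false]; exact ih h2

/-- No carry reaches the digits above the ten parameter digits. So the number of the unknown stays
fixed while the monomials multiply. -/
lemma rowVal_add {s k : ℕ} (hs : DigitsLE 127 10 s) (hk : Small k) :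
    rowVal p w (k + s) = parVal p 0 10 s * rowVal p w k := by
  have h1 := (DigitsLE.add hk hs (by norm_num)).lt
  have h2 : (k + s) % 256 ^ 10 = k % 256 ^ 10 + s := by omega
  have h3 : (k + s) / 256 ^ 10 = k / 256 ^ 10 := by omega
  rw [rowVal, rowVal, h2, h3, parVal_add p hk hs (by norm_num)]
  ring

lemma eval_shift {s : ℕ} (hs : DigitsLE 127 10 s) (z : ℤ) {l : Terms} (hl : Terms.Keys Small l) :
    (Terms.mapKey (fun k => k + s) z l).eval (rowVal p w)
      = z • (parVal p 0 10 s * l.eval (rowVal p w)) :=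
  Terms.eval_mapKey (f := rowVal p w) (AddMonoidHom.mulLeft (parVal p 0 10 s))
    fun t ht => rowVal_add hs (hl t ht)

lemma eval_pmul {a l : Terms} (ha : Terms.Keys (DigitsLE 127 10) a) (hl : Terms.Keys Small l) :
    (pmul a l).eval (rowVal p w) = parEval p a * l.eval (rowVal p w) := by
  induction a with
  | nil => simp [pmul]
  | cons t a ih =>
    obtain ⟨h1, h2⟩ := Terms.keys_cons.1 ha
    obtain ⟨s, z⟩ := t
    rw [pmul, Terms.eval_merge, ih h2, eval_shift h1 z hl, parEval, parEval, Terms.eval_cons,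
      add_mul, smul_mul_assoc]

lemma parEval_pmul {a b : Terms} (ha : Terms.Keys (DigitsLE 127 10) a)
    (hb : Terms.Keys (DigitsLE 127 10) b) : parEval p (pmul a b) = parEval p a * parEval p b := by
  induction a with
  | nil => simp [pmul]
  | cons t a ih =>
    obtain ⟨h1, h2⟩ := Terms.keys_cons.1 ha
    obtain ⟨s, z⟩ := t
    simp only [parEval] at ih ⊢
    rw [pmul, Terms.eval_merge, ih h2, Terms.eval_cons, add_mul, smul_mul_assoc,
      Terms.eval_mapKey (f := parVal p 0 10) (AddMonoidHom.mulLeft (parVal p 0 10 s)) fun t ht => by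
        rw [parVal_add p (hb t ht) h1 (by norm_num), mul_comm]; rfl]
    rfl

lemma holds_eliminate {f : Fact} (hf : f.Holds p w) {l : Terms} (hl : Holds p w l) :
    Holds p w (eliminate f l) := by
  obtain ⟨j, piv, rest⟩ := f
  obtain ⟨h1, h2, h3, h4⟩ := hf
  obtain ⟨h5, h6⟩ := hl
  rw [← eval_coeff_drop j] at h6
  simp only at h1 h2 h3 h4
  match rest with
  | [] =>
    rw [Terms.eval_nil, add_zero, mul_eq_zero, or_iff_right h3] at h4
    rw [h4, mul_zero, zero_add] at h6
    exact ⟨keys_drop h5 j, h6⟩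
  | t :: rest =>
    apply holds_guard
    simp only
    rw [Terms.eval_merge, eval_pmul h1 (keys_drop h5 j),
      eval_pmul (Terms.keys_mapKey (g := id) (keys_coeff h5 j)) h2]
    have h7 : parEval p (Terms.mapKey id (-1) (coeff j l)) = -parEval p (coeff j l) := by
      rw [parEval, Terms.eval_mapKey (f := parVal p 0 10) (AddMonoidHom.id K) fun _ _ => rfl]
      simp
    rw [h7]
    linear_combination parEval p piv * h6 - parEval p (coeff j l) * h4

lemma holds_reduce {facts : List Fact} (hf : ∀ f ∈ facts, f.Holds p w) {c : ℕ → Terms → Terms}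
    (hc : ∀ m l, Holds p w l → Holds p w (c m l)) (m : ℕ) {l : Terms} (hl : Holds p w l) :
    Holds p w (reduce facts c m l) := by
  induction facts generalizing c m l with
  | nil => exact hc m l hl
  | cons f facts ih =>
    obtain ⟨h1, h2⟩ := List.forall_mem_cons.1 hf
    refine ih h2 (fun m l hl => ?_) m hl
    unfold reduceAux
    by_cases h : bit m f.j
    · rw [h, cond_true]; exact hc _ _ (holds_eliminate h1 hl)
    · simp only [h, cond_false]; exact hc _ _ hl

lemma eqInt_sound {a b : ℤ} (h : eqInt a b = true) : a = b := by
  match a, b with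
  | .ofNat a, .ofNat b => exact congrArg _ (Nat.eq_of_beq_eq_true h)
  | .negSucc a, .negSucc b => exact congrArg _ (Nat.eq_of_beq_eq_true h)
  | .ofNat a, .negSucc b => simp [eqInt] at h
  | .negSucc a, .ofNat b => simp [eqInt] at h

lemma eqInt_self (a : ℤ) : eqInt a a = true := by
  cases a <;> simp [eqInt]

lemma eqTerms_sound {l m : Terms} (h : eqTerms l m = true) : l = m := by
  induction l generalizing m with
  | nil => cases m with
    | nil => rfl
    | cons t m => simp [eqTerms] at h
  | cons t l ih => cases m with
    | nil => simp [eqTerms] at h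
    | cons t' m =>
      simp only [eqTerms, Bool.and_eq_true] at h
      rw [ih h.2, Prod.ext (Nat.eq_of_beq_eq_true h.1.1) (eqInt_sound h.1.2)]

lemma isUnit_sound {u : List Bool} {e i : ℕ} (hu : ∀ j, u.getD j false = true → p (i + j) ≠ 0)
    (he : isUnit u e = true) (n : ℕ) : parVal p i n e ≠ 0 := by
  induction n generalizing u e i with
  | zero => exact one_ne_zero
  | succ n ih =>
    cases u with
    | nil => rw [Nat.eq_of_beq_eq_true he, parVal_zero]; exact one_ne_zero
    | cons b u =>
      simp only [isUnit, Bool.and_eq_true, Bool.or_eq_true] at he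
      refine mul_ne_zero ?_ (ih (fun j hj => ?_) he.2)
      · rcases he.1 with h | h
        · exact pow_ne_zero _ (hu 0 (by simpa using h))
        · rw [Nat.eq_of_beq_eq_true h, pow_zero]; exact one_ne_zero
      · rw [add_assoc, add_comm 1]; exact hu (j + 1) (by simpa using hj)

variable [CharZero K]

/-- The check in `cancel` exhibits the row as an integer times a monomial times the new row. The
integer is nonzero in characteristic zero and the monomial is invertible, so the new row vanishes
too. -/
lemma holds_normalize {u : List Bool} (hu : ∀ j, u.getD j false = true → p j ≠ 0) {l : Terms}
    (hl : Holds p w l) : Holds p w (normalize u l) := by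
  unfold normalize cancel
  generalize divide _ _ l = l'
  generalize commonMonomial l 0 u = e
  generalize content l = g
  by_cases h : Nat.blt 0 g && isUnit u e && Bdd.digitsLE 127 10 e &&
    eqTerms (Terms.mapKey (fun k => k + e) g (guard l')) l
  · rw [h, cond_true]
    simp only [Bool.and_eq_true, Nat.blt_eq] at h
    obtain ⟨⟨⟨h1, h2⟩, h3⟩, h4⟩ := h
    refine ⟨keys_guard _, ?_⟩
    have h5 := hl.2
    rw [← eqTerms_sound h4, eval_shift (Bdd.digitsLE_sound h3) _ (keys_guard _), zsmul_eq_mul,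
      mul_eq_zero, or_iff_right (by exact_mod_cast h1.ne'), mul_eq_zero,
      or_iff_right (isUnit_sound (i := 0) (by simpa using hu) h2 10)] at h5
    exact h5
  · simpa only [h, cond_false] using hl

lemma isPivot_sound {u : List Bool} (hu : ∀ j, u.getD j false = true → p j ≠ 0) {sp : List Terms}
    (hsp : ∀ l ∈ sp, parEval p l ≠ 0) {l : Terms} (h : isPivot u sp l = true) :
    parEval p l ≠ 0 := by
  match l with
  | [] => simp [isPivot] at h
  | [(e, z)] =>
    simp only [isPivot, Bool.and_eq_true, Bool.not_eq_true'] at h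
    simp only [parEval, Terms.eval_cons, Terms.eval_nil, add_zero, zsmul_eq_mul]
    refine mul_ne_zero (Int.cast_ne_zero.2 fun hz => ?_)
      (isUnit_sound (i := 0) (by simpa using hu) h.1.1 10)
    rw [hz, eqInt_self] at h
    simp at h
  | t :: t' :: l =>
    simp only [isPivot, List.any_eq_true] at h
    obtain ⟨m, hm, e⟩ := h
    rw [eqTerms_sound e]
    exact hsp m hm

variable (p w) in
structure State.Holds (s : State) : Prop where
  tables : ∀ T ∈ s.tables, Vanishes p w T
  facts : ∀ f ∈ s.facts, f.Holds p w
  zeros : Zeros w s.zeros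

lemma holds_solveRow {u : List Bool} (hu : ∀ j, u.getD j false = true → p j ≠ 0) {sp : List Terms}
    (hsp : ∀ l ∈ sp, parEval p l ≠ 0) {s : State} (hs : s.Holds p w) (j : ℕ) {l : Terms}
    (hl : Holds p w l) : (solveRow u sp s j l).Holds p w := by
  unfold solveRow addFact
  by_cases h : isPivot u sp (coeff j l)
  · rw [h, cond_true]
    have h1 := isPivot_sound hu hsp h
    have h2 := (eval_coeff_drop j l).trans hl.2
    refine ⟨hs.tables, List.forall_mem_cons.2 ⟨⟨keys_coeff hl.1 j, keys_drop hl.1 j, h1, h2⟩,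
      hs.facts⟩, ?_⟩
    by_cases h3 : Bdd.isNil (drop j l)
    · rw [h3]
      intro i hi
      rw [cond_true, bit_setBit, Bool.or_eq_true, decide_eq_true_eq] at hi
      rcases hi with hi | rfl
      · exact hs.zeros i hi
      · match e : drop j l with
        | [] =>
          rw [e, Terms.eval_nil, add_zero, mul_eq_zero, or_iff_right h1] at h2
          exact h2
        | _ :: _ => rw [e] at h3; simp [Bdd.isNil] at h3
    · simp only [h3, cond_false]; exact hs.zeros
  · simpa only [h, cond_false] using hs

variable (p w) in
/-- The unknowns satisfy the linear equations which express that polar parts cancel. -/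
def Source (l : List Bdd) : Prop :=
  ∀ Z, Zeros w Z → bounded Z 0 l = true → Vanishes p w (mergeAll (groups Z 0 l))

lemma holds_step {u : List Bool} (hu : ∀ j, u.getD j false = true → p j ≠ 0) {sp : List Terms}
    (hsp : ∀ l ∈ sp, parEval p l ≠ 0) {im : ℕ → List Bdd} (him : ∀ i, Source p w (im i)) {s : State}
    (hs : s.Holds p w) (t : Step) : (step u sp im s t).Holds p w := by
  cases t with
  | load i =>
    unfold step
    by_cases h : bounded s.zeros 0 (im i)
    · simp only [h, cond_true]
      refine ⟨fun T hT => ?_, hs.facts, hs.zeros⟩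
      rcases List.mem_append.1 hT with hT | hT
      · exact hs.tables T hT
      · rw [List.mem_singleton.1 hT]; exact him i _ hs.zeros h
    · simpa only [h, cond_false] using hs
  | solve i j κ =>
    unfold step
    by_cases h : Bdd.nonpolar (κ * 256 ^ 11)
    · simpa only [h, cond_true] using hs
    · rw [Bool.not_eq_true] at h
      simp only [h, cond_false]
      refine holds_solveRow hu hsp hs j (holds_normalize hu
        (holds_reduce hs.facts (fun _ _ e => e) _ (holds_guard ?_)))
      rw [eval_dropAll hs.zeros]
      refine (?_ : Vanishes p w (s.tables.getD i [])) κ h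
      rw [List.getD_eq_getElem?_getD]
      cases e : s.tables[i]? with
      -- A table that does not exist is read as empty, and its equations are trivial.
      | none => exact fun κ _ => rfl
      | some T => exact hs.tables T (List.mem_of_getElem? e)

omit [CharZero K] in
-- If all other unknowns of a solved equation are zero, it says that a nonzero pivot times its
-- unknown is zero.
lemma vanishing_sound {facts : List Fact} (hf : ∀ f ∈ facts, f.Holds p w) {Z : ℕ} (hZ : Zeros w Z) :
    Zeros w (vanishing facts Z) := by
  induction facts generalizing Z with
  | nil => exact hZ
  | cons f facts ih =>
    obtain ⟨h1, h2⟩ := List.forall_mem_cons.1 hf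
    refine ih h2 ?_
    by_cases h : Bdd.allKeys (fun k => bit Z (k / 256 ^ 10)) f.rest
    · rw [h]
      intro i hi
      rw [cond_true, bit_setBit, Bool.or_eq_true, decide_eq_true_eq] at hi
      rcases hi with hi | rfl
      · exact hZ i hi
      · have h3 := h1.eq_zero
        have h4 : f.rest.eval (rowVal p w) = f.rest.eval (fun _ => 0) :=
          Terms.eval_congr ((Bdd.allKeys_sound h).mono fun k hk => by
            rw [rowVal, hZ _ hk, mul_zero])
        have h5 : ∀ l : Terms, l.eval (fun _ => (0 : K)) = 0 := fun l => by
          induction l with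
          | nil => rfl
          | cons t l ih => rw [Terms.eval_cons, ih, smul_zero, add_zero]
        rw [h4, h5, add_zero, mul_eq_zero, or_iff_right h1.ne_zero] at h3
        exact h3
    · simp only [h, cond_false]; exact hZ

lemma allBits_sound {Z n : ℕ} (h : allBits Z n = true) {j : ℕ} (h0 : j ≠ 0) (hj : j ≤ n) :
    bit Z j = true := by
  induction n with
  | zero => omega
  | succ n ih =>
    simp only [allBits, Bool.and_eq_true] at h
    rcases Nat.lt_or_ge n j with h1 | h1
    · rw [show j = n + 1 by omega]; exact h.1
    · exact ih h.2 h1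

lemma solves_sound {u : List Bool} (hu : ∀ j, u.getD j false = true → p j ≠ 0) {sp : List Terms}
    (hsp : ∀ l ∈ sp, parEval p l ≠ 0) {im : ℕ → List Bdd} (him : ∀ i, Source p w (im i))
    {steps : List Step} (h : solves u sp im steps = true) {j : ℕ} (h0 : j ≠ 0) (hj : j ≤ 125) :
    w j = 0 := by
  have hbit0 : Zeros w 0 := fun j hj => by simp [bit_eq] at hj
  have key : ∀ s : State, s.Holds p w → (run u sp im s steps).Holds p w := by
    induction steps with
    | nil => exact fun s hs => hs
    | cons t l ih =>
      intro s hs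
      clear h
      have ih' : ∀ s : State, s.Holds p w → (run u sp im s l).Holds p w := by
        clear ih
        induction l with
        | nil => exact fun s hs => hs
        | cons t l ih => exact fun s hs => ih _ (holds_step hu hsp him hs t)
      exact ih' _ (holds_step hu hsp him hs t)
  exact vanishing_sound (key _ ⟨by simp, by simp, hbit0⟩).facts hbit0 j (allBits_sound h h0 hj)

end

end Linear

/-! ### From polar coefficients to linear equations. -/

namespace Linear

section Tables

variable {K : Type*} [Field K] (p w : ℕ → K)

/-- The coefficient of the monomial with given exponents. -/
def coefVal (κ k : ℕ) : K := if k / 256 ^ 11 = κ then parVal p 0 10 (k % 256 ^ 10) else 0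

/-- The value of the equation which a table contains for given exponents. -/
def tableVal (κ : ℕ) (T : Table) : K := (select κ T).eval (rowVal p w)

/-- The combination of the coefficients of given exponents in a list of elements. -/
def coefSum (κ : ℕ) : ℕ → List Bdd → K
  | _, [] => 0
  | i, b :: l => w i * b.l.eval (coefVal p κ) + coefSum κ (i + 1) l

variable {p w}

lemma tableVal_cons (κ : ℕ) (x : ℕ × Terms) (T : Table) :
    tableVal p w κ (x :: T)
      = (if κ = x.1 then x.2.eval (rowVal p w) else 0) + tableVal p w κ T := by
  obtain ⟨κ', l⟩ := x
  rw [tableVal, select]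
  by_cases h : κ = κ'
  · subst h; rw [if_pos rfl, Nat.beq_refl, cond_true, Terms.eval_append]; rfl
  · rw [if_neg h, Bool.eq_false_iff.2 (fun e => h (Nat.eq_of_beq_eq_true e)), cond_false, zero_add]
    rfl

lemma tableVal_insertTerm (κ κ' : ℕ) (t : ℕ × ℤ) (T : Table) :
    tableVal p w κ (insertTerm κ' t T)
      = (if κ = κ' then t.2 • rowVal p w t.1 else 0) + tableVal p w κ T := by
  induction T with
  | nil => rw [insertTerm, tableVal_cons]; simp
  | cons x T ih =>
    obtain ⟨κ'', l⟩ := x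
    rw [insertTerm]
    by_cases h : Nat.beq κ' κ''
    · rw [h, cond_true, tableVal_cons, tableVal_cons]
      obtain rfl := Nat.eq_of_beq_eq_true h
      split_ifs with h1
      · simp [add_assoc]
      · simp
    · simp only [h, cond_false]
      rw [tableVal_cons]
      simp

/-- The terms dropped by `group` have no negative exponents, so they do not contribute to the
coefficient of a polar monomial. -/
lemma tableVal_group {κ : ℕ} (hκ : Bdd.nonpolar (κ * 256 ^ 11) = false) (j : ℕ) (l : Terms) :
    tableVal p w κ (group j l) = w j * l.eval (coefVal p κ) := by
  induction l with
  | nil => simp [group, tableVal, select]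
  | cons t l ih =>
    obtain ⟨k, z⟩ := t
    rw [group, Terms.eval_cons, mul_add, ← ih]
    by_cases h : Bdd.nonpolar k
    · rw [h, cond_true, coefVal, if_neg, smul_zero, mul_zero, zero_add]
      rintro rfl
      rw [Bdd.nonpolar, Bool.and_eq_true, Nat.ble_eq, Nat.ble_eq] at h
      rw [Bdd.nonpolar, Bool.and_eq_false_iff] at hκ
      rcases hκ with hκ | hκ <;> rw [← Bool.not_eq_true, Nat.ble_eq] at hκ <;> omega
    · simp only [h, cond_false]
      rw [tableVal_insertTerm, coefVal]
      simp only [eq_comm (a := κ)]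
      split_ifs with h1
      · have h2 : k % 256 ^ 10 < 256 ^ 10 := Nat.mod_lt _ (by norm_num)
        rw [rowVal, show (k % 256 ^ 10 + j * 256 ^ 10) % 256 ^ 10 = k % 256 ^ 10 by omega,
          show (k % 256 ^ 10 + j * 256 ^ 10) / 256 ^ 10 = j by omega]
        simp only [zsmul_eq_mul]
        ring
      · simp

lemma tableVal_merge (κ : ℕ) (T T' : Table) :
    tableVal p w κ (merge T T') = tableVal p w κ T + tableVal p w κ T' := by
  induction T generalizing T' with
  | nil => simp [merge, tableVal, select]
  | cons x T ih =>
    induction T' with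
    | nil => simp [merge, mergeAux, tableVal, select]
    | cons y T' ihy =>
      simp only [merge, mergeAux] at ihy ⊢
      by_cases h1 : Nat.blt x.1 y.1
      · simp only [h1, cond_true, tableVal_cons, ih, add_assoc]
      · by_cases h2 : Nat.blt y.1 x.1
        · simp only [h1, h2, cond_true, cond_false]
          rw [tableVal_cons, ihy, tableVal_cons κ y]; ring
        · simp only [h1, h2, cond_false]
          simp only [Nat.blt_eq, not_lt] at h1 h2
          rw [tableVal_cons, ih, tableVal_cons, tableVal_cons, le_antisymm h2 h1]
          split_ifs
          · rw [Terms.eval_append]; ring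
          · ring

lemma sum_mergePairs (κ : ℕ) (l : List Table) :
    ((mergePairs l).map (tableVal p w κ)).sum = (l.map (tableVal p w κ)).sum := by
  fun_induction mergePairs l with
  | case1 a b l ih => simp [ih, tableVal_merge, add_assoc]
  | case2 l h => rfl

lemma tableVal_mergeAll (κ : ℕ) (l : List Table) :
    tableVal p w κ (mergeAll l) = (l.map (tableVal p w κ)).sum := by
  have h1 : ∀ l : List Table,
      tableVal p w κ (l.foldr merge []) = (l.map (tableVal p w κ)).sum := fun l => by
    induction l with
    | nil => rfl
    | cons T l ih => rw [List.foldr_cons, tableVal_merge, ih, List.map_cons, List.sum_cons]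
  have h2 : ∀ n, ((Terms.iter mergePairs n l).map (tableVal p w κ)).sum
      = (l.map (tableVal p w κ)).sum := fun n => by
    induction n with
    | zero => rfl
    | succ n ih => rw [Terms.iter, sum_mergePairs, ih]
  rw [mergeAll, h1, h2]

lemma sum_groups {κ : ℕ} (hκ : Bdd.nonpolar (κ * 256 ^ 11) = false) {Z : ℕ} (hZ : Zeros w Z)
    (i : ℕ) (l : List Bdd) :
    ((groups Z i l).map (tableVal p w κ)).sum = coefSum p w κ i l := by
  induction l generalizing i with
  | nil => rfl
  | cons b l ih =>
    rw [groups, coefSum]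
    by_cases h : bit Z i
    · rw [h, cond_true, ih, hZ i h, zero_mul, zero_add]
    · simp only [h, cond_false, List.map_cons, List.sum_cons]
      rw [ih, tableVal_group hκ]

end Tables

section Combinations

variable {K A B : Type*} [Field K] [AddCommGroup A] [Module K A] [AddCommGroup B] [Module K B]
  (w : ℕ → K)

/-- The linear combination of the members of a list with given coefficients. -/
def lincomb : ℕ → List A → A
  | _, [] => 0
  | i, z :: l => w i • z + lincomb (i + 1) l

variable {w}

lemma lincomb_map (f : A →ₗ[K] B) {l : List A} {l' : List B}
    (h : List.Forall₂ (fun a b => f a = b) l l') (i : ℕ) :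
    lincomb w i l' = f (lincomb w i l) := by
  induction h generalizing i with
  | nil => simp [lincomb]
  | cons h _ ih => rw [lincomb, lincomb, map_add, map_smul, h, ih]

lemma lincomb_eq_zero {i : ℕ} {l : List A} (h : ∀ j, i ≤ j → j < i + l.length → w j = 0) :
    lincomb w i l = 0 := by
  induction l generalizing i with
  | nil => rfl
  | cons z l ih =>
    rw [List.length_cons] at h
    rw [lincomb, h i le_rfl (by omega), zero_smul, zero_add, ih fun j h1 h2 =>
      h j (by omega) (by omega)]

lemma exists_lincomb {l : List A} {z : A} (hz : z ∈ Submodule.span K {a | a ∈ l}) (i : ℕ) :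
    ∃ w : ℕ → K, lincomb w i l = z := by
  induction l generalizing z i with
  | nil => exact ⟨0, by simpa [lincomb, eq_comm] using hz⟩
  | cons a l ih =>
    have e : {b | b ∈ a :: l} = insert a {b | b ∈ l} := by ext b; simp
    rw [e, Submodule.mem_span_insert] at hz
    obtain ⟨c, y, hy, rfl⟩ := hz
    obtain ⟨w, hw⟩ := ih hy (i + 1)
    refine ⟨Function.update w i c, ?_⟩
    have : ∀ j, i < j → lincomb (Function.update w i c) j l = lincomb w j l := by
      clear hw hy ih e
      induction l with
      | nil => exact fun _ _ => rfl
      | cons b l ih =>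
        intro j hj
        rw [lincomb, lincomb, Function.update_of_ne (by omega), ih (j + 1) (by omega)]
    rw [lincomb, Function.update_self, this _ (by omega), hw]

end Combinations

section Words

variable {α β γ δ : Type*} {R : α → γ → Prop} {S : β → δ → Prop}

lemma forall₂_orbit {f : α → α} {g : γ → γ} (h : ∀ a b, R a b → R (f a) (g b)) (n : ℕ) {a : α}
    {b : γ} (hab : R a b) : List.Forall₂ R (orbit f n a) (orbit g n b) := by
  induction n generalizing a b with
  | zero => exact .cons hab .nil
  | succ n ih => exact .cons hab (ih (h _ _ hab))

lemma forall₂_flat {f : ℕ → α → List β} {g : ℕ → γ → List δ}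
    (h : ∀ n a b, R a b → List.Forall₂ S (f n a) (g n b)) (n : ℕ) {l : List α} {m : List γ}
    (hlm : List.Forall₂ R l m) : List.Forall₂ S (flat f n l) (flat g n m) := by
  induction hlm generalizing n with
  | nil => exact .nil
  | cons h1 _ ih => exact List.rel_append (h n _ _ h1) (ih (n - 1))

/-- Parametricity: a relation which the four operations preserve holds entry by entry between the
two lists of words. It connects encoded words with their values, and free words with their images.
-/
lemma forall₂_words {f₁ f₂ f₃ f₄ : α → α} {g₁ g₂ g₃ g₄ : γ → γ}
    (h₁ : ∀ a b, R a b → R (f₁ a) (g₁ b)) (h₂ : ∀ a b, R a b → R (f₂ a) (g₂ b))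
    (h₃ : ∀ a b, R a b → R (f₃ a) (g₃ b)) (h₄ : ∀ a b, R a b → R (f₄ a) (g₄ b)) (n : ℕ) {a : α}
    {b : γ} (hab : R a b) : List.Forall₂ R (words f₁ f₂ f₃ f₄ n a) (words g₁ g₂ g₃ g₄ n b) :=
  forall₂_flat (R := R) (fun n _ _ h => forall₂_flat (R := R) (fun n _ _ h => forall₂_flat (R := R)
    (fun n _ _ h => forall₂_orbit h₁ n h) n (forall₂_orbit h₂ n h)) n (forall₂_orbit h₃ n h)) n
    (forall₂_orbit h₄ n hab)

lemma getElem?_orbit (f : α → α) {i n : ℕ} (hi : i ≤ n) (a : α) :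
    (orbit f n a)[i]? = some (f^[i] a) := by
  induction n generalizing i a with
  | zero => simp [orbit, Nat.le_zero.1 hi]
  | succ n ih =>
    cases i with
    | zero => simp [orbit]
    | succ i => simpa [orbit] using ih (by omega) (f a)

lemma mem_flat {g : ℕ → α → List β} {n i : ℕ} {l : List α} {a : α} {b : β} (ha : l[i]? = some a)
    (hb : b ∈ g (n - i) a) : b ∈ flat g n l := by
  induction l generalizing n i with
  | nil => simp at ha
  | cons x l ih =>
    rw [flat, List.mem_append]
    cases i with
    | zero =>
      simp only [List.getElem?_cons_zero, Option.some.injEq] at ha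
      rw [ha]; exact Or.inl hb
    | succ i =>
      exact Or.inr (ih (i := i) (by simpa using ha) (by rwa [Nat.sub_sub, Nat.add_comm 1]))

lemma mem_words (f₁ f₂ f₃ f₄ : α → α) {n a b c d : ℕ} (h : a + b + c + d ≤ n) (v : α) :
    f₁^[a] (f₂^[b] (f₃^[c] (f₄^[d] v))) ∈ words f₁ f₂ f₃ f₄ n v := by
  refine mem_flat (getElem?_orbit f₄ (i := d) (by omega) v) ?_
  refine mem_flat (getElem?_orbit f₃ (i := c) (by omega) _) ?_
  refine mem_flat (getElem?_orbit f₂ (i := b) (by omega) _) ?_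
  exact List.mem_of_getElem? (getElem?_orbit f₁ (i := a) (by omega) _)

end Words

section Source

variable {K : Type*} [Field K] [Algebra ℂ K] {h : ℂ} {b₁ b₂ : Bool} {p w : ℕ → K}

/-- Three digits and the whole remaining quotient are recorded, so nothing is lost and injectivity
holds on all natural numbers. -/
lemma expsOf_injective : Function.Injective expsOf := by
  intro k k' e
  simp only [expsOf, Prod.mk.injEq] at e
  omega

/-- The computed lists are turned into coefficient functions. Words whose unknown is already known
to be zero drop out of the sum, so no bound is required for them. -/
lemma exists_comb_lincomb {l : List Bdd} {zs : List (LocK K h)}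
    (hl : List.Forall₂ (Bdd.Rep (frame K h b₁ b₂) p) l zs) {Z : ℕ} (hZ : Zeros w Z) (i : ℕ)
    (hb : bounded Z i l = true) :
    ∃ u : Frame.Exps →₀ K, (frame K h b₁ b₂).comb u = lincomb w i zs ∧
      ∀ κ, u (expsOf κ) = coefSum p w κ i l := by
  induction hl generalizing i with
  | nil => exact ⟨0, by simp [lincomb], fun κ => by simp [coefSum]⟩
  | @cons b z l zs hbz _ ih =>
    simp only [bounded, Bool.and_eq_true, Bool.or_eq_true, Nat.ble_eq] at hb
    obtain ⟨u, hu1, hu2⟩ := ih (i + 1) hb.2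
    rcases hb.1 with h1 | h1
    · refine ⟨u, ?_, fun κ => ?_⟩
      · rw [hu1, lincomb, hZ i h1, zero_smul, zero_add]
      · rw [hu2, coefSum, hZ i h1, zero_mul, zero_add]
    · let v : Frame.Exps →₀ K := b.l.eval fun k =>
        Finsupp.single (expsOf (k / 256 ^ 11)) (parVal p 0 10 (k % 256 ^ 10))
      have hv1 : (frame K h b₁ b₂).comb v = z := by
        rw [← (hbz h1).2]
        refine (Terms.map_eval (frame K h b₁ b₂).comb.toAddMonoidHom _ _).trans ?_
        simp only [LinearMap.toAddMonoidHom_coe, Frame.comb_single]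
        rfl
      have hv2 : ∀ κ, v (expsOf κ) = b.l.eval (coefVal p κ) := fun κ => by
        refine (Terms.map_eval (M := Frame.Exps →₀ K) (N := K)
          (Finsupp.lapply (R := K) (expsOf κ)).toAddMonoidHom _ _).trans ?_
        refine Terms.eval_congr fun t _ => ?_
        simp only [LinearMap.toAddMonoidHom_coe, Finsupp.lapply_apply, Finsupp.single_apply,
          expsOf_injective.eq_iff, coefVal]
      refine ⟨w i • v + u, ?_, fun κ => ?_⟩
      · rw [map_add, map_smul, hv1, hu1, lincomb]
      · rw [Finsupp.add_apply, Finsupp.smul_apply, hv2, hu2, coefSum, smul_eq_mul]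

/-- A polynomial has an expansion without negative exponents. By independence of the monomials it
coincides with the computed expansion, whose polar coefficients therefore vanish. -/
lemma source_of_mem_polynomials (hh : h ≠ 0) {l : List Bdd} {zs : List (LocK K h)}
    (hl : List.Forall₂ (Bdd.Rep (frame K h b₁ b₂) p) l zs)
    (hm : lincomb w 0 zs ∈ polynomials K h) : Source p w l := by
  have := nontrivial_locK K hh
  have : CharZero K := charZero_of_injective_algebraMap (algebraMap ℂ K).injective
  intro Z hZ hb κ hκ
  obtain ⟨u, hu1, hu2⟩ := exists_comb_lincomb hl hZ 0 hb
  obtain ⟨v, hv1, hv2⟩ := exists_comb_of_mem_polynomials b₁ b₂ hm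
  have huv : u = v := Frame.comb_injective (frame K h b₁ b₂)
    ((map_ne_zero (algebraMap ℂ K)).2 hh) (isUnit_frame_Y₁ K h b₁ b₂) (isUnit_frame_Y₂ K h b₁ b₂)
    (hu1.trans hv2.symm)
  rw [← tableVal, tableVal_mergeAll, sum_groups hκ hZ, ← hu2, huv]
  by_contra h0
  have h1 := hv1 _ h0
  rw [Bdd.nonpolar, Bool.and_eq_false_iff] at hκ
  simp only [nonneg, Set.mem_ofPred_eq, expsOf] at h1
  rcases hκ with hκ | hκ <;> rw [← Bool.not_eq_true, Nat.ble_eq] at hκ <;> omega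

end Source

end Linear

/-! ### Normally ordered words of bounded degree. -/

section Span

open Linear

variable {K A : Type*} [Field K] [Algebra ℂ K] [Ring A] [Algebra K A] {h : ℂ}

omit [Algebra ℂ K] in
lemma mul_pow_of_heisenberg {c : K} {x y : A} (e : y * x = x * y - algebraMap K A c) (n : ℕ) :
    y * x ^ (n + 1) = x ^ (n + 1) * y - (((n + 1 : ℕ) : K) * c) • x ^ n := by
  induction n with
  | zero => simp [e, Algebra.algebraMap_eq_smul_one]
  | succ n ih =>
    rw [pow_succ x (n + 1), ← mul_assoc, ih, sub_mul, mul_assoc, e, mul_sub, ← mul_assoc,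
      smul_mul_assoc, ← pow_succ, ← pow_succ, sub_sub, ← Algebra.commutes c, ← Algebra.smul_def,
      ← add_smul]
    push_cast
    ring_nf

/-- The span of the normally ordered monomials of bounded degree. -/
def orderedSpan (r : Var → A) (n : ℕ) : Submodule K A :=
  Submodule.span K {z | ∃ a b c d, a + b + c + d ≤ n ∧
    z = r .q₁ ^ a * (r .q₂ ^ b * (r .p₁ ^ c * r .p₂ ^ d))}

/-- Moving a variable to its place produces one word longer by one letter and at most one
correction, which comes from a commutator and has lower degree. -/
lemma mul_mem_orderedSpan {r : Var → A} (hr : Canonical (K := K) h r) (v : Var) {n : ℕ} {z : A}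
    (hz : z ∈ orderedSpan (K := K) r n) : r v * z ∈ orderedSpan (K := K) r (n + 1) := by
  have hc : ∀ u v, pairing u v = 0 → Commute (r u) (r v) := fun u v e => by
    have := hr u v
    rwa [e, zero_mul, map_zero, map_zero, sub_eq_zero] at this
  have key : ∀ a b c d, a + b + c + d ≤ n + 1 →
      r .q₁ ^ a * (r .q₂ ^ b * (r .p₁ ^ c * r .p₂ ^ d)) ∈ orderedSpan (K := K) r (n + 1) :=
    fun a b c d e => Submodule.subset_span ⟨a, b, c, d, e, rfl⟩
  have e₁ : r .p₁ * r .q₁ = r .q₁ * r .p₁ - algebraMap K A (algebraMap ℂ K h) := by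
    have := hr .q₁ .p₁
    rw [pairing, one_mul] at this
    rw [← this]; abel
  have e₂ : r .p₂ * r .q₂ = r .q₂ * r .p₂ - algebraMap K A (algebraMap ℂ K h) := by
    have := hr .q₂ .p₂
    rw [pairing, one_mul] at this
    rw [← this]; abel
  induction hz using Submodule.span_induction with
  | zero => simp
  | add x y _ _ hx hy => rw [mul_add]; exact add_mem hx hy
  | smul k x _ hx => rw [mul_smul_comm]; exact Submodule.smul_mem _ _ hx
  | mem z hz =>
    obtain ⟨a, b, c, d, e, rfl⟩ := hz
    cases v with
    | q₁ => rw [← mul_assoc, ← pow_succ']; exact key (a + 1) b c d (by omega)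
    | q₂ =>
      rw [((hc .q₂ .q₁ rfl).pow_right a).left_comm, ← mul_assoc (r .q₂), ← pow_succ']
      exact key a (b + 1) c d (by omega)
    | p₁ =>
      have h1 : r .p₁ * (r .q₂ ^ b * (r .p₁ ^ c * r .p₂ ^ d))
          = r .q₂ ^ b * (r .p₁ ^ (c + 1) * r .p₂ ^ d) := by
        rw [((hc .p₁ .q₂ rfl).pow_right b).left_comm, ← mul_assoc (r .p₁), ← pow_succ']
      cases a with
      | zero => rw [pow_zero, one_mul, h1]; simpa using key 0 b (c + 1) d (by omega)
      | succ a =>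
        rw [← mul_assoc, mul_pow_of_heisenberg e₁, sub_mul, mul_assoc, h1, smul_mul_assoc]
        exact sub_mem (key (a + 1) b (c + 1) d (by omega))
          (Submodule.smul_mem _ _ (key a b c d (by omega)))
    | p₂ =>
      rw [((hc .p₂ .q₁ rfl).pow_right a).left_comm]
      have h1 : r .p₂ * (r .p₁ ^ c * r .p₂ ^ d) = r .p₁ ^ c * r .p₂ ^ (d + 1) := by
        rw [((hc .p₂ .p₁ rfl).pow_right c).left_comm, ← pow_succ']
      cases b with
      | zero => rw [pow_zero, one_mul, h1]; simpa using key a 0 c (d + 1) (by omega)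
      | succ b =>
        rw [← mul_assoc (r .p₂), mul_pow_of_heisenberg e₂, sub_mul, mul_assoc (_ ^ _) (r .p₂), h1,
          smul_mul_assoc, mul_sub, mul_smul_comm]
        exact sub_mem (key a (b + 1) c (d + 1) (by omega))
          (Submodule.smul_mem _ _ (key a b c d (by omega)))

omit [Algebra ℂ K] in
lemma orderedSpan_mono (r : Var → A) {m n : ℕ} (h : m ≤ n) :
    orderedSpan (K := K) r m ≤ orderedSpan (K := K) r n :=
  Submodule.span_mono fun _ ⟨a, b, c, d, e, hz⟩ => ⟨a, b, c, d, e.trans h, hz⟩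

lemma lift_mem_orderedSpan {r : Var → A} (hr : Canonical (K := K) h r) {n : ℕ}
    {F : FreeAlgebra K Var} (hF : TotalDegreeLE n F) :
    FreeAlgebra.lift K r F ∈ orderedSpan (K := K) r n := by
  induction hF using Submodule.span_induction with
  | zero => simp
  | add x y _ _ hx hy => rw [map_add]; exact add_mem hx hy
  | smul k x _ hx => rw [map_smul]; exact Submodule.smul_mem _ _ hx
  | mem z hz =>
    obtain ⟨l, hl, rfl⟩ := hz
    refine orderedSpan_mono r hl ?_
    clear hl
    induction l with
    | nil => exact Submodule.subset_span ⟨0, 0, 0, 0, by simp, by simp⟩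
    | cons v l ih =>
      rw [List.map_cons, List.prod_cons, map_mul, FreeAlgebra.lift_ι_apply]
      exact mul_mem_orderedSpan hr v ih

/-- The normally ordered words of length at most five. -/
def orderedWords {B : Type*} [Mul B] (r : Var → B) (z : B) : List B :=
  words (r .q₁ * ·) (r .q₂ * ·) (r .p₁ * ·) (r .p₂ * ·) 5 z

lemma exists_lincomb_orderedWords {r : Var → A} (hr : Canonical (K := K) h r)
    {F : FreeAlgebra K Var} (hF : TotalDegreeLE 5 F) :
    ∃ w : ℕ → K, lincomb w 0 (orderedWords r 1) = FreeAlgebra.lift K r F := by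
  refine exists_lincomb (Submodule.span_mono ?_ (lift_mem_orderedSpan hr hF)) 0
  rintro _ ⟨a, b, c, d, e, rfl⟩
  have := mem_words (r .q₁ * ·) (r .q₂ * ·) (r .p₁ * ·) (r .p₂ * ·) e 1
  simp only [mul_left_iterate, mul_one] at this
  exact this

lemma canonical_weylVar : Canonical (K := K) h (weylVar K h) := by
  intro u v
  have e := RingQuot.mkAlgHom_rel ℂ (WeylRel.comm (h := h) u v)
  rw [map_sub, map_mul, map_mul, AlgHom.commutes] at e
  simp only [weylVar, Algebra.TensorProduct.tmul_mul_tmul, mul_one, ← TensorProduct.tmul_sub, e]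
  rw [Algebra.TensorProduct.algebraMap_apply, Algebra.algebraMap_self_apply,
    Algebra.algebraMap_eq_smul_one, TensorProduct.tmul_smul, TensorProduct.smul_tmul',
    Algebra.algebraMap_eq_smul_one]

omit [Algebra ℂ K] in
lemma lift_lincomb_orderedWords {B : Type*} [Ring B] [Algebra K B] (r : Var → B) (w : ℕ → K) :
    FreeAlgebra.lift K r (lincomb w 0 (orderedWords (FreeAlgebra.ι K) 1))
      = lincomb w 0 (orderedWords r 1) := by
  refine (lincomb_map (FreeAlgebra.lift K r).toLinearMap (forall₂_words ?_ ?_ ?_ ?_ 5 ?_) 0).symm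
  iterate 4
    rintro a _ rfl
    simp
  simp

/-- A polynomial of total degree at most five has coefficients with respect to the normally ordered
words, for all substitutions at once. -/
lemma exists_coefficients (h : ℂ) {F : FreeAlgebra K Var} (hF : TotalDegreeLE 5 F) :
    ∃ w : ℕ → K, toWeyl h F = lincomb w 0 (orderedWords (weylVar K h) 1) ∧
      ∀ {B : Type _} [Ring B] [Algebra K B] {r : Var → B}, Canonical (K := K) h r →
        FreeAlgebra.lift K r F = lincomb w 0 (orderedWords r 1) := by
  obtain ⟨w, hw⟩ := exists_lincomb_orderedWords (canonical_weylVar (K := K) (h := h)) hF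
  refine ⟨w, hw.symm, fun hr => ?_⟩
  rw [← lift_lincomb_orderedWords]
  -- The coefficients are found once, in the Weyl algebra. Every canonical substitution factors
  -- through it and so yields the same coefficients.
  refine lift_eq_of_toWeyl_eq hr ?_
  rw [toWeyl, lift_lincomb_orderedWords, hw]

omit [Algebra ℂ K] in
lemma lincomb_orderedWords {B : Type*} [Ring B] [Algebra K B] (r : Var → B) {w : ℕ → K}
    (hw : ∀ j, j ≠ 0 → j ≤ 125 → w j = 0) :
    lincomb w 0 (orderedWords r 1) = algebraMap K B (w 0) := by
  -- The list starts with the empty word, followed by the 125 others.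
  have h1 : ∃ l : List B, orderedWords r 1 = 1 :: l ∧ l.length = 125 := ⟨_, rfl, rfl⟩
  obtain ⟨l, h2, h3⟩ := h1
  rw [h2, lincomb, lincomb_eq_zero, add_zero, Algebra.algebraMap_eq_smul_one]
  intro j h4 h5
  exact hw j (by omega) (by omega)

end Span

namespace Data

open Linear

section

variable {K : Type*} [Field K] (p : ℕ → K)

/-- The letters from 6 to 9 stand for the canonical variables. -/
def freeVal : ℕ → FreeAlgebra K Var
  | 6 => FreeAlgebra.ι K .q₁
  | 7 => FreeAlgebra.ι K .p₁
  | 8 => FreeAlgebra.ι K .q₂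
  | 9 => FreeAlgebra.ι K .p₂
  | i => algebraMap K _ (p (i - 10))

end

end Data

/-! ### Degrees of the Hamiltonians. -/

/-- The degree of an expression in the canonical variables. -/
def Ex.degree : Ex → ℕ
  | .var i => bif Nat.ble i 9 then 1 else 0
  | .int _ => 0
  | .add a b => max (degree a) (degree b)
  | .neg a => degree a
  | .mul a b => degree a + degree b

section Degree

variable {K : Type*} [Field K]

lemma totalDegreeLE_mono {m n : ℕ} (h : m ≤ n) {F : FreeAlgebra K Var} (hF : TotalDegreeLE m F) :
    TotalDegreeLE n F :=
  Submodule.span_mono (by rintro _ ⟨l, hl, rfl⟩; exact ⟨l, hl.trans h, rfl⟩) hF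

lemma totalDegreeLE_mul {m n : ℕ} {F G : FreeAlgebra K Var} (hF : TotalDegreeLE m F)
    (hG : TotalDegreeLE n G) : TotalDegreeLE (m + n) (F * G) := by
  refine (Submodule.span_mul_span K _ _).le.trans (Submodule.span_mono ?_)
    (Submodule.mul_mem_mul hF hG)
  rintro _ ⟨_, ⟨l, hl, rfl⟩, _, ⟨l', hl', rfl⟩, rfl⟩
  exact ⟨l ++ l', by rw [List.length_append]; omega, by simp⟩

lemma totalDegreeLE_algebraMap (k : K) : TotalDegreeLE 0 (algebraMap K (FreeAlgebra K Var) k) := by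
  rw [Algebra.algebraMap_eq_smul_one]
  exact Submodule.smul_mem _ _ (Submodule.subset_span ⟨[], by simp⟩)

lemma totalDegreeLE_ι (v : Var) : TotalDegreeLE 1 (FreeAlgebra.ι K v) :=
  Submodule.subset_span ⟨[v], by simp⟩

lemma totalDegreeLE_eval (p : ℕ → K) (a : Ex) :
    TotalDegreeLE a.degree (a.eval (Data.freeVal p)) := by
  induction a with
  | var i =>
    match i with
    | 0 | 1 | 2 | 3 | 4 | 5 => exact totalDegreeLE_mono (by decide) (totalDegreeLE_algebraMap _)
    | 6 | 7 | 8 | 9 => exact totalDegreeLE_ι _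
    | i + 10 => exact totalDegreeLE_mono (Nat.zero_le _) (totalDegreeLE_algebraMap _)
  | int z =>
    have := totalDegreeLE_algebraMap (z : K)
    rwa [map_intCast] at this
  | add a b ha hb =>
    exact Submodule.add_mem _ (totalDegreeLE_mono (le_max_left _ _) ha)
      (totalDegreeLE_mono (le_max_right _ _) hb)
  | neg a ha => exact Submodule.neg_mem _ ha
  | mul a b ha hb => exact totalDegreeLE_mul ha hb

end Degree

/-! ### Reduction of the theorem to the checks on the data. -/

namespace Data

open Linear

section

variable {K : Type*} [Field K] [Algebra ℂ K] (p : ℕ → K)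

/-- The change of variables which is given by the data of a transformation. -/
noncomputable def Trans.map (h : ℂ) (t : Trans) : Var → LocK K h :=
  Bdd.values (frame K h t.b₁ t.b₂) p t.r

/-- The values of the letters after a transformation. -/
noncomputable def Trans.letters (h : ℂ) (t : Trans) : ℕ → LocK K h :=
  Bdd.letterSubstVal (frame K h t.b₁ t.b₂) p t.r

/-- The given values of the parameters and of the denominators have the properties which the data of
a system require. -/
structure System.Realized (s : System) (h : ℂ) (D₁ D₂ : Derivation ℂ K K) (c₁ c₂ : K) : Prop where
  zero : p 0 = algebraMap ℂ K h
  units : ∀ j, s.units.getD j false = true → p j ≠ 0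
  pivots : ∀ l ∈ s.pivots, parEval p l ≠ 0
  ne₁ : c₁ ≠ 0
  ne₂ : c₂ ≠ 0
  d₁ : ∀ j, c₁ * D₁ (p j) = (s.d₁.getD j (.int 0)).eval fun i => p (i - 10)
  d₂ : ∀ j, c₂ * D₂ (p j) = (s.d₂.getD j (.int 0)).eval fun i => p (i - 10)

variable {p} {h : ℂ}

lemma lift_eval_freeVal (t : Trans) {a : Ex} (ha : a.uses (Nat.ble 6) = true) :
    FreeAlgebra.lift K (t.map p h) (a.eval (freeVal p)) = a.eval (t.letters p h) := by
  refine (Ex.map_eval (freeVal p) (FreeAlgebra.lift K (t.map p h)).toRingHom a).trans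
    (Ex.eval_congr (fun i hi => ?_) ha)
  have hi := Nat.le_of_ble_eq_true hi
  match i, hi with
  | 6, _ => exact FreeAlgebra.lift_ι_apply _ _
  | 7, _ => exact FreeAlgebra.lift_ι_apply _ _
  | 8, _ => exact FreeAlgebra.lift_ι_apply _ _
  | 9, _ => exact FreeAlgebra.lift_ι_apply _ _
  | i + 10, _ => exact AlgHom.commutes _ _

/-- Since `r(E) - R` is a polynomial, `R` may be replaced by `r(E)` modulo polynomials. The affine
condition on `H` turns into a linear one on the sum of `H` and a multiple of `E`. -/
lemma flowTransforms_map_iff {κ : ℂ} (hh : h ≠ 0) (hκ : κ ≠ 0) (hp : p 0 = algebraMap ℂ K h)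
    {D : Derivation ℂ K K} {d : List Ex} {c : K} (hc : c ≠ 0)
    (hu : ∀ j, (d.getD j (.int 0)).uses (Nat.ble 10) = true)
    (hd : ∀ j, c * D (p j) = (d.getD j (.int 0)).eval fun i => p (i - 10)) {t : Trans}
    (hgen : Bdd.generates t.r t.gen [6, 7, 8, 9] = true) {R E : Ex}
    (hflow : (Bdd.isFlow t.r d R .q₁ 6 && Bdd.isFlow t.r d R .p₁ 7 &&
      Bdd.isFlow t.r d R .q₂ 8 && Bdd.isFlow t.r d R .p₂ 9) = true)
    (hE : E.uses (Nat.ble 6) = true) (hpoly : Bdd.isPoly t.r (E - R) = true)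
    (H : FreeAlgebra K Var) :
    FlowTransformsToPolynomial κ D (t.map p h) H ↔
      FreeAlgebra.lift K (t.map p h) (H + algebraMap ℂ K (κ * h)⁻¹ • (c⁻¹ • E.eval (freeVal p)))
        ∈ polynomials K h := by
  simp only [Bool.and_eq_true] at hflow
  have hmem : ∀ a : Ex, a.eval (t.letters p h) ∈ (frame K h t.b₁ t.b₂).combs := fun a => by
    refine Ex.eval_mem (fun i => ?_) a
    unfold Trans.letters Bdd.letterSubstVal
    split
    iterate 4 exact Ex.eval_mem ((frame K h t.b₁ t.b₂).letterVal_mem_combs p) _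
    exact (frame K h t.b₁ t.b₂).letterVal_mem_combs p _
  have hk : algebraMap ℂ K h ≠ 0 := (map_ne_zero (algebraMap ℂ K)).2 hh
  have hcomm : ∀ (k : K) (x y : LocK K h), comm x (k • y) = k • comm x y := by
    intro k x y; simp only [comm, smul_sub, smul_mul_assoc, mul_smul_comm]
  have hscale : ∀ {x y z : LocK K h}, comm x y = (algebraMap ℂ K h * c) • z →
      comm x (c⁻¹ • y) = h • z := by
    intro x y z e
    rw [hcomm, e, smul_smul, show c⁻¹ * (algebraMap ℂ K h * c) = algebraMap ℂ K h by field_simp,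
      ← algebra_compatible_smul K]
  have key : FlowTransformsToPolynomial κ D (t.map p h) H ↔
      FreeAlgebra.lift K (t.map p h) H + (κ * h)⁻¹ • (c⁻¹ • R.eval (t.letters p h))
        ∈ polynomials K h := by
    refine flowTransforms_iff (b₁ := t.b₁) (b₂ := t.b₂) hh hκ D (fun v => ?_)
      (Subalgebra.smul_mem _ (hmem R) _) (fun v => hscale ?_) (fun z hz => ?_) H
    · exact Ex.eval_mem ((frame K h t.b₁ t.b₂).letterVal_mem_combs p) _
    · cases v
      · exact Bdd.isFlow_sound D hp hu hd rfl hflow.1.1.1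
      · exact Bdd.isFlow_sound D hp hu hd rfl hflow.1.1.2
      · exact Bdd.isFlow_sound D hp hu hd rfl hflow.1.2
      · exact Bdd.isFlow_sound D hp hu hd rfl hflow.2
    · refine Bdd.generates_sound (F := frame K h t.b₁ t.b₂) hp hgen fun i hi => ?_
      simp only [List.mem_cons, List.not_mem_nil, or_false] at hi
      rcases hi with rfl | rfl | rfl | rfl
      · exact hz .q₁
      · exact hz .p₁
      · exact hz .q₂
      · exact hz .p₂
  have hsub : E.eval (t.letters p h) - R.eval (t.letters p h) ∈ polynomials K h :=
    Bdd.isPoly_sound hp hpoly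
  have hdiff : FreeAlgebra.lift K (t.map p h)
        (H + algebraMap ℂ K (κ * h)⁻¹ • (c⁻¹ • E.eval (freeVal p)))
      = FreeAlgebra.lift K (t.map p h) H + (κ * h)⁻¹ • (c⁻¹ • R.eval (t.letters p h))
        + algebraMap ℂ K (κ * h)⁻¹ • (c⁻¹ • (E.eval (t.letters p h) - R.eval (t.letters p h))) := by
    rw [map_add, map_smul, map_smul, lift_eval_freeVal t hE, algebra_compatible_smul K (κ * h)⁻¹,
      smul_sub, smul_sub, add_assoc, add_sub_cancel]
  rw [key, hdiff]
  exact (add_mem_cancel_right (Subalgebra.smul_mem _ (Subalgebra.smul_mem _ hsub _) _)).symm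

lemma source_images (hh : h ≠ 0) (hp : p 0 = algebraMap ℂ K h) {w : ℕ → K} {t : Trans}
    (hm : lincomb w 0 (orderedWords (t.map p h) 1) ∈ polynomials K h) :
    Source p w (Linear.images t.r) := by
  refine source_of_mem_polynomials (b₁ := t.b₁) (b₂ := t.b₂) hh (forall₂_words
    (R := Bdd.Rep (frame K h t.b₁ t.b₂) p)
    (fun _ _ e => (Bdd.rep_letterSubst hp t.r 6).star hp e)
    (fun _ _ e => (Bdd.rep_letterSubst hp t.r 8).star hp e)
    (fun _ _ e => (Bdd.rep_letterSubst hp t.r 7).star hp e)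
    (fun _ _ e => (Bdd.rep_letterSubst hp t.r 9).star hp e) 5 (Bdd.rep_one _ p)) hm

variable {s : System} {D₁ D₂ : Derivation ℂ K K} {c₁ c₂ : K}

/-- Elements of degree at most five which all transformations map to polynomials are constants. -/
lemma forall_lift_mem_polynomials_iff (hh : h ≠ 0) (hs : s.Realized p h D₁ D₂ c₁ c₂)
    (hvalid : ∀ t ∈ s.trans, t.valid s = true) (hunique : s.unique = true)
    {F : FreeAlgebra K Var} (hF : TotalDegreeLE 5 F) :
    (∀ t ∈ s.trans, FreeAlgebra.lift K (t.map p h) F ∈ polynomials K h) ↔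
      ∃ k : K, toWeyl h F = algebraMap K (WeylK K h) k := by
  have : CharZero K := charZero_of_injective_algebraMap (algebraMap ℂ K).injective
  have hcan : ∀ t ∈ s.trans, Canonical (K := K) h (t.map p h) := fun t ht => by
    have := hvalid t ht
    simp only [Trans.valid, Bool.and_eq_true] at this
    exact Bdd.isCanonical_sound rfl hs.zero this.1.1.1.1.1
  constructor
  · intro hm
    obtain ⟨w, hw1, hw2⟩ := exists_coefficients h hF
    refine ⟨w 0, hw1.trans (lincomb_orderedWords _ fun j h0 hj => ?_)⟩
    refine solves_sound hs.units hs.pivots (fun i => ?_) hunique h0 hj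
    rw [System.images, List.getD_eq_getElem?_getD, List.getElem?_map]
    cases e : s.trans[i]? with
    | none => intro Z _ _ κ _; rfl
    | some t =>
      have ht := List.mem_of_getElem? e
      have := hm t ht
      rw [hw2 (hcan t ht)] at this
      exact source_images hh hs.zero this
  · rintro ⟨k, hk⟩ t ht
    have : toWeyl h F = toWeyl h (algebraMap K _ k) := by rw [hk, AlgHom.commutes]
    rw [lift_eq_of_toWeyl_eq (hcan t ht) this, AlgHom.commutes]
    exact Subalgebra.algebraMap_mem _ _

lemma neg_inv_smul {R A : Type*} [Field R] [Ring A] [Algebra R A] (c : R) (x : A) :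
    (-c)⁻¹ • x = -(c⁻¹ • x) := by
  rw [inv_neg, neg_smul]

lemma toWeyl_add_smul_eq_iff {κ : ℂ} (H E : FreeAlgebra K Var) :
    (∃ k : K, toWeyl h (H + algebraMap ℂ K (κ * h)⁻¹ • E) = algebraMap K (WeylK K h) k) ↔
      ∃ k : K, toWeyl h H = (-(κ * h))⁻¹ • toWeyl h E + algebraMap K (WeylK K h) k := by
  refine exists_congr fun k => ?_
  have e : ∀ (c : ℂ) (x : WeylK K h), (-c)⁻¹ • x = -(c⁻¹ • x) := fun c x =>
    neg_inv_smul c x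
  rw [map_add, map_smul, ← algebra_compatible_smul K, e, ← eq_sub_iff_add_eq, neg_add_eq_sub]

/-- The expressions in the data of a system contain admissible letters only, and the degrees of the
Hamiltonians are at most five. -/
def System.wellFormed (s : System) : Bool :=
  s.d₁.all (Ex.uses (Nat.ble 10)) && s.d₂.all (Ex.uses (Nat.ble 10)) &&
    s.H₁.uses (Nat.ble 6) && s.H₂.uses (Nat.ble 6) &&
    Nat.ble s.H₁.degree 5 && Nat.ble s.H₂.degree 5

lemma uses_getD {d : List Ex} (h : d.all (Ex.uses (Nat.ble 10)) = true) (j : ℕ) :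
    (d.getD j (.int 0)).uses (Nat.ble 10) = true := by
  rw [List.getD_eq_getElem?_getD]
  cases e : d[j]? with
  | none => rfl
  | some a => exact List.all_eq_true.1 h a (List.mem_of_getElem? e)

omit [Algebra ℂ K] in
lemma System.totalDegreeLE (hwf : s.wellFormed = true) (k : K) :
    TotalDegreeLE 5 (k • s.H₁.eval (freeVal p)) ∧ TotalDegreeLE 5 (k • s.H₂.eval (freeVal p)) := by
  simp only [System.wellFormed, Bool.and_eq_true, Nat.ble_eq] at hwf
  exact ⟨Submodule.smul_mem _ _ (totalDegreeLE_mono hwf.1.2 (totalDegreeLE_eval p _)),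
    Submodule.smul_mem _ _ (totalDegreeLE_mono hwf.2 (totalDegreeLE_eval p _))⟩

/-- The two times decouple: each difference from the expected Hamiltonian satisfies the same
homogeneous condition, whose only solutions are constants. -/
theorem forall_flowTransforms_iff {κ : ℂ} (hh : h ≠ 0) (hκ : κ ≠ 0)
    (hs : s.Realized p h D₁ D₂ c₁ c₂) (hwf : s.wellFormed = true)
    (hvalid : (s.trans.all fun t => t.valid s) = true) (hunique : s.unique = true)
    {E₁ E₂ : FreeAlgebra K Var} (e₁ : E₁ = c₁⁻¹ • s.H₁.eval (freeVal p))
    (e₂ : E₂ = c₂⁻¹ • s.H₂.eval (freeVal p)) {H₁ H₂ : FreeAlgebra K Var}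
    (hH₁ : TotalDegreeLE 5 H₁) (hH₂ : TotalDegreeLE 5 H₂) :
    (∀ r ∈ s.trans.map (Trans.map p h), FlowTransformsToPolynomial κ D₁ r H₁ ∧
      FlowTransformsToPolynomial κ D₂ r H₂) ↔
    ∃ k₁ k₂ : K,
      toWeyl h H₁ = (-(κ * h))⁻¹ • toWeyl h E₁ + algebraMap K (WeylK K h) k₁ ∧
      toWeyl h H₂ = (-(κ * h))⁻¹ • toWeyl h E₂ + algebraMap K (WeylK K h) k₂ := by
  have hE₁ : TotalDegreeLE 5 E₁ := e₁ ▸ (System.totalDegreeLE hwf _).1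
  have hE₂ : TotalDegreeLE 5 E₂ := e₂ ▸ (System.totalDegreeLE hwf _).2
  rw [List.all_eq_true] at hvalid
  simp only [System.wellFormed, Bool.and_eq_true] at hwf
  obtain ⟨⟨⟨⟨⟨u₁, u₂⟩, u₃⟩, u₄⟩, -⟩, -⟩ := hwf
  rw [exists_and_exists_comm.symm, ← toWeyl_add_smul_eq_iff, ← toWeyl_add_smul_eq_iff,
    ← forall_lift_mem_polynomials_iff hh hs hvalid hunique
      (Submodule.add_mem _ hH₁ (Submodule.smul_mem _ _ hE₁)),
    ← forall_lift_mem_polynomials_iff hh hs hvalid hunique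
      (Submodule.add_mem _ hH₂ (Submodule.smul_mem _ _ hE₂)), List.forall_mem_map, ← forall₂_and]
  refine forall₂_congr fun t ht => ?_
  have hv := hvalid t ht
  rw [Trans.valid, Bool.and_eq_true, Bool.and_eq_true, Bool.and_eq_true, Bool.and_eq_true,
    Bool.and_eq_true] at hv
  obtain ⟨⟨⟨⟨⟨-, v₁⟩, v₂⟩, v₃⟩, v₄⟩, v₅⟩ := hv
  rw [e₁, e₂, flowTransforms_map_iff hh hκ hs.zero hs.ne₁ (uses_getD u₁) hs.d₁ v₁ v₂ u₃ v₄,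
    flowTransforms_map_iff hh hκ hs.zero hs.ne₂ (uses_getD u₂) hs.d₂ v₁ v₃ u₄ v₅]

end

end Data

/-! ### Comparison of the data with the statement. -/

namespace Data

open Linear

section

variable {K A : Type*} [Field K] [Ring A] [Algebra K A]

/-- The members of a list, followed by zeros. -/
def param (l : List K) (i : ℕ) : K := l.getD i 0

/-- The values of the letters in the frames which belong to a chart. -/
structure Flavors (c : Chart A) (p : ℕ → K) (G : Bool → Bool → ℕ → A) : Prop where
  X₁ : ∀ b, G false b 0 = c.x₁
  I₁ : ∀ b, G false b 1 = c.ix₁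
  Y₁ : ∀ b, G false b 4 = c.y₁
  X₁' : ∀ b, G true b 0 = c.y₁
  I₁' : ∀ b, G true b 1 = c.iy₁
  Y₁' : ∀ b, G true b 4 = -c.x₁
  X₂ : ∀ b, G b false 2 = c.x₂
  I₂ : ∀ b, G b false 3 = c.ix₂
  Y₂ : ∀ b, G b false 5 = c.y₂
  X₂' : ∀ b, G b true 2 = c.y₂
  I₂' : ∀ b, G b true 3 = c.iy₂
  Y₂' : ∀ b, G b true 5 = -c.x₂
  par : ∀ b₁ b₂ i, G b₁ b₂ (10 + i) = algebraMap K A (p i)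

variable {c : Chart A} {G : Bool → Bool → ℕ → A}

lemma units_of_forall₂ {u : List Bool} {l : List K}
    (h : List.Forall₂ (fun b x => b = true → x ≠ 0) u l) (j : ℕ) (hj : u.getD j false = true) :
    param l j ≠ 0 := by
  induction h generalizing j with
  | nil => simp at hj
  | cons h _ ih =>
    cases j with
    | zero => exact h hj
    | succ j => exact ih j hj

lemma derivatives_of_forall₂ [Algebra ℂ K] {D : Derivation ℂ K K} {k : K} {q : ℕ → K} {d : List Ex}
    {l : List K} (h : List.Forall₂ (fun x a => k * D x = a.eval q) l d) (j : ℕ) :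
    k * D (param l j) = (d.getD j (.int 0)).eval q := by
  induction h generalizing j with
  | nil => simp [param]
  | cons h _ ih =>
    cases j with
    | zero => exact h
    | succ j => exact ih j

lemma eval_zero (g : ℕ → A) : (0 : Ex).eval g = 0 := Int.cast_zero

lemma eval_one (g : ℕ → A) : (1 : Ex).eval g = 1 := Int.cast_one

lemma eval_two (g : ℕ → A) : (2 : Ex).eval g = 2 := Int.cast_ofNat 2

lemma eval_three (g : ℕ → A) : (3 : Ex).eval g = 3 := Int.cast_ofNat 3

lemma eval_four (g : ℕ → A) : (4 : Ex).eval g = 4 := Int.cast_ofNat 4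

lemma parEval_pmul_ne_zero {p : ℕ → K} {a b : Terms}
    (ha : Bdd.allKeys (Bdd.digitsLE 127 10) a = true)
    (hb : Bdd.allKeys (Bdd.digitsLE 127 10) b = true) (h : parEval p a ≠ 0)
    (h' : parEval p b ≠ 0) : parEval p (pmul a b) ≠ 0 := by
  rw [parEval_pmul ((Bdd.allKeys_sound ha).mono fun _ => Bdd.digitsLE_sound)
    ((Bdd.allKeys_sound hb).mono fun _ => Bdd.digitsLE_sound)]
  exact mul_ne_zero h h'

end

section

variable {K : Type*} [Field K] [Algebra ℂ K]

lemma flavors_newChart (h : ℂ) (p : ℕ → K) : Flavors (newChart K h) p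
    fun b₁ b₂ => Bdd.letterVal (frame K h b₁ b₂) p where
  X₁ _ := rfl
  I₁ _ := rfl
  Y₁ _ := rfl
  X₁' _ := rfl
  I₁' _ := rfl
  Y₁' _ := rfl
  X₂ _ := rfl
  I₂ _ := rfl
  Y₂ _ := rfl
  X₂' _ := rfl
  I₂' _ := rfl
  Y₂' _ := rfl
  par b₁ b₂ i := by rw [Bdd.letterVal_param (by omega), Nat.add_sub_cancel_left]

lemma derivation_div (D : Derivation ℂ K K) (x y : K) :
    D (x / y) = (D x * y - x * D y) / y ^ 2 := by
  rw [Derivation.leibniz_div, smul_eq_mul, smul_eq_mul, smul_eq_mul]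
  ring

lemma derivation_two (D : Derivation ℂ K K) : D 2 = 0 := by
  exact_mod_cast D.map_natCast 2

lemma derivation_inv_two (D : Derivation ℂ K K) : D 2⁻¹ = 0 := by
  simp [D.leibniz_inv, derivation_two]

lemma denom_algebraMap (k : Kind) (h : ℂ) (α : ℕ → ℂ) :
    denom k (algebraMap ℂ K h) (fun i => algebraMap ℂ K (α i)) = algebraMap ℂ K (denom k h α) := by
  cases k <;> simp [denom, map_ofNat (algebraMap ℂ K)]

/-- The assertion about one system. -/
def Determined (k : Kind) (h κ : ℂ) (α : ℕ → ℂ) (η : ℂ) (D₁ D₂ : Derivation ℂ K K) (t₁ t₂ : K) :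
    Prop :=
  (TotalDegreeLE 5 (garnierHamiltonians k h α η t₁ t₂).1 ∧
    TotalDegreeLE 5 (garnierHamiltonians k h α η t₁ t₂).2) ∧
  ∀ H₁ H₂ : FreeAlgebra K Var, TotalDegreeLE 5 H₁ → TotalDegreeLE 5 H₂ →
    (HolomorphyCondition k h κ α η D₁ D₂ t₁ t₂ H₁ H₂ ↔ ∃ c₁ c₂ : K,
      toWeyl h H₁ = (-(κ * h))⁻¹ • toWeyl h (garnierHamiltonians k h α η t₁ t₂).1
        + algebraMap K (WeylK K h) c₁ ∧
      toWeyl h H₂ = (-(κ * h))⁻¹ • toWeyl h (garnierHamiltonians k h α η t₁ t₂).2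
        + algebraMap K (WeylK K h) c₂)

lemma determined_of_realized {k : Kind} {h κ : ℂ} {α : ℕ → ℂ} {η : ℂ} {D₁ D₂ : Derivation ℂ K K}
    {t₁ t₂ : K} (hh : h ≠ 0) (hκ : κ ≠ 0) {s : System} {p : ℕ → K} {c₁ c₂ : K}
    (hs : s.Realized p h D₁ D₂ c₁ c₂) (hwf : s.wellFormed = true)
    (hvalid : (s.trans.all fun t => t.valid s) = true) (hunique : s.unique = true)
    (hH : garnierHamiltonians k h α η t₁ t₂
      = (c₁⁻¹ • s.H₁.eval (freeVal p), c₂⁻¹ • s.H₂.eval (freeVal p)))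
    (ht : transformations k (fun i => algebraMap ℂ K (α i)) (algebraMap ℂ K η) t₁ t₂ (newChart K h)
      = s.trans.map (Trans.map p h)) : Determined k h κ α η D₁ D₂ t₁ t₂ := by
  refine ⟨?_, fun H₁ H₂ hH₁ hH₂ => ?_⟩
  · rw [hH]
    exact ⟨(System.totalDegreeLE hwf _).1, (System.totalDegreeLE hwf _).2⟩
  · rw [HolomorphyCondition, ht]
    exact forall_flowTransforms_iff hh hκ hs hwf hvalid hunique (congrArg Prod.fst hH)
      (congrArg Prod.snd hH) hH₁ hH₂

end

end Data

/-! ### The seven systems. -/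

namespace Data

open Linear

set_option linter.unusedSimpArgs false
set_option maxRecDepth 100000

namespace G11111

/-- The values of the parameters. -/
def values {K : Type*} [Field K] (h : K) (a : ℕ → K) (t₁ t₂ : K) : ℕ → K :=
  param [h, a 1, a 1 - a 2, a 3, a 4, a 5, denom .g11111 h a, t₁ / t₂, t₂]

section

variable {K A : Type*} [Field K] [Ring A] [Algebra K A] {h η t₁ t₂ : K} {a p : ℕ → K}
  (e₀ : t₁ / t₂ = p 7) (e₁ : h = p 0) (e₂ : a 1 = p 1) (e₃ : a 2 = p 1 - p 2) (e₄ : a 3 = p 3)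
  (e₅ : a 4 = p 4) (e₆ : a 5 = p 5) (e₇ : t₂ = p 8) (e₈ : t₁ = p 7 * p 8)
  (e₉ : a 6 = p 0 - p 1 - (p 1 - p 2) - p 3 - p 4 - p 5 - p 6)

include e₁ e₂ e₃ e₄ e₅ e₆ e₇ e₈ in
-- Once the old parameters are rewritten through the independent ones, both sides expand to the same
-- expression in the free algebra.
lemma ham_eq :
    hamiltonians .g11111 h a η t₁ t₂ (FreeAlgebra.ι K .q₁) (FreeAlgebra.ι K .p₁)
      (FreeAlgebra.ι K .q₂) (FreeAlgebra.ι K .p₂)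
    = ((denom .g11111 h a * t₁ * (t₁ - 1) * (t₁ - t₂))⁻¹ • system.H₁.eval (freeVal p),
      (denom .g11111 h a * t₂ * (t₂ - 1) * (t₂ - t₁))⁻¹ • system.H₂.eval (freeVal p)) := by
  refine Prod.ext (congrArg (_ • ·) ?_) (congrArg (_ • ·) ?_)
  all_goals
    simp only [e₁, e₂, e₃, e₄, e₅, e₆, e₇, e₈, system, H₁, H₂, freeVal, Nat.add_sub_cancel_left,
      Ex.eval_add, Ex.eval_sub, Ex.eval_mul, Ex.eval_neg, Ex.eval_pow, Ex.eval_var, eval_one,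
      eval_two, eval_three, eval_four, Algebra.smul_def, map_add, map_sub, map_mul, map_pow,
      map_one, map_ofNat, map_neg, neg_mul]

include e₀ e₂ e₃ e₄ e₅ e₆ e₈ e₉ in
lemma trans_eq {c : Chart A} {G : Bool → Bool → ℕ → A} (hG : Flavors c p G) :
    transformations .g11111 a η t₁ t₂ c =
      system.trans.map fun t v => (t.r v).eval (G t.b₁ t.b₂) := by
  simp only [transformations, trans11111, e₀]
  refine congrArg₂ List.cons ?_ <| congrArg₂ List.cons ?_ <| congrArg₂ List.cons ?_ <| congrArg₂
    List.cons ?_ <| congrArg₂ List.cons ?_ <| congrArg₂ List.cons ?_ rfl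
  all_goals
    ext v
    cases v <;>
    simp only [e₂, e₃, e₄, e₅, e₆, e₈, e₉, subst, projective₁, dualInversion₁, dualInversion₂,
      shiftedInversion, chart, cond_true, cond_false, hG.par, hG.X₁, hG.I₁, hG.Y₁, hG.X₁', hG.I₁',
      hG.Y₁', hG.X₂, hG.I₂, hG.Y₂, hG.X₂', hG.I₂', hG.Y₂', Ex.eval_add, Ex.eval_sub, Ex.eval_mul,
      Ex.eval_neg, Ex.eval_pow, Ex.eval_var, eval_one, eval_two, eval_three, eval_four,
      Algebra.smul_def, map_add, map_sub, map_mul, map_pow, map_one, map_ofNat, map_neg, neg_mul,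
      neg_neg, mul_one, one_mul]

end

section

variable {K : Type*} [Field K] [Algebra ℂ K] {D₁ D₂ : Derivation ℂ K K} {t₁ t₂ : K} {h κ : ℂ}
  {α : ℕ → ℂ} {η : ℂ}

lemma realized (h11 : D₁ t₁ = 1) (h12 : D₁ t₂ = 0) (h21 : D₂ t₁ = 0) (h22 : D₂ t₂ = 1)
    (hh : h ≠ 0) (hS : denom .g11111 h α ≠ 0) (hα : α 1 ≠ α 2) :
    system.Realized
      (values (algebraMap ℂ K h) (fun i => algebraMap ℂ K (α i)) t₁ t₂) h D₁ D₂
      (denom .g11111 (algebraMap ℂ K h) (fun i => algebraMap ℂ K (α i)) * t₁ * (t₁ - 1) * (t₁ - t₂))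
      (denom .g11111 (algebraMap ℂ K h) (fun i => algebraMap ℂ K (α i)) * t₂ * (t₂ - 1) *
        (t₂ - t₁)) := by
  have : CharZero K := charZero_of_injective_algebraMap (algebraMap ℂ K).injective
  -- All nonvanishing statements about the times follow from the derivations: a zero of `t₁`, `t₁ -
  -- 1` or `t₁ - t₂` would contradict `D₁ t₁ = 1` and `D₁ t₂ = 0`.
  have n₁ : t₁ ≠ 0 := fun e => by simp [e] at h11
  have n₂ : t₂ ≠ 0 := fun e => by simp [e] at h22
  have n₃ : t₁ - 1 ≠ 0 := fun e => by simp [sub_eq_zero.1 e] at h11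
  have n₄ : t₂ - 1 ≠ 0 := fun e => by simp [sub_eq_zero.1 e] at h22
  have n₅ : t₁ - t₂ ≠ 0 := fun e => by simp [sub_eq_zero.1 e, h12] at h11
  have n₆ : t₂ - t₁ ≠ 0 := fun e => n₅ (by linear_combination -e)
  have nδ : algebraMap ℂ K (α 1) - algebraMap ℂ K (α 2) ≠ 0 := by
    rw [← map_sub]; exact (map_ne_zero (algebraMap ℂ K)).2 (sub_ne_zero.2 hα)
  have nS : algebraMap ℂ K (denom .g11111 h α) ≠ 0 := (map_ne_zero (algebraMap ℂ K)).2 hS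
  rw [denom_algebraMap]
  set q := values (algebraMap ℂ K h) (fun i => algebraMap ℂ K (α i)) t₁ t₂ with hq
  refine ⟨rfl, units_of_forall₂ ?_, ?_, by simp [*], by simp [*], derivatives_of_forall₂ ?_,
    derivatives_of_forall₂ ?_⟩
  · simp [system, denom_algebraMap, *]
  · have n₇ : t₁ / t₂ - 1 ≠ 0 := by rw [div_sub_one n₂]; exact div_ne_zero n₅ n₂
    have w₁ : parEval q tMinusOne ≠ 0 := by
      convert n₇ using 1
      simp [q, tMinusOne, parVal, values, param]
      ring
    have w₂ : parEval q t₁MinusOne ≠ 0 := by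
      convert n₃ using 1
      simp [q, t₁MinusOne, parVal, values, param, n₂]
      ring
    have w₃ : parEval q t₂MinusOne ≠ 0 := by
      convert n₄ using 1
      simp [q, t₂MinusOne, parVal, values, param]
      ring
    have w₄ : parEval q [(0, 2)] ≠ 0 := by simp [parVal_zero]
    have w₅ : parEval q [(0, -1)] ≠ 0 := by simp [parVal_zero]
    simp only [system, List.forall_mem_cons]
    exact ⟨w₁, w₂, parEval_pmul_ne_zero (by decide +kernel) (by decide +kernel) w₄ w₂,
      parEval_pmul_ne_zero (by decide +kernel) (by decide +kernel) w₅
        (parEval_pmul_ne_zero (by decide +kernel) (by decide +kernel) w₂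
          (parEval_pmul_ne_zero (by decide +kernel) (by decide +kernel) w₂ w₂)),
      parEval_pmul_ne_zero (by decide +kernel) (by decide +kernel)
        (parEval_pmul_ne_zero (by decide +kernel) (by decide +kernel) w₁ w₁)
        (parEval_pmul_ne_zero (by decide +kernel) (by decide +kernel) w₃ w₂), by simp⟩
  · simp [system, q, derivation_div, values, param, denom_algebraMap, eval_zero, eval_one, eval_two,
      derivation_two, derivation_inv_two, h11, h12, h21, h22]
    field_simp
  · simp [system, q, derivation_div, values, param, denom_algebraMap, eval_zero, eval_one, eval_two,
      derivation_two, derivation_inv_two, h11, h12, h21, h22]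
    field_simp
    simp

lemma determined (h11 : D₁ t₁ = 1) (h12 : D₁ t₂ = 0) (h21 : D₂ t₁ = 0) (h22 : D₂ t₂ = 1)
    (hh : h ≠ 0) (hκ : κ ≠ 0) (hS : denom .g11111 h α ≠ 0) (hα : α 1 ≠ α 2) :
    Determined .g11111 h κ α η D₁ D₂ t₁ t₂ := by
  have : CharZero K := charZero_of_injective_algebraMap (algebraMap ℂ K).injective
  have n₁ : t₁ ≠ 0 := fun e => by simp [e] at h11
  have n₂ : t₂ ≠ 0 := fun e => by simp [e] at h22
  have hp := realized h11 h12 h21 h22 hh hS hα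
  let a (i : ℕ) : K := algebraMap ℂ K (α i)
  let q := values (algebraMap ℂ K h) a t₁ t₂
  have e₀ : t₁ / t₂ = q 7 := rfl
  have e₁ : algebraMap ℂ K h = q 0 := rfl
  have e₂ : a 1 = q 1 := rfl
  have e₃ : a 2 = q 1 - q 2 := by
    change _ = a 1 - (a 1 - a 2)
    ring
  have e₄ : a 3 = q 3 := rfl
  have e₅ : a 4 = q 4 := rfl
  have e₆ : a 5 = q 5 := rfl
  have e₇ : t₂ = q 8 := rfl
  have e₈ : t₁ = q 7 * q 8 := by
    change _ = (t₁ / t₂) * t₂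
    field_simp
  have e₉ : a 6 = q 0 - q 1 - (q 1 - q 2) - q 3 - q 4 - q 5 - q 6 := by
    change _ = algebraMap ℂ K h - a 1 - (a 1 - (a 1 - a 2)) - a 3 - a 4 - a 5 - (denom .g11111
      (algebraMap ℂ K h) a)
    simp only [denom]
    ring
  -- The three Boolean checks, namely admissible letters and degrees, the properties of the
  -- transformations, and uniqueness, are evaluated by the kernel.
  exact determined_of_realized hh hκ hp (by decide +kernel) (by decide +kernel) (by decide +kernel)
    (ham_eq e₁ e₂ e₃ e₄ e₅ e₆ e₇ e₈) (trans_eq e₀ e₂ e₃ e₄ e₅ e₆ e₈ e₉ (flavors_newChart h _))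

end

end G11111

namespace G1112

/-- The values of the parameters. -/
def values {K : Type*} [Field K] (h : K) (a : ℕ → K) (η : K) (t₁ t₂ : K) : ℕ → K :=
  param [h, a 1, a 2, a 3, a 3 - a 4, denom .g1112 h a, η, t₁ / t₂, t₂]

section

variable {K A : Type*} [Field K] [Ring A] [Algebra K A] {h η t₁ t₂ : K} {a p : ℕ → K}
  (e₀ : t₁ / t₂ = p 7) (e₁ : h = p 0) (e₂ : a 1 = p 1) (e₃ : a 2 = p 2) (e₄ : a 3 = p 3)
  (e₅ : a 4 = p 3 - p 4) (e₆ : η = p 6) (e₇ : t₂ = p 8) (e₈ : t₁ = p 7 * p 8)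
  (e₉ : a 5 = p 5 - p 0 + p 1 - p 2 - p 3 - (p 3 - p 4))

include e₁ e₂ e₃ e₄ e₅ e₆ e₇ e₈ in
lemma ham_eq :
    hamiltonians .g1112 h a η t₁ t₂ (FreeAlgebra.ι K .q₁) (FreeAlgebra.ι K .p₁)
      (FreeAlgebra.ι K .q₂) (FreeAlgebra.ι K .p₂)
    = ((denom .g1112 h a * t₁ ^ 2)⁻¹ • system.H₁.eval (freeVal p),
      (denom .g1112 h a * t₂ * t₁ * (t₂ - 1))⁻¹ • system.H₂.eval (freeVal p)) := by
  refine Prod.ext (congrArg (_ • ·) ?_) (congrArg (_ • ·) ?_)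
  all_goals
    simp only [e₁, e₂, e₃, e₄, e₅, e₆, e₇, e₈, system, H₁, H₂, freeVal, Nat.add_sub_cancel_left,
      Ex.eval_add, Ex.eval_sub, Ex.eval_mul, Ex.eval_neg, Ex.eval_pow, Ex.eval_var, eval_one,
      eval_two, eval_three, eval_four, Algebra.smul_def, map_add, map_sub, map_mul, map_pow,
      map_one, map_ofNat, map_neg, neg_mul]

include e₀ e₂ e₃ e₄ e₅ e₆ e₈ e₉ in
lemma trans_eq {c : Chart A} {G : Bool → Bool → ℕ → A} (hG : Flavors c p G) :
    transformations .g1112 a η t₁ t₂ c =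
      system.trans.map fun t v => (t.r v).eval (G t.b₁ t.b₂) := by
  simp only [transformations, trans1112, e₀]
  refine congrArg₂ List.cons ?_ <| congrArg₂ List.cons ?_ <| congrArg₂ List.cons ?_ <| congrArg₂
    List.cons ?_ <| congrArg₂ List.cons ?_ rfl
  all_goals
    ext v
    cases v <;>
    simp only [e₂, e₃, e₄, e₅, e₆, e₈, e₉, subst, projective₁, dualInversion₂, shiftedInversion,
      chart, cond_true, cond_false, hG.par, hG.X₁, hG.I₁, hG.Y₁, hG.X₁', hG.I₁', hG.Y₁', hG.X₂,
      hG.I₂, hG.Y₂, hG.X₂', hG.I₂', hG.Y₂', Ex.eval_add, Ex.eval_sub, Ex.eval_mul, Ex.eval_neg,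
      Ex.eval_pow, Ex.eval_var, eval_one, eval_two, eval_three, eval_four, Algebra.smul_def,
      map_add, map_sub, map_mul, map_pow, map_one, map_ofNat, map_neg, neg_mul, neg_neg, mul_one,
      one_mul]

end

section

variable {K : Type*} [Field K] [Algebra ℂ K] {D₁ D₂ : Derivation ℂ K K} {t₁ t₂ : K} {h κ : ℂ}
  {α : ℕ → ℂ} {η : ℂ}

lemma realized (h11 : D₁ t₁ = 1) (h12 : D₁ t₂ = 0) (h21 : D₂ t₁ = 0) (h22 : D₂ t₂ = 1)
    (hh : h ≠ 0) (hS : denom .g1112 h α ≠ 0) (hα : α 3 ≠ α 4) (hη : η ≠ 0) :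
    system.Realized
      (values (algebraMap ℂ K h) (fun i => algebraMap ℂ K (α i)) (algebraMap ℂ K η) t₁ t₂) h D₁ D₂
      (denom .g1112 (algebraMap ℂ K h) (fun i => algebraMap ℂ K (α i)) * t₁ ^ 2)
      (denom .g1112 (algebraMap ℂ K h) (fun i => algebraMap ℂ K (α i)) * t₂ * t₁ * (t₂ - 1)) := by
  have : CharZero K := charZero_of_injective_algebraMap (algebraMap ℂ K).injective
  have n₁ : t₁ ≠ 0 := fun e => by simp [e] at h11
  have n₂ : t₂ ≠ 0 := fun e => by simp [e] at h22
  have n₄ : t₂ - 1 ≠ 0 := fun e => by simp [sub_eq_zero.1 e] at h22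
  have nδ : algebraMap ℂ K (α 3) - algebraMap ℂ K (α 4) ≠ 0 := by
    rw [← map_sub]; exact (map_ne_zero (algebraMap ℂ K)).2 (sub_ne_zero.2 hα)
  have nη : algebraMap ℂ K η ≠ 0 := (map_ne_zero (algebraMap ℂ K)).2 hη
  have nS : algebraMap ℂ K (denom .g1112 h α) ≠ 0 := (map_ne_zero (algebraMap ℂ K)).2 hS
  rw [denom_algebraMap]
  set q := values (algebraMap ℂ K h) (fun i => algebraMap ℂ K (α i)) (algebraMap ℂ K η) t₁ t₂ with
    hq
  refine ⟨rfl, units_of_forall₂ ?_, ?_, by simp [*], by simp [*], derivatives_of_forall₂ ?_,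
    derivatives_of_forall₂ ?_⟩
  · simp [system, denom_algebraMap, *]
  · have w : parEval q [(0, 1), (256 ^ 8, -1)] ≠ 0 := by
      refine ne_of_eq_of_ne (b := -(t₂ - 1)) ?_ (neg_ne_zero.2 n₄)
      simp [q, parVal, values, param]
      ring
    simpa only [system, List.forall_mem_singleton] using w
  · simp [system, q, derivation_div, values, param, denom_algebraMap, eval_zero, eval_one, eval_two,
      derivation_two, derivation_inv_two, h11, h12, h21, h22]
    field_simp
  · simp [system, q, derivation_div, values, param, denom_algebraMap, eval_zero, eval_one, eval_two,
      derivation_two, derivation_inv_two, h11, h12, h21, h22]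
    refine ⟨by field_simp, Or.inl ?_⟩
    field_simp

lemma determined (h11 : D₁ t₁ = 1) (h12 : D₁ t₂ = 0) (h21 : D₂ t₁ = 0) (h22 : D₂ t₂ = 1)
    (hh : h ≠ 0) (hκ : κ ≠ 0) (hS : denom .g1112 h α ≠ 0) (hα : α 3 ≠ α 4) (hη : η ≠ 0) :
    Determined .g1112 h κ α η D₁ D₂ t₁ t₂ := by
  have : CharZero K := charZero_of_injective_algebraMap (algebraMap ℂ K).injective
  have n₁ : t₁ ≠ 0 := fun e => by simp [e] at h11
  have n₂ : t₂ ≠ 0 := fun e => by simp [e] at h22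
  have hp := realized h11 h12 h21 h22 hh hS hα hη
  let a (i : ℕ) : K := algebraMap ℂ K (α i)
  let q := values (algebraMap ℂ K h) a (algebraMap ℂ K η) t₁ t₂
  have e₀ : t₁ / t₂ = q 7 := rfl
  have e₁ : algebraMap ℂ K h = q 0 := rfl
  have e₂ : a 1 = q 1 := rfl
  have e₃ : a 2 = q 2 := rfl
  have e₄ : a 3 = q 3 := rfl
  have e₅ : a 4 = q 3 - q 4 := by
    change _ = a 3 - (a 3 - a 4)
    ring
  have e₆ : algebraMap ℂ K η = q 6 := rfl
  have e₇ : t₂ = q 8 := rfl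
  have e₈ : t₁ = q 7 * q 8 := by
    change _ = (t₁ / t₂) * t₂
    field_simp
  have e₉ : a 5 = q 5 - q 0 + q 1 - q 2 - q 3 - (q 3 - q 4) := by
    change _ = (denom .g1112 (algebraMap ℂ K h) a) - algebraMap ℂ K h + a 1 - a 2 - a 3 - (a 3 -
      (a 3 - a 4))
    simp only [denom]
    ring
  exact determined_of_realized hh hκ hp (by decide +kernel) (by decide +kernel) (by decide +kernel)
    (ham_eq e₁ e₂ e₃ e₄ e₅ e₆ e₇ e₈) (trans_eq e₀ e₂ e₃ e₄ e₅ e₆ e₈ e₉ (flavors_newChart h _))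

end

end G1112

namespace G113

/-- The values of the parameters. -/
def values {K : Type*} [Field K] (h : K) (a : ℕ → K) (t₁ t₂ : K) : ℕ → K :=
  param [h, a 1, a 2, a 3, denom .g113 h a, t₁ - t₂, t₂]

section

variable {K A : Type*} [Field K] [Ring A] [Algebra K A] {h η t₁ t₂ : K} {a p : ℕ → K}
  (e₀ : a 1 = p 1) (e₁ : a 2 = p 2) (e₂ : a 3 = p 3) (e₃ : t₂ = p 6) (e₄ : t₁ = p 6 + p 5)
  (e₅ : a 4 = p 0 - p 1 - p 2 - p 3 - p 4)

include e₀ e₁ e₂ e₃ e₄ in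
lemma ham_eq :
    hamiltonians .g113 h a η t₁ t₂ (FreeAlgebra.ι K .q₁) (FreeAlgebra.ι K .p₁)
      (FreeAlgebra.ι K .q₂) (FreeAlgebra.ι K .p₂)
    = ((denom .g113 h a * (t₁ - t₂))⁻¹ • system.H₁.eval (freeVal p),
      (denom .g113 h a * (t₂ - t₁))⁻¹ • system.H₂.eval (freeVal p)) := by
  refine Prod.ext (congrArg (_ • ·) ?_) (congrArg (_ • ·) ?_)
  all_goals
    simp only [e₀, e₁, e₂, e₃, e₄, system, H₁, H₂, freeVal, Nat.add_sub_cancel_left, Ex.eval_add,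
      Ex.eval_sub, Ex.eval_mul, Ex.eval_neg, Ex.eval_pow, Ex.eval_var, eval_one, eval_two,
      eval_three, eval_four, Algebra.smul_def, map_add, map_sub, map_mul, map_pow, map_one,
      map_ofNat, map_neg, neg_mul]

include e₀ e₁ e₂ e₃ e₄ e₅ in
lemma trans_eq {c : Chart A} {G : Bool → Bool → ℕ → A} (hG : Flavors c p G) :
    transformations .g113 a η t₁ t₂ c =
      system.trans.map fun t v => (t.r v).eval (G t.b₁ t.b₂) := by
  simp only [transformations, trans113]
  refine congrArg₂ List.cons ?_ <| congrArg₂ List.cons ?_ <| congrArg₂ List.cons ?_ <| congrArg₂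
    List.cons ?_ rfl
  all_goals
    ext v
    cases v <;>
    simp only [e₀, e₁, e₂, e₃, e₄, e₅, subst, inversion₁, inversion₂, chart, cond_true,
      cond_false, hG.par, hG.X₁, hG.I₁, hG.Y₁, hG.X₁', hG.I₁', hG.Y₁', hG.X₂, hG.I₂, hG.Y₂, hG.X₂',
      hG.I₂', hG.Y₂', Ex.eval_add, Ex.eval_sub, Ex.eval_mul, Ex.eval_neg, Ex.eval_pow, Ex.eval_var,
      eval_one, eval_two, eval_three, eval_four, Algebra.smul_def, map_add, map_sub, map_mul,
      map_pow, map_one, map_ofNat, map_neg, neg_mul, neg_neg, mul_one, one_mul]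

end

section

variable {K : Type*} [Field K] [Algebra ℂ K] {D₁ D₂ : Derivation ℂ K K} {t₁ t₂ : K} {h κ : ℂ}
  {α : ℕ → ℂ} {η : ℂ}

lemma realized (h11 : D₁ t₁ = 1) (h12 : D₁ t₂ = 0) (h21 : D₂ t₁ = 0) (h22 : D₂ t₂ = 1)
    (hh : h ≠ 0) (hS : denom .g113 h α ≠ 0) :
    system.Realized
      (values (algebraMap ℂ K h) (fun i => algebraMap ℂ K (α i)) t₁ t₂) h D₁ D₂
      (denom .g113 (algebraMap ℂ K h) (fun i => algebraMap ℂ K (α i)) * (t₁ - t₂))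
      (denom .g113 (algebraMap ℂ K h) (fun i => algebraMap ℂ K (α i)) * (t₂ - t₁)) := by
  have : CharZero K := charZero_of_injective_algebraMap (algebraMap ℂ K).injective
  have n₂ : t₂ ≠ 0 := fun e => by simp [e] at h22
  have n₅ : t₁ - t₂ ≠ 0 := fun e => by simp [sub_eq_zero.1 e, h12] at h11
  have n₆ : t₂ - t₁ ≠ 0 := fun e => n₅ (by linear_combination -e)
  have nS : algebraMap ℂ K (denom .g113 h α) ≠ 0 := (map_ne_zero (algebraMap ℂ K)).2 hS
  rw [denom_algebraMap]
  set q := values (algebraMap ℂ K h) (fun i => algebraMap ℂ K (α i)) t₁ t₂ with hq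
  refine ⟨rfl, units_of_forall₂ ?_, ?_, by simp [*], by simp [*], derivatives_of_forall₂ ?_,
    derivatives_of_forall₂ ?_⟩
  · simp [system, denom_algebraMap, *]
  · simp [system]
  · simp [system, q, derivation_div, values, param, denom_algebraMap, eval_zero, eval_one, eval_two,
      derivation_two, derivation_inv_two, h11, h12, h21, h22]
  · simp [system, q, derivation_div, values, param, denom_algebraMap, eval_zero, eval_one, eval_two,
      derivation_two, derivation_inv_two, h11, h12, h21, h22]
    constructor <;> ring

lemma determined (h11 : D₁ t₁ = 1) (h12 : D₁ t₂ = 0) (h21 : D₂ t₁ = 0) (h22 : D₂ t₂ = 1)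
    (hh : h ≠ 0) (hκ : κ ≠ 0) (hS : denom .g113 h α ≠ 0) :
    Determined .g113 h κ α η D₁ D₂ t₁ t₂ := by
  have : CharZero K := charZero_of_injective_algebraMap (algebraMap ℂ K).injective
  have n₂ : t₂ ≠ 0 := fun e => by simp [e] at h22
  have hp := realized h11 h12 h21 h22 hh hS
  let a (i : ℕ) : K := algebraMap ℂ K (α i)
  let q := values (algebraMap ℂ K h) a t₁ t₂
  have e₀ : a 1 = q 1 := rfl
  have e₁ : a 2 = q 2 := rfl
  have e₂ : a 3 = q 3 := rfl
  have e₃ : t₂ = q 6 := rfl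
  have e₄ : t₁ = q 6 + q 5 := by
    change _ = t₂ + (t₁ - t₂)
    ring
  have e₅ : a 4 = q 0 - q 1 - q 2 - q 3 - q 4 := by
    change _ = algebraMap ℂ K h - a 1 - a 2 - a 3 - (denom .g113 (algebraMap ℂ K h) a)
    simp only [denom]
    ring
  exact determined_of_realized hh hκ hp (by decide +kernel) (by decide +kernel) (by decide +kernel)
    (ham_eq e₀ e₁ e₂ e₃ e₄) (trans_eq e₀ e₁ e₂ e₃ e₄ e₅ (flavors_newChart h _))

end

end G113

namespace G122

/-- The values of the parameters. -/
def values {K : Type*} [Field K] (h : K) (a : ℕ → K) (t₁ t₂ : K) : ℕ → K :=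
  param [h, a 1, denom .g122 h a, a 3, a 4, t₁, t₂ / t₁]

section

variable {K A : Type*} [Field K] [Ring A] [Algebra K A] {h η t₁ t₂ : K} {a p : ℕ → K}
  (e₀ : t₂ / t₁ = p 6) (e₁ : a 1 = p 1) (e₂ : a 2 = p 2 - 2 * p 0 - p 1 - p 3 - 2 * p 4)
  (e₃ : a 3 = p 3) (e₄ : t₂ = p 6 * p 5) (e₅ : t₁ = p 5) (e₆ : a 4 = p 4)

include e₁ e₂ e₃ e₄ e₅ in
lemma ham_eq :
    hamiltonians .g122 h a η t₁ t₂ (FreeAlgebra.ι K .q₁) (FreeAlgebra.ι K .p₁)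
      (FreeAlgebra.ι K .q₂) (FreeAlgebra.ι K .p₂)
    = ((denom .g122 h a * t₁ * (t₁ - t₂))⁻¹ • system.H₁.eval (freeVal p),
      (denom .g122 h a * t₂ * (t₁ - t₂))⁻¹ • system.H₂.eval (freeVal p)) := by
  refine Prod.ext (congrArg (_ • ·) ?_) (congrArg (_ • ·) ?_)
  all_goals
    simp only [e₁, e₂, e₃, e₄, e₅, system, H₁, H₂, freeVal, Nat.add_sub_cancel_left, Ex.eval_add,
      Ex.eval_sub, Ex.eval_mul, Ex.eval_neg, Ex.eval_pow, Ex.eval_var, eval_one, eval_two,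
      eval_three, eval_four, Algebra.smul_def, map_add, map_sub, map_mul, map_pow, map_one,
      map_ofNat, map_neg, neg_mul]

include e₀ e₁ e₂ e₃ e₅ e₆ in
lemma trans_eq {c : Chart A} {G : Bool → Bool → ℕ → A} (hG : Flavors c p G) :
    transformations .g122 a η t₁ t₂ c =
      system.trans.map fun t v => (t.r v).eval (G t.b₁ t.b₂) := by
  simp only [transformations, trans122, e₀]
  refine congrArg₂ List.cons ?_ <| congrArg₂ List.cons ?_ <| congrArg₂ List.cons ?_ <| congrArg₂
    List.cons ?_ rfl
  all_goals
    ext v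
    cases v <;>
    simp only [e₁, e₂, e₃, e₅, e₆, subst, inversion₁, inversion₂, chart, cond_true, cond_false,
      hG.par, hG.X₁, hG.I₁, hG.Y₁, hG.X₁', hG.I₁', hG.Y₁', hG.X₂, hG.I₂, hG.Y₂, hG.X₂', hG.I₂',
      hG.Y₂', Ex.eval_add, Ex.eval_sub, Ex.eval_mul, Ex.eval_neg, Ex.eval_pow, Ex.eval_var,
      eval_one, eval_two, eval_three, eval_four, Algebra.smul_def, map_add, map_sub, map_mul,
      map_pow, map_one, map_ofNat, map_neg, neg_mul, neg_neg, mul_one, one_mul]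

end

section

variable {K : Type*} [Field K] [Algebra ℂ K] {D₁ D₂ : Derivation ℂ K K} {t₁ t₂ : K} {h κ : ℂ}
  {α : ℕ → ℂ} {η : ℂ}

lemma realized (h11 : D₁ t₁ = 1) (h12 : D₁ t₂ = 0) (h21 : D₂ t₁ = 0) (h22 : D₂ t₂ = 1)
    (hh : h ≠ 0) (hS : denom .g122 h α ≠ 0) :
    system.Realized
      (values (algebraMap ℂ K h) (fun i => algebraMap ℂ K (α i)) t₁ t₂) h D₁ D₂
      (denom .g122 (algebraMap ℂ K h) (fun i => algebraMap ℂ K (α i)) * t₁ * (t₁ - t₂))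
      (denom .g122 (algebraMap ℂ K h) (fun i => algebraMap ℂ K (α i)) * t₂ * (t₁ - t₂)) := by
  have : CharZero K := charZero_of_injective_algebraMap (algebraMap ℂ K).injective
  have n₁ : t₁ ≠ 0 := fun e => by simp [e] at h11
  have n₂ : t₂ ≠ 0 := fun e => by simp [e] at h22
  have n₅ : t₁ - t₂ ≠ 0 := fun e => by simp [sub_eq_zero.1 e, h12] at h11
  have n₆ : t₂ - t₁ ≠ 0 := fun e => n₅ (by linear_combination -e)
  have nS : algebraMap ℂ K (denom .g122 h α) ≠ 0 := (map_ne_zero (algebraMap ℂ K)).2 hS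
  rw [denom_algebraMap]
  set q := values (algebraMap ℂ K h) (fun i => algebraMap ℂ K (α i)) t₁ t₂ with hq
  refine ⟨rfl, units_of_forall₂ ?_, ?_, by simp [*], by simp [*], derivatives_of_forall₂ ?_,
    derivatives_of_forall₂ ?_⟩
  · simp [system, denom_algebraMap, *]
  · have w : parEval q [(0, 1), (256 ^ 6, -1)] ≠ 0 := by
      refine ne_of_eq_of_ne (b := (t₁ - t₂) / t₁) ?_ (div_ne_zero n₅ n₁)
      simp [q, parVal, values, param]
      field_simp
      ring
    simpa only [system, List.forall_mem_singleton] using w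
  · simp [system, q, derivation_div, values, param, denom_algebraMap, eval_zero, eval_one, eval_two,
      derivation_two, derivation_inv_two, h11, h12, h21, h22]
    refine ⟨Or.inl ?_, ?_⟩ <;> field_simp
  · simp [system, q, derivation_div, values, param, denom_algebraMap, eval_zero, eval_one, eval_two,
      derivation_two, derivation_inv_two, h11, h12, h21, h22]
    field_simp

lemma determined (h11 : D₁ t₁ = 1) (h12 : D₁ t₂ = 0) (h21 : D₂ t₁ = 0) (h22 : D₂ t₂ = 1)
    (hh : h ≠ 0) (hκ : κ ≠ 0) (hS : denom .g122 h α ≠ 0) :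
    Determined .g122 h κ α η D₁ D₂ t₁ t₂ := by
  have : CharZero K := charZero_of_injective_algebraMap (algebraMap ℂ K).injective
  have n₁ : t₁ ≠ 0 := fun e => by simp [e] at h11
  have n₂ : t₂ ≠ 0 := fun e => by simp [e] at h22
  have hp := realized h11 h12 h21 h22 hh hS
  let a (i : ℕ) : K := algebraMap ℂ K (α i)
  let q := values (algebraMap ℂ K h) a t₁ t₂
  have e₀ : t₂ / t₁ = q 6 := rfl
  have e₁ : a 1 = q 1 := rfl
  have e₂ : a 2 = q 2 - 2 * q 0 - q 1 - q 3 - 2 * q 4 := by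
    change _ = (denom .g122 (algebraMap ℂ K h) a) - 2 * algebraMap ℂ K h - a 1 - a 3 - 2 * a 4
    simp only [denom]
    ring
  have e₃ : a 3 = q 3 := rfl
  have e₄ : t₂ = q 6 * q 5 := by
    change _ = (t₂ / t₁) * t₁
    field_simp
  have e₅ : t₁ = q 5 := rfl
  have e₆ : a 4 = q 4 := rfl
  exact determined_of_realized hh hκ hp (by decide +kernel) (by decide +kernel) (by decide +kernel)
    (ham_eq e₁ e₂ e₃ e₄ e₅) (trans_eq e₀ e₁ e₂ e₃ e₅ e₆ (flavors_newChart h _))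

end

end G122

namespace G14

/-- The values of the parameters. -/
def values {K : Type*} [Field K] (h : K) (a : ℕ → K) (t₁ t₂ : K) : ℕ → K :=
  param [h, a 1, a 2, denom .g14 h a, (t₁ - t₂) / 2, t₂]

section

variable {K A : Type*} [Field K] [Ring A] [Algebra K A] {h η t₁ t₂ : K} {a p : ℕ → K}
  (e₀ : t₁ * (t₁ - t₂) / 2 = t₁ * p 4) (e₁ : t₂ * (t₁ - t₂) / 2 = t₂ * p 4)
  (e₂ : (t₁ - t₂) / 2 = p 4) (e₃ : a 1 = p 1) (e₄ : a 2 = p 2) (e₅ : t₂ = p 5)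
  (e₆ : t₁ = p 5 + 2 * p 4) (e₇ : a 3 = p 3 - 2 * p 0 - p 1 - p 2)

include e₀ e₁ e₂ e₃ e₄ e₅ e₆ in
lemma ham_eq :
    hamiltonians .g14 h a η t₁ t₂ (FreeAlgebra.ι K .q₁) (FreeAlgebra.ι K .p₁)
      (FreeAlgebra.ι K .q₂) (FreeAlgebra.ι K .p₂)
    = ((denom .g14 h a * (t₁ - t₂))⁻¹ • system.H₁.eval (freeVal p),
      (denom .g14 h a * (t₁ - t₂))⁻¹ • system.H₂.eval (freeVal p)) := by
  refine Prod.ext (congrArg (_ • ·) ?_) (congrArg (_ • ·) ?_)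
  all_goals
    try simp only [e₀, e₁, e₂]
    simp only [e₃, e₄, e₅, e₆, system, H₁, H₂, freeVal, Nat.add_sub_cancel_left, Ex.eval_add,
      Ex.eval_sub, Ex.eval_mul, Ex.eval_neg, Ex.eval_pow, Ex.eval_var, eval_one, eval_two,
      eval_three, eval_four, Algebra.smul_def, map_add, map_sub, map_mul, map_pow, map_one,
      map_ofNat, map_neg, neg_mul]

include e₂ e₃ e₄ e₆ e₇ in
lemma trans_eq {c : Chart A} {G : Bool → Bool → ℕ → A} (hG : Flavors c p G) :
    transformations .g14 a η t₁ t₂ c =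
      system.trans.map fun t v => (t.r v).eval (G t.b₁ t.b₂) := by
  simp only [transformations, trans14, e₂]
  refine congrArg₂ List.cons ?_ <| congrArg₂ List.cons ?_ <| congrArg₂ List.cons ?_ rfl
  all_goals
    ext v
    cases v <;>
    simp only [e₃, e₄, e₆, e₇, subst, inversion₁, inversion₂, chart, cond_true, cond_false,
      hG.par, hG.X₁, hG.I₁, hG.Y₁, hG.X₁', hG.I₁', hG.Y₁', hG.X₂, hG.I₂, hG.Y₂, hG.X₂', hG.I₂',
      hG.Y₂', Ex.eval_add, Ex.eval_sub, Ex.eval_mul, Ex.eval_neg, Ex.eval_pow, Ex.eval_var,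
      eval_one, eval_two, eval_three, eval_four, Algebra.smul_def, map_add, map_sub, map_mul,
      map_pow, map_one, map_ofNat, map_neg, neg_mul, neg_neg, mul_one, one_mul]

end

section

variable {K : Type*} [Field K] [Algebra ℂ K] {D₁ D₂ : Derivation ℂ K K} {t₁ t₂ : K} {h κ : ℂ}
  {α : ℕ → ℂ} {η : ℂ}

lemma realized (h11 : D₁ t₁ = 1) (h12 : D₁ t₂ = 0) (h21 : D₂ t₁ = 0) (h22 : D₂ t₂ = 1)
    (hh : h ≠ 0) (hS : denom .g14 h α ≠ 0) :
    system.Realized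
      (values (algebraMap ℂ K h) (fun i => algebraMap ℂ K (α i)) t₁ t₂) h D₁ D₂
      (denom .g14 (algebraMap ℂ K h) (fun i => algebraMap ℂ K (α i)) * (t₁ - t₂))
      (denom .g14 (algebraMap ℂ K h) (fun i => algebraMap ℂ K (α i)) * (t₁ - t₂)) := by
  have : CharZero K := charZero_of_injective_algebraMap (algebraMap ℂ K).injective
  have n₂ : t₂ ≠ 0 := fun e => by simp [e] at h22
  have n₅ : t₁ - t₂ ≠ 0 := fun e => by simp [sub_eq_zero.1 e, h12] at h11
  have n₆ : t₂ - t₁ ≠ 0 := fun e => n₅ (by linear_combination -e)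
  have nS : algebraMap ℂ K (denom .g14 h α) ≠ 0 := (map_ne_zero (algebraMap ℂ K)).2 hS
  rw [denom_algebraMap]
  set q := values (algebraMap ℂ K h) (fun i => algebraMap ℂ K (α i)) t₁ t₂ with hq
  refine ⟨rfl, units_of_forall₂ ?_, ?_, by simp [*], by simp [*], derivatives_of_forall₂ ?_,
    derivatives_of_forall₂ ?_⟩
  · simp [system, denom_algebraMap, *]
  · simp [system]
  · simp [system, q, derivation_div, values, param, denom_algebraMap, eval_zero, eval_one, eval_two,
      derivation_two, derivation_inv_two, h11, h12, h21, h22]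
    ring
  · simp [system, q, derivation_div, values, param, denom_algebraMap, eval_zero, eval_one, eval_two,
      derivation_two, derivation_inv_two, h11, h12, h21, h22]
    constructor <;> ring

lemma determined (h11 : D₁ t₁ = 1) (h12 : D₁ t₂ = 0) (h21 : D₂ t₁ = 0) (h22 : D₂ t₂ = 1)
    (hh : h ≠ 0) (hκ : κ ≠ 0) (hS : denom .g14 h α ≠ 0) :
    Determined .g14 h κ α η D₁ D₂ t₁ t₂ := by
  have : CharZero K := charZero_of_injective_algebraMap (algebraMap ℂ K).injective
  have n₂ : t₂ ≠ 0 := fun e => by simp [e] at h22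
  have hp := realized h11 h12 h21 h22 hh hS
  let a (i : ℕ) : K := algebraMap ℂ K (α i)
  let q := values (algebraMap ℂ K h) a t₁ t₂
  have e₀ : t₁ * (t₁ - t₂) / 2 = t₁ * q 4 := by
    change _ = t₁ * ((t₁ - t₂) / 2)
    ring
  have e₁ : t₂ * (t₁ - t₂) / 2 = t₂ * q 4 := by
    change _ = t₂ * ((t₁ - t₂) / 2)
    ring
  have e₂ : (t₁ - t₂) / 2 = q 4 := rfl
  have e₃ : a 1 = q 1 := rfl
  have e₄ : a 2 = q 2 := rfl
  have e₅ : t₂ = q 5 := rfl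
  have e₆ : t₁ = q 5 + 2 * q 4 := by
    change _ = t₂ + 2 * ((t₁ - t₂) / 2)
    ring
  have e₇ : a 3 = q 3 - 2 * q 0 - q 1 - q 2 := by
    change _ = (denom .g14 (algebraMap ℂ K h) a) - 2 * algebraMap ℂ K h - a 1 - a 2
    simp only [denom]
    ring
  exact determined_of_realized hh hκ hp (by decide +kernel) (by decide +kernel) (by decide +kernel)
    (ham_eq e₀ e₁ e₂ e₃ e₄ e₅ e₆) (trans_eq e₂ e₃ e₄ e₆ e₇ (flavors_newChart h _))

end

end G14

namespace G23

/-- The values of the parameters. -/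
def values {K : Type*} [Field K] (h : K) (a : ℕ → K) (η : K) (t₁ t₂ : K) : ℕ → K :=
  param [h, a 1, a 2, denom .g23 h a, η, t₁, t₂, 1 / 2]

section

variable {K A : Type*} [Field K] [Ring A] [Algebra K A] {h η t₁ t₂ : K} {a p : ℕ → K}
  (e₀ : (1 / 2 : K) = p 7) (e₁ : a 1 / 2 = a 1 * p 7) (e₂ : t₂ / 2 = t₂ * p 7)
  (e₃ : 1 + h + 2 * a 1 - a 2 + 2 * a 3 = h + a 1 + (p 3 - 3 * p 0 - p 1 - p 2))
  (e₄ : 1 + a 1 - a 2 + 2 * a 3 = p 3 - 3 * p 0 - p 1 - p 2) (e₅ : h = p 0) (e₆ : a 1 = p 1)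
  (e₇ : η = p 4) (e₈ : t₁ = p 5) (e₉ : t₂ = p 6) (e₁₀ : a 2 = p 2)

include e₀ e₁ e₂ e₃ e₅ e₆ e₇ e₈ e₉ in
lemma ham_eq :
    hamiltonians .g23 h a η t₁ t₂ (FreeAlgebra.ι K .q₁) (FreeAlgebra.ι K .p₁)
      (FreeAlgebra.ι K .q₂) (FreeAlgebra.ι K .p₂)
    = ((denom .g23 h a * t₁)⁻¹ • system.H₁.eval (freeVal p),
      (denom .g23 h a)⁻¹ • system.H₂.eval (freeVal p)) := by
  refine Prod.ext (congrArg (_ • ·) ?_) (congrArg (_ • ·) ?_)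
  all_goals
    try simp only [e₀, e₁, e₂, e₃]
    simp only [e₅, e₆, e₇, e₈, e₉, system, H₁, H₂, freeVal, Nat.add_sub_cancel_left, Ex.eval_add,
      Ex.eval_sub, Ex.eval_mul, Ex.eval_neg, Ex.eval_pow, Ex.eval_var, eval_one, eval_two,
      eval_three, eval_four, Algebra.smul_def, map_add, map_sub, map_mul, map_pow, map_one,
      map_ofNat, map_neg, neg_mul]

include e₀ e₄ e₆ e₇ e₈ e₉ e₁₀ in
lemma trans_eq {c : Chart A} {G : Bool → Bool → ℕ → A} (hG : Flavors c p G) :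
    transformations .g23 a η t₁ t₂ c =
      system.trans.map fun t v => (t.r v).eval (G t.b₁ t.b₂) := by
  simp only [transformations, trans23, e₀, e₄]
  refine congrArg₂ List.cons ?_ <| congrArg₂ List.cons ?_ <| congrArg₂ List.cons ?_ <| congrArg₂
    List.cons ?_ <| congrArg₂ List.cons ?_ <| congrArg₂ List.cons ?_ rfl
  all_goals
    ext v
    cases v <;>
    simp only [e₆, e₇, e₈, e₉, e₁₀, subst, projective₁, projective₂, chart, cond_true, cond_false,
      hG.par, hG.X₁, hG.I₁, hG.Y₁, hG.X₁', hG.I₁', hG.Y₁', hG.X₂, hG.I₂, hG.Y₂, hG.X₂', hG.I₂',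
      hG.Y₂', Ex.eval_add, Ex.eval_sub, Ex.eval_mul, Ex.eval_neg, Ex.eval_pow, Ex.eval_var,
      eval_one, eval_two, eval_three, eval_four, Algebra.smul_def, map_add, map_sub, map_mul,
      map_pow, map_one, map_ofNat, map_neg, neg_mul, neg_neg, mul_one, one_mul]

end

section

variable {K : Type*} [Field K] [Algebra ℂ K] {D₁ D₂ : Derivation ℂ K K} {t₁ t₂ : K} {h κ : ℂ}
  {α : ℕ → ℂ} {η : ℂ}

lemma realized (h11 : D₁ t₁ = 1) (h12 : D₁ t₂ = 0) (h21 : D₂ t₁ = 0) (h22 : D₂ t₂ = 1)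
    (hh : h ≠ 0) (hS : denom .g23 h α ≠ 0) (hη : η ≠ 0) :
    system.Realized
      (values (algebraMap ℂ K h) (fun i => algebraMap ℂ K (α i)) (algebraMap ℂ K η) t₁ t₂) h D₁ D₂
      (denom .g23 (algebraMap ℂ K h) (fun i => algebraMap ℂ K (α i)) * t₁)
      (denom .g23 (algebraMap ℂ K h) (fun i => algebraMap ℂ K (α i))) := by
  have : CharZero K := charZero_of_injective_algebraMap (algebraMap ℂ K).injective
  have n₁ : t₁ ≠ 0 := fun e => by simp [e] at h11
  have n₂ : t₂ ≠ 0 := fun e => by simp [e] at h22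
  have nη : algebraMap ℂ K η ≠ 0 := (map_ne_zero (algebraMap ℂ K)).2 hη
  have nS : algebraMap ℂ K (denom .g23 h α) ≠ 0 := (map_ne_zero (algebraMap ℂ K)).2 hS
  rw [denom_algebraMap]
  set q := values (algebraMap ℂ K h) (fun i => algebraMap ℂ K (α i)) (algebraMap ℂ K η) t₁ t₂ with
    hq
  refine ⟨rfl, units_of_forall₂ ?_, ?_, by simp [*], by simp [*], derivatives_of_forall₂ ?_,
    derivatives_of_forall₂ ?_⟩
  · simp [system, denom_algebraMap, *]
  · simp [system]
  · simp [system, q, derivation_div, values, param, denom_algebraMap, eval_zero, eval_one, eval_two,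
      derivation_two, derivation_inv_two, h11, h12, h21, h22]
  · simp [system, q, derivation_div, values, param, denom_algebraMap, eval_zero, eval_one, eval_two,
      derivation_two, derivation_inv_two, h11, h12, h21, h22]

lemma determined (h11 : D₁ t₁ = 1) (h12 : D₁ t₂ = 0) (h21 : D₂ t₁ = 0) (h22 : D₂ t₂ = 1)
    (hh : h ≠ 0) (hκ : κ ≠ 0) (hS : denom .g23 h α ≠ 0) (hη : η ≠ 0) :
    Determined .g23 h κ α η D₁ D₂ t₁ t₂ := by
  have : CharZero K := charZero_of_injective_algebraMap (algebraMap ℂ K).injective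
  have n₁ : t₁ ≠ 0 := fun e => by simp [e] at h11
  have n₂ : t₂ ≠ 0 := fun e => by simp [e] at h22
  have hp := realized h11 h12 h21 h22 hh hS hη
  let a (i : ℕ) : K := algebraMap ℂ K (α i)
  let q := values (algebraMap ℂ K h) a (algebraMap ℂ K η) t₁ t₂
  have e₀ : (1 / 2 : K) = q 7 := rfl
  have e₁ : a 1 / 2 = a 1 * q 7 := by
    change _ = a 1 * (1 / 2)
    ring
  have e₂ : t₂ / 2 = t₂ * q 7 := by
    change _ = t₂ * (1 / 2)
    ring
  have e₃ : 1 + algebraMap ℂ K h + 2 * a 1 - a 2 + 2 * a 3 = algebraMap ℂ K h + a 1 + (q 3 - 3 * q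
      0 - q 1 - q 2) := by
    change _ = algebraMap ℂ K h + a 1 + ((denom .g23 (algebraMap ℂ K h) a) - 3 * algebraMap ℂ K h
      - a 1 - a 2)
    simp only [denom]
    ring
  have e₄ : 1 + a 1 - a 2 + 2 * a 3 = q 3 - 3 * q 0 - q 1 - q 2 := by
    change _ = (denom .g23 (algebraMap ℂ K h) a) - 3 * algebraMap ℂ K h - a 1 - a 2
    simp only [denom]
    ring
  have e₅ : algebraMap ℂ K h = q 0 := rfl
  have e₆ : a 1 = q 1 := rfl
  have e₇ : algebraMap ℂ K η = q 4 := rfl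
  have e₈ : t₁ = q 5 := rfl
  have e₉ : t₂ = q 6 := rfl
  have e₁₀ : a 2 = q 2 := rfl
  exact determined_of_realized hh hκ hp (by decide +kernel) (by decide +kernel) (by decide +kernel)
    (ham_eq e₀ e₁ e₂ e₃ e₅ e₆ e₇ e₈ e₉) (trans_eq e₀ e₄ e₆ e₇ e₈ e₉ e₁₀ (flavors_newChart h _))

end

end G23

namespace G5

/-- The values of the parameters. -/
def values {K : Type*} [Field K] (h : K) (a : ℕ → K) (t₁ t₂ : K) : ℕ → K :=
  param [h, a 1, denom .g5 h a, t₁, t₂]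

section

variable {K A : Type*} [Field K] [Ring A] [Algebra K A] {h η t₁ t₂ : K} {a p : ℕ → K}
  (e₀ : a 1 - 2 * a 2 = p 2 - 3 * p 0 - p 1) (e₁ : a 1 = p 1) (e₂ : t₁ = p 3) (e₃ : t₂ = p 4)

include e₁ e₂ e₃ in
lemma ham_eq :
    hamiltonians .g5 h a η t₁ t₂ (FreeAlgebra.ι K .q₁) (FreeAlgebra.ι K .p₁)
      (FreeAlgebra.ι K .q₂) (FreeAlgebra.ι K .p₂)
    = ((denom .g5 h a)⁻¹ • system.H₁.eval (freeVal p),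
      (denom .g5 h a)⁻¹ • system.H₂.eval (freeVal p)) := by
  refine Prod.ext (congrArg (_ • ·) ?_) (congrArg (_ • ·) ?_)
  all_goals
    simp only [e₁, e₂, e₃, system, H₁, H₂, freeVal, Nat.add_sub_cancel_left, Ex.eval_add,
      Ex.eval_sub, Ex.eval_mul, Ex.eval_neg, Ex.eval_pow, Ex.eval_var, eval_one, eval_two,
      eval_three, eval_four, Algebra.smul_def, map_add, map_sub, map_mul, map_pow, map_one,
      map_ofNat, map_neg, neg_mul]

include e₀ e₁ e₂ e₃ in
lemma trans_eq {c : Chart A} {G : Bool → Bool → ℕ → A} (hG : Flavors c p G) :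
    transformations .g5 a η t₁ t₂ c =
      system.trans.map fun t v => (t.r v).eval (G t.b₁ t.b₂) := by
  simp only [transformations, trans5, e₀]
  refine congrArg₂ List.cons ?_ <| congrArg₂ List.cons ?_ <| congrArg₂ List.cons ?_ <| congrArg₂
    List.cons ?_ rfl
  all_goals
    ext v
    cases v <;>
    simp only [e₁, e₂, e₃, subst, projective₁, projective₂, chart, cond_true, cond_false, hG.par,
      hG.X₁, hG.I₁, hG.Y₁, hG.X₁', hG.I₁', hG.Y₁', hG.X₂, hG.I₂, hG.Y₂, hG.X₂', hG.I₂', hG.Y₂',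
      Ex.eval_add, Ex.eval_sub, Ex.eval_mul, Ex.eval_neg, Ex.eval_pow, Ex.eval_var, eval_one,
      eval_two, eval_three, eval_four, Algebra.smul_def, map_add, map_sub, map_mul, map_pow,
      map_one, map_ofNat, map_neg, neg_mul, neg_neg, mul_one, one_mul]
    try abel

end

section

variable {K : Type*} [Field K] [Algebra ℂ K] {D₁ D₂ : Derivation ℂ K K} {t₁ t₂ : K} {h κ : ℂ}
  {α : ℕ → ℂ} {η : ℂ}

lemma realized (h11 : D₁ t₁ = 1) (h12 : D₁ t₂ = 0) (h21 : D₂ t₁ = 0) (h22 : D₂ t₂ = 1)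
    (hh : h ≠ 0) (hS : denom .g5 h α ≠ 0) :
    system.Realized
      (values (algebraMap ℂ K h) (fun i => algebraMap ℂ K (α i)) t₁ t₂) h D₁ D₂
      (denom .g5 (algebraMap ℂ K h) (fun i => algebraMap ℂ K (α i)))
      (denom .g5 (algebraMap ℂ K h) (fun i => algebraMap ℂ K (α i))) := by
  have : CharZero K := charZero_of_injective_algebraMap (algebraMap ℂ K).injective
  have n₁ : t₁ ≠ 0 := fun e => by simp [e] at h11
  have n₂ : t₂ ≠ 0 := fun e => by simp [e] at h22
  have nS : algebraMap ℂ K (denom .g5 h α) ≠ 0 := (map_ne_zero (algebraMap ℂ K)).2 hS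
  rw [denom_algebraMap]
  set q := values (algebraMap ℂ K h) (fun i => algebraMap ℂ K (α i)) t₁ t₂ with hq
  refine ⟨rfl, units_of_forall₂ ?_, ?_, by simp [*], by simp [*], derivatives_of_forall₂ ?_,
    derivatives_of_forall₂ ?_⟩
  · simp [system, denom_algebraMap, *]
  · simp [system]
  · simp [system, q, derivation_div, values, param, denom_algebraMap, eval_zero, eval_one, eval_two,
      derivation_two, derivation_inv_two, h11, h12, h21, h22]
  · simp [system, q, derivation_div, values, param, denom_algebraMap, eval_zero, eval_one, eval_two,
      derivation_two, derivation_inv_two, h11, h12, h21, h22]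

lemma determined (h11 : D₁ t₁ = 1) (h12 : D₁ t₂ = 0) (h21 : D₂ t₁ = 0) (h22 : D₂ t₂ = 1)
    (hh : h ≠ 0) (hκ : κ ≠ 0) (hS : denom .g5 h α ≠ 0) :
    Determined .g5 h κ α η D₁ D₂ t₁ t₂ := by
  have : CharZero K := charZero_of_injective_algebraMap (algebraMap ℂ K).injective
  have n₁ : t₁ ≠ 0 := fun e => by simp [e] at h11
  have n₂ : t₂ ≠ 0 := fun e => by simp [e] at h22
  have hp := realized h11 h12 h21 h22 hh hS
  let a (i : ℕ) : K := algebraMap ℂ K (α i)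
  let q := values (algebraMap ℂ K h) a t₁ t₂
  have e₀ : a 1 - 2 * a 2 = q 2 - 3 * q 0 - q 1 := by
    change _ = (denom .g5 (algebraMap ℂ K h) a) - 3 * algebraMap ℂ K h - a 1
    simp only [denom]
    ring
  have e₁ : a 1 = q 1 := rfl
  have e₂ : t₁ = q 3 := rfl
  have e₃ : t₂ = q 4 := rfl
  exact determined_of_realized hh hκ hp (by decide +kernel) (by decide +kernel) (by decide +kernel)
    (ham_eq e₁ e₂ e₃) (trans_eq e₀ e₁ e₂ e₃ (flavors_newChart h _))

end

end G5

end Data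

end QuantumGarnier

theorem theorem3p1 {K : Type*} [Field K] [Algebra ℂ K]
    (D₁ D₂ : Derivation ℂ K K) (t₁ t₂ : K)
    (h11 : D₁ t₁ = 1) (h12 : D₁ t₂ = 0) (h21 : D₂ t₁ = 0) (h22 : D₂ t₂ = 1)
    (h κ : ℂ) (hh : h ≠ 0) (hκ : κ ≠ 0)
    (k : QuantumGarnier.Kind) (α : ℕ → ℂ) (η : ℂ)
    (hnd : QuantumGarnier.Nondegenerate k h α η) :
    (QuantumGarnier.TotalDegreeLE 5 (QuantumGarnier.garnierHamiltonians k h α η t₁ t₂).1 ∧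
      QuantumGarnier.TotalDegreeLE 5 (QuantumGarnier.garnierHamiltonians k h α η t₁ t₂).2) ∧
    ∀ H₁ H₂ : FreeAlgebra K QuantumGarnier.Var,
      QuantumGarnier.TotalDegreeLE 5 H₁ → QuantumGarnier.TotalDegreeLE 5 H₂ →
      (QuantumGarnier.HolomorphyCondition k h κ α η D₁ D₂ t₁ t₂ H₁ H₂ ↔
        ∃ c₁ c₂ : K,
          QuantumGarnier.toWeyl h H₁ =
            (-(κ * h))⁻¹ • QuantumGarnier.toWeyl h
              (QuantumGarnier.garnierHamiltonians k h α η t₁ t₂).1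
              + algebraMap K (QuantumGarnier.WeylK K h) c₁ ∧
          QuantumGarnier.toWeyl h H₂ =
            (-(κ * h))⁻¹ • QuantumGarnier.toWeyl h
              (QuantumGarnier.garnierHamiltonians k h α η t₁ t₂).2
              + algebraMap K (QuantumGarnier.WeylK K h) c₂) := by
  cases k
  · exact QuantumGarnier.Data.G11111.determined h11 h12 h21 h22 hh hκ hnd.1 hnd.2
  · exact QuantumGarnier.Data.G1112.determined h11 h12 h21 h22 hh hκ hnd.1 hnd.2.1 hnd.2.2
  · exact QuantumGarnier.Data.G113.determined h11 h12 h21 h22 hh hκ hnd.1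
  · exact QuantumGarnier.Data.G122.determined h11 h12 h21 h22 hh hκ hnd.1
  · exact QuantumGarnier.Data.G14.determined h11 h12 h21 h22 hh hκ hnd.1
  · exact QuantumGarnier.Data.G23.determined h11 h12 h21 h22 hh hκ hnd.1 hnd.2
  · exact QuantumGarnier.Data.G5.determined h11 h12 h21 h22 hh hκ hnd.1
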